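/- Let $k$ be a field. **Setting.** A *finite ordered quiver with tensor relations* $(Q,R)$ over $k$ consists of a quiver $Q$ with finitely many vertices and arrows and no nontrivial oriented cycles, and a set $R$ of elements of the path algebra $kQ$ that are linear combinations of nontrivial paths, such that the category $(Q,R)\text{-Rep}$ of finite dimensional representations of $Q$ over $k$ that satisfy the relations in $R$ contains the unit representation $U$ ($k$ at every vertex, the identity along every arrow) and is closed under the vertexwise tensor product. In $kQ$ the product $pq$ is "first $p$, then $q$", so that representations are right modules over $\Lambda:=kQ/(R)$, where $(R)$ is the two-sided ideal generated by $R$. Let $D(Q)$ be the bounded derived category of the abelian category $(Q,R)\text{-Rep}$, a $k$-linear tensor triangulated category with the tensor product induced by the exact vertexwise tensor product, and let $D^b(k)$ be the bounded derived category of finite dimensional vector spaces with its tensor product. For a $k$-linear tensor triangulated category $T$, let $T(k)$ be the set of isomorphism classes of $k$-linear exact functors $F:T\to D^b(k)$ that preserve the tensor products and the unit objects. Here an exact functor comes with its commutation isomorphisms with the shift, and a morphism $F\to G$ is a natural transformation that is compatible with the shift; $\mathrm{Hom}(F,G)$ denotes the $k$-vector space of these, and isomorphisms are those of this category. Choose a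 representative of each class. If $T(k)$ is finite, then $$A(T):=\prod_{F,G\in T(k)}\mathrm{Hom}(F,G)$$ is a $k$-algebra: $(\alpha\beta)_{F,H}=\sum_{G}\beta_{G,H}\circ\alpha_{F,G}$, that is, composable elements are multiplied by composition and the product of elements that are not composable is zero. **Theorem.** For every finite ordered quiver with tensor relations $(Q,R)$ the set $D(Q)(k)$ is finite, and there are isomorphisms of $k$-algebras $$\Phi_Q:\ kQ/(R)\ \xrightarrow{\ \sim\ }\ A(D(Q)),$$ for all finite ordered quivers with tensor relations, with the following properties. 1. *(Description.)* There are a bijection $n\mapsto F_n$ from the set of vertices of $Q$ to $D(Q)(k)$ and isomorphisms $\theta_n:F_n(V)\cong V_n$, natural in the bounded complex $V$ of representations, such that for every linear combination $p$ of paths from $n$ to $m$ the component of $\Phi_Q(p)$ in $\mathrm{Hom}(F_n,F_m)$ corresponds under $\theta_n,\theta_m$ to the action $V_n\to V_m$ of $p$, and similarly, componentwise, for every element of $kQ$. 2. *(Naturality.)* Let $(Q,R)$ and $(Q',R')$ be finite ordered quivers with tensor relations, $\Lambda=kQ/(R)$, $\Lambda'=kQ'/(R')$, let $f:\Lambda\to\Lambda'$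 be a homomorphism of $k$-algebras, and suppose that the functor $D(Q')\to D(Q)$ given by restriction of scalars along $f$ underlies (i.e. agrees on bounded complexes of representations, up to natural isomorphism, with) a $k$-linear exact functor $u$ that preserves the tensor products and the unit objects. Then $F\mapsto \sigma(F):=[F\circ u]$ is a bijection $D(Q)(k)\to D(Q')(k)$, and there are isomorphisms $\kappa_F:F\circ u\cong\sigma(F)$ such that the induced homomorphism of $k$-algebras $$u^*:A(D(Q))\to A(D(Q')),\qquad u^*(\alpha)_{\sigma(F),\sigma(G)}=\kappa_G\circ\alpha_{F,G}u\circ\kappa_F^{-1},$$ satisfies $u^*\circ\Phi_Q=\Phi_{Q'}\circ f$ if $f$ sends the class of each trivial path to the class of a trivial path; for arbitrary such $f$ there is a unit $c$ of $\Lambda'$ with $u^*(\Phi_Q(x))=\Phi_{Q'}(c^{-1}f(x)c)$ for all $x\in\Lambda$. -/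

import Mathlib

open CategoryTheory Limits

set_option linter.unusedSectionVars false
set_option linter.checkUnivs false

noncomputable section

namespace QuiverPoints

/-! ### The bounded derived category of an abelian category -/

section BoundedDerived

open Pretriangulated HomotopicalAlgebra ZeroObject

variable (A : Type*) [Category* A] [Abelian A]

/-- The property of being a bounded cochain complex. -/
def bounded : ObjectProperty (CochainComplex A ℤ) :=
  fun K ↦ (∃ n : ℤ, K.IsStrictlyGE n) ∧ ∃ n : ℤ, K.IsStrictlyLE n

/-- The category of bounded cochain complexes. -/
abbrev Cb := (bounded A).FullSubcategory

/-- Quasi-isomorphisms of bounded cochain complexes. -/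
def quasiIsoCb : MorphismProperty (Cb A) :=
  (HomologicalComplex.quasiIso A (ComplexShape.up ℤ)).inverseImage (bounded A).ι

/-- The bounded complexes, as objects of the homotopy category. -/
def boundedK : ObjectProperty (HomotopyCategory A (ComplexShape.up ℤ)) :=
  (bounded A).strictMap (HomotopyCategory.quotient _ _)

/-- The bounded homotopy category. -/
abbrev Kb := (boundedK A).FullSubcategory

variable {A} in
lemma boundedK_quotient_obj_iff (K : CochainComplex A ℤ) :
    boundedK A ((HomotopyCategory.quotient _ _).obj K) ↔ bounded A K := by
  refine ⟨?_, fun h ↦ ⟨_, h⟩⟩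
  simp only [boundedK, ObjectProperty.strictMap_iff]
  rintro ⟨L, h, hL⟩
  obtain rfl : L = K := congr_arg Quotient.as hL
  exact h

instance : (boundedK A).ContainsZero where
  exists_zero :=
    ⟨(HomotopyCategory.quotient _ _).obj 0, Functor.map_isZero _ (isZero_zero _), by
      simp only [boundedK_quotient_obj_iff]
      exact ⟨⟨0, inferInstance⟩, ⟨0, inferInstance⟩⟩⟩

instance : (boundedK A).IsStableUnderShift ℤ where
  isStableUnderShiftBy n :=
    { le_shift K hK := by
        obtain ⟨K : CochainComplex _ _, rfl⟩ := K.quotient_obj_surjective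
        simp only [boundedK_quotient_obj_iff] at hK
        obtain ⟨⟨q, _⟩, ⟨r, _⟩⟩ := hK
        rw [ObjectProperty.prop_shift_iff, HomotopyCategory.shift_quotient_obj,
          boundedK_quotient_obj_iff]
        exact ⟨⟨q - n, K.isStrictlyGE_shift q n (q - n) (by lia)⟩,
          ⟨r - n, K.isStrictlyLE_shift r n (r - n) (by lia)⟩⟩ }

instance : (boundedK A).IsTriangulatedClosed₃ where
  ext₃' T hT h₁ h₂ := by
    obtain ⟨⟨m₁, _⟩, ⟨n₁, _⟩⟩ : (bounded A) T.obj₁.as := by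
      rwa [← boundedK_quotient_obj_iff]
    obtain ⟨⟨m₂, _⟩, ⟨n₂, _⟩⟩ : (bounded A) T.obj₂.as := by
      rwa [← boundedK_quotient_obj_iff]
    obtain ⟨f : T.obj₁.as ⟶ T.obj₂.as, hf⟩ :=
      (HomotopyCategory.quotient _ _).map_surjective T.mor₁
    refine ⟨_, ?_,
      ⟨Triangle.π₃.mapIso (isoTriangleOfIso₁₂ T _ hT
        (HomotopyCategory.mappingCone_triangleh_distinguished f)
        (Iso.refl _) (Iso.refl _) ?_)⟩⟩
    · refine (boundedK_quotient_obj_iff (CochainComplex.mappingCone f)).2 ?_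
      refine ⟨⟨min (m₁ - 1) m₂, CochainComplex.isStrictlyGE_mappingCone f m₁ m₂ _
        (by simp) (by simp)⟩, ⟨max n₁ n₂, ?_⟩⟩
      rw [CochainComplex.isStrictlyLE_iff]
      intro i hi
      simp only [sup_lt_iff] at hi
      simp only [CochainComplex.mappingCone.isZero_X_iff]
      exact ⟨CochainComplex.isZero_of_isStrictlyLE _ n₁ _ (by lia),
        CochainComplex.isZero_of_isStrictlyLE _ n₂ _ (by lia)⟩
    · exact (Category.comp_id _).trans (hf.symm.trans (Category.id_comp _).symm)

instance : (boundedK A).IsTriangulated where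
  toIsTriangulatedClosed₂ := .of_isTriangulatedClosed₃

/-- The acyclic bounded complexes. -/
abbrev acyclicKb : ObjectProperty (Kb A) :=
  (HomotopyCategory.subcategoryAcyclic A).inverseImage (boundedK A).ι

/-- The bounded derived category of `A`: the Verdier quotient of the bounded homotopy category
by the acyclic complexes. -/
def Db := (acyclicKb A).trW.Localization

instance : Category (Db A) := inferInstanceAs (Category (acyclicKb A).trW.Localization)

/-- The localization functor `Kᵇ(A) ⥤ Dᵇ(A)`. -/
def Qh : Kb A ⥤ Db A := (acyclicKb A).trW.Q

instance : (Qh A).IsLocalization (acyclicKb A).trW :=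
  inferInstanceAs ((acyclicKb A).trW.Q.IsLocalization _)

instance : Preadditive (Db A) := Localization.preadditive (Qh A) (acyclicKb A).trW

instance : (Qh A).Additive := Localization.functor_additive (Qh A) (acyclicKb A).trW

instance : HasZeroObject (Db A) := Functor.hasZeroObject_of_additive (Qh A)

instance : HasShift (Db A) ℤ := HasShift.localized (Qh A) (acyclicKb A).trW ℤ

instance : (Qh A).CommShift ℤ := Functor.CommShift.localized (Qh A) (acyclicKb A).trW ℤ

instance (n : ℤ) : (shiftFunctor (Db A) n).Additive := by
  rw [Localization.functor_additive_iff (Qh A) (acyclicKb A).trW]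
  exact Functor.additive_of_iso ((Qh A).commShiftIso n)

instance : Pretriangulated (Db A) := Triangulated.Localization.pretriangulated (Qh A) (acyclicKb A).trW

instance : (Qh A).IsTriangulated :=
  Triangulated.Localization.isTriangulated_functor (Qh A) (acyclicKb A).trW

/-- The functor from bounded complexes to the bounded homotopy category. -/
def quotientb : Cb A ⥤ Kb A :=
  ObjectProperty.lift _ ((bounded A).ι ⋙ HomotopyCategory.quotient A (ComplexShape.up ℤ)) (by
    rintro ⟨K, h⟩
    simpa [boundedK_quotient_obj_iff])

/-- The functor sending a bounded complex to the corresponding object of `Dᵇ(A)`. -/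
def Q : Cb A ⥤ Db A := quotientb A ⋙ Qh A

variable {A} in
lemma quotientb_obj_surjective : Function.Surjective (quotientb A).obj :=
  fun K ↦ by
    obtain ⟨L, hL⟩ := HomotopyCategory.quotient_obj_surjective K.obj
    refine ⟨⟨L, ?_⟩, by ext; exact hL⟩
    rw [← boundedK_quotient_obj_iff, hL]
    exact K.property

instance : (quotientb A).EssSurj where
  mem_essImage K := by
    obtain ⟨L, rfl⟩ := quotientb_obj_surjective K
    exact ⟨L, ⟨Iso.refl _⟩⟩

instance : (quotientb A).Full := by dsimp [quotientb]; infer_instance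

lemma bounded_cylinder (K : CochainComplex A ℤ) (hK : bounded A K) :
    bounded A (HomologicalComplex.cylinder K) := by
  obtain ⟨hm, ⟨n, hn⟩⟩ := hK
  refine ⟨K.plus_cylinder hm, ⟨n, ?_⟩⟩
  rw [CochainComplex.isStrictlyLE_iff]
  intro i hi
  change IsZero ((HomologicalComplex.homotopyCofiber (biprod.lift (𝟙 K) (-𝟙 K))).X i)
  refine HomologicalComplex.homotopyCofiber.isZero_X (biprod.lift (𝟙 K) (-𝟙 K)) _ ?_ (fun j hj ↦ ?_)
  · refine IsZero.of_iso ?_ ((HomologicalComplex.eval A (.up ℤ) i).mapBiprod _ _)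
    exact (biprod_isZero_iff _ _).2
      ⟨K.isZero_of_isStrictlyLE n i, K.isZero_of_isStrictlyLE n i⟩
  · simp only [ComplexShape.up_Rel] at hj
    exact K.isZero_of_isStrictlyLE n _ (by lia)

instance : (quotientb A).IsLocalization
    ((HomologicalComplex.homotopyEquivalences A (.up ℤ)).inverseImage (bounded A).ι) :=
  Functor.isLocalization_of_essSurj_of_full_of_exists_cylinders _ _
    (fun K L f hf ↦ by
      rw [← isIso_iff_of_reflects_iso _ (boundedK A).ι]
      have : (MorphismProperty.isomorphisms _).inverseImage
          (HomotopyCategory.quotient A (.up ℤ)) ((bounded A).ι.map f) := by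
        rw [HomotopyCategory.inverseImage_quotient_isomorphisms]
        exact hf
      exact this) (by
    rintro K L f₀ f₁ hf
    obtain ⟨f₀, rfl⟩ := ObjectProperty.homMk_surjective f₀
    obtain ⟨f₁, rfl⟩ := ObjectProperty.homMk_surjective f₁
    replace hf := HomotopyCategory.homotopyOfEq f₀ f₁ ((boundedK A).ι.congr_map hf)
    exact ⟨K.obj.precylinder.toFullSubcategory (bounded_cylinder A _ K.property),
      Precylinder.LeftHomotopy.fullSubcategoryEquiv.symm
      { h := HomologicalComplex.cylinder.desc _ _ hf
        h₀ := HomologicalComplex.cylinder.ι₀_desc _ _ hf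
        h₁ := HomologicalComplex.cylinder.ι₁_desc _ _ hf },
      ⟨HomologicalComplex.cylinder.homotopyEquiv _ (fun n ↦ ⟨n - 1, by simp⟩), rfl⟩⟩)

lemma trW_acyclicKb_iff {K L : Kb A} (f : K ⟶ L) :
    (acyclicKb A).trW f ↔ HomotopyCategory.quasiIso A (.up ℤ) f.hom := by
  obtain ⟨M, g, h, mem⟩ := CategoryTheory.Pretriangulated.distinguished_cocone_triangle f
  have h₁ := (HomotopyCategory.subcategoryAcyclic A).trW_iff_of_distinguished _
    ((boundedK A).ι.map_distinguished _ mem)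
  rw [← HomotopyCategory.quasiIso_eq_trW_subcategoryAcyclic] at h₁
  exact ((acyclicKb A).trW_iff_of_distinguished _ mem).trans h₁.symm

lemma trW_quotientb_iff {K L : Cb A} (f : K ⟶ L) :
    (acyclicKb A).trW ((quotientb A).map f) ↔ quasiIsoCb A f := by
  rw [trW_acyclicKb_iff]
  exact HomotopyCategory.quotient_map_mem_quasiIso_iff f.hom

instance : (Q A).IsLocalization (quasiIsoCb A) := by
  refine Functor.IsLocalization.comp (quotientb A) (Qh A)
    ((HomologicalComplex.homotopyEquivalences A (.up ℤ)).inverseImage (bounded A).ι)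
    (acyclicKb A).trW (quasiIsoCb A) ?_ ?_ ?_
  · intro K L f hf
    exact Localization.inverts (Qh A) (acyclicKb A).trW _ ((trW_quotientb_iff A f).2 hf)
  · intro K L f hf
    exact homotopyEquivalences_le_quasiIso A (.up ℤ) _ hf
  · intro K L f hf
    obtain ⟨K, rfl⟩ := quotientb_obj_surjective K
    obtain ⟨L, rfl⟩ := quotientb_obj_surjective L
    obtain ⟨f, rfl⟩ := (quotientb A).map_surjective f
    exact MorphismProperty.map_mem_map _ _ _ ((trW_quotientb_iff A f).1 hf)

section Linear

variable (k : Type*) [Ring k] [Linear k A]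

instance : Linear k (Db A) := Localization.linear k (Qh A) (acyclicKb A).trW

instance : (Qh A).Linear k := Localization.functor_linear k (Qh A) (acyclicKb A).trW

instance (n : ℤ) : (shiftFunctor (Kb A) n).Linear k where
  map_smul f r := by
    apply (boundedK A).ι.map_injective
    have : (shiftFunctor (Kb A) n ⋙ (boundedK A).ι).Linear k :=
      Functor.linear_of_iso k ((boundedK A).ι.commShiftIso n).symm
    exact (shiftFunctor (Kb A) n ⋙ (boundedK A).ι).map_smul r f

instance (n : ℤ) : (shiftFunctor (Db A) n).Linear k :=
  Shift.linear_of_localization k (Qh A) (acyclicKb A).trW n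

end Linear

end BoundedDerived

/-! ### The tensor product of bounded complexes and of the bounded derived category -/

section Tensor

open MonoidalCategory

variable {B : Type*} [Category* B] [Abelian B] [MonoidalCategory B] [MonoidalPreadditive B]
  [HasColimitsOfSize.{0, 0} B]
  [∀ X : B, PreservesColimitsOfSize.{0, 0} ((curriedTensor B).obj X)]
  [∀ X : B, PreservesColimitsOfSize.{0, 0} ((curriedTensor B).flip.obj X)]

section

variable (P : ObjectProperty B) [P.ContainsZero] [P.IsClosedUnderKernels]
  [P.IsClosedUnderCokernels] [P.IsClosedUnderFiniteProducts]

lemma isClosedUnderIsomorphisms_of_products : P.IsClosedUnderIsomorphisms where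
  of_iso {X Y} e hX := by
    have : IsLimit (Fan.mk (f := fun _ : Unit ↦ X) Y (fun _ ↦ e.inv)) :=
      Fan.IsLimit.mk _ (fun s ↦ s.proj () ≫ e.hom) (by simp) (by
        intro s m hm
        simp [← hm ()])
    exact P.prop_of_isLimit_fan this (fun _ ↦ hX)

/-- The bounded complexes in `B` all of whose terms satisfy `P`. -/
def boundedIn : ObjectProperty (CochainComplex B ℤ) :=
  fun K ↦ bounded B K ∧ ∀ i, P (K.X i)

/-- A bounded complex in the full subcategory defined by `P` is the same as a bounded complex
in `B` all of whose terms satisfy `P`. -/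
def equivBoundedIn : Cb P.FullSubcategory ≌ (boundedIn P).FullSubcategory where
  functor := (boundedIn P).lift
    ((bounded P.FullSubcategory).ι ⋙ P.ι.mapHomologicalComplex _) (by
      rintro ⟨K, ⟨m, hm⟩, ⟨n, hn⟩⟩
      refine ⟨⟨⟨m, ?_⟩, ⟨n, ?_⟩⟩, fun i ↦ (K.X i).property⟩
      · rw [CochainComplex.isStrictlyGE_iff]
        intro i hi
        exact P.ι.map_isZero (K.isZero_of_isStrictlyGE m i hi)
      · rw [CochainComplex.isStrictlyLE_iff]
        intro i hi
        exact P.ι.map_isZero (K.isZero_of_isStrictlyLE n i hi))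
  inverse := (bounded P.FullSubcategory).lift
    (HomologicalComplex.liftFunctorObjectProperty P (boundedIn P).ι (fun X n ↦ X.property.2 n)) (by
      rintro ⟨K, ⟨⟨m, hm⟩, ⟨n, hn⟩⟩, h⟩
      refine ⟨⟨m, ?_⟩, ⟨n, ?_⟩⟩
      · rw [CochainComplex.isStrictlyGE_iff]
        intro i hi
        have := (IsZero.iff_id_eq_zero _).1 (K.isZero_of_isStrictlyGE m i hi)
        rw [IsZero.iff_id_eq_zero]
        exact P.ι.map_injective this
      · rw [CochainComplex.isStrictlyLE_iff]
        intro i hi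
        have := (IsZero.iff_id_eq_zero _).1 (K.isZero_of_isStrictlyLE n i hi)
        rw [IsZero.iff_id_eq_zero]
        exact P.ι.map_injective this)
  unitIso := Iso.refl _
  counitIso := Iso.refl _
  functor_unitIso_comp X := by
    exact (Category.comp_id _).trans (CategoryTheory.Functor.map_id _ _)

lemma equivBoundedIn_quasiIso {K L : Cb P.FullSubcategory} (f : K ⟶ L) :
    quasiIsoCb _ f ↔ HomologicalComplex.quasiIso B (.up ℤ)
      ((boundedIn P).ι.map ((equivBoundedIn P).functor.map f)) := by
  have : P.ι.PreservesHomology :=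
    { preservesKernels _ _ f := P.preservesKernels_ι f
      preservesCokernels _ _ f := P.preservesCokernels_ι f }
  exact (HomologicalComplex.quasiIso_map_iff_of_preservesHomology f.hom P.ι).symm

variable [P.IsMonoidal]

lemma isZero_tensor_of_isZero_left (X Y : B) (h : IsZero X) : IsZero (X ⊗ Y) :=
  ((curriedTensor B).flip.obj Y).map_isZero h

lemma isZero_tensor_of_isZero_right (X Y : B) (h : IsZero Y) : IsZero (X ⊗ Y) :=
  ((curriedTensor B).obj X).map_isZero h

lemma isZero_tensor_X (K L : CochainComplex B ℤ) (n : ℤ)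
    (h : ∀ i j, i + j = n → IsZero (K.X i) ∨ IsZero (L.X j)) : IsZero ((K ⊗ L).X n) := by
  rw [IsZero.iff_id_eq_zero]
  refine HomologicalComplex.mapBifunctor.hom_ext (K₁ := K) (K₂ := L) (F := curriedTensor B)
    (fun i j hij ↦ IsZero.eq_of_src ?_ _ _)
  rcases h i j hij with h | h
  · exact isZero_tensor_of_isZero_left _ _ h
  · exact isZero_tensor_of_isZero_right _ _ h

attribute [local instance] Abelian.hasFiniteBiproducts

/-- A term of the tensor product of bounded complexes is a finite direct sum. -/
def tensorXIso (K L : CochainComplex B ℤ) (m n : ℤ) [K.IsStrictlyGE m] [K.IsStrictlyLE n]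
    (r : ℤ) : (K ⊗ L).X r ≅ ⨁ fun i : Finset.Icc m n ↦ K.X i.1 ⊗ L.X (r - i.1) where
  hom := HomologicalComplex.mapBifunctorDesc (K₁ := K) (K₂ := L) (F := curriedTensor B)
    (fun i j hij ↦ if h : i ∈ Finset.Icc m n then
      K.X i ◁ eqToHom (by congr 1; rw [← hij]; change j = i + j - i; ring) ≫
        biproduct.ι (fun i : Finset.Icc m n ↦ K.X i.1 ⊗ L.X (r - i.1)) ⟨i, h⟩ else 0)
  inv := biproduct.desc (fun i ↦ HomologicalComplex.ιTensorObj K L i.1 (r - i.1) r (by ring))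
  hom_inv_id := by
    refine HomologicalComplex.mapBifunctor.hom_ext (K₁ := K) (K₂ := L) (F := curriedTensor B)
      (fun i j hij ↦ ?_)
    by_cases h : i ∈ Finset.Icc m n
    · rw [HomologicalComplex.ι_mapBifunctorDesc_assoc, dif_pos h, Category.assoc, biproduct.ι_desc]
      obtain rfl : j = r - i := by
        rw [← hij]; change j = i + j - i; ring
      simp only [eqToHom_refl, MonoidalCategory.whiskerLeft_id]
      exact (Category.id_comp _).trans (Category.comp_id _).symm
    · refine IsZero.eq_of_src (isZero_tensor_of_isZero_left _ _ ?_) _ _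
      rw [Finset.mem_Icc] at h
      by_cases hi : i < m
      · exact K.isZero_of_isStrictlyGE m i hi
      · exact K.isZero_of_isStrictlyLE n i (by lia)
  inv_hom_id := by
    refine biproduct.hom_ext' _ _ (fun i ↦ ?_)
    rw [biproduct.ι_desc_assoc, Category.comp_id]
    refine (HomologicalComplex.ι_mapBifunctorDesc (K₁ := K) (K₂ := L) (F := curriedTensor B)
      _ _ _ _).trans ?_
    rw [dif_pos i.2]
    simp

lemma boundedIn_tensor (K L : CochainComplex B ℤ) (hK : boundedIn P K) (hL : boundedIn P L) :
    boundedIn P (K ⊗ L) := by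
  have := isClosedUnderIsomorphisms_of_products P
  obtain ⟨⟨⟨m₁, h₁⟩, ⟨n₁, h₁'⟩⟩, hPK⟩ := hK
  obtain ⟨⟨⟨m₂, h₂⟩, ⟨n₂, h₂'⟩⟩, hPL⟩ := hL
  refine ⟨⟨⟨m₁ + m₂, ?_⟩, ⟨n₁ + n₂, ?_⟩⟩, fun r ↦ ?_⟩
  · rw [CochainComplex.isStrictlyGE_iff]
    intro r hr
    refine isZero_tensor_X K L r (fun i j hij ↦ ?_)
    by_cases hi : i < m₁
    · exact Or.inl (K.isZero_of_isStrictlyGE m₁ i hi)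
    · exact Or.inr (L.isZero_of_isStrictlyGE m₂ j (by lia))
  · rw [CochainComplex.isStrictlyLE_iff]
    intro r hr
    refine isZero_tensor_X K L r (fun i j hij ↦ ?_)
    by_cases hi : n₁ < i
    · exact Or.inl (K.isZero_of_isStrictlyLE n₁ i hi)
    · exact Or.inr (L.isZero_of_isStrictlyLE n₂ j (by lia))
  · exact P.prop_of_iso ((biproduct.isoProduct _).symm ≪≫ (tensorXIso K L m₁ n₁ r).symm)
      (P.prop_product (fun i ↦ P.prop_tensor (hPK _) (hPL _)))

lemma boundedIn_unit : boundedIn P (𝟙_ (CochainComplex B ℤ)) := by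
  have := isClosedUnderIsomorphisms_of_products P
  refine ⟨⟨⟨0, inferInstanceAs (((CochainComplex.singleFunctor B 0).obj (𝟙_ B)).IsStrictlyGE 0)⟩,
    ⟨0, inferInstanceAs (((CochainComplex.singleFunctor B 0).obj (𝟙_ B)).IsStrictlyLE 0)⟩⟩,
    fun i ↦ ?_⟩
  change P (((HomologicalComplex.single B (.up ℤ) 0).obj (𝟙_ B)).X i)
  by_cases hi : i = 0
  · subst hi
    exact P.prop_of_iso (HomologicalComplex.singleObjXSelf (.up ℤ) (0 : ℤ) (𝟙_ B)).symm
      P.prop_unit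
  · exact P.prop_of_isZero (HomologicalComplex.isZero_single_obj_X (.up ℤ) _ _ _ hi)

instance : (boundedIn P).IsMonoidal where
  prop_unit := boundedIn_unit P
  prop_tensor _ _ := boundedIn_tensor P _ _

/-- The tensor product of bounded complexes. -/
instance : MonoidalCategory (Cb P.FullSubcategory) :=
  Monoidal.transport (equivBoundedIn P).symm

instance : (equivBoundedIn P).functor.Monoidal :=
  inferInstanceAs (Monoidal.equivalenceTransported (equivBoundedIn P).symm).inverse.Monoidal

end

variable (B) in
/-- The tensor product with a bounded complex preserves the quasi-isomorphisms between bounded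
complexes. This is proved below for vector spaces and for representations, and it is what is
needed in order to define the tensor product on the bounded derived category. -/
class ExactTensor : Prop where
  whiskerLeft {K L : CochainComplex B ℤ} (f : K ⟶ L) (M : CochainComplex B ℤ) :
    bounded B K → bounded B L → bounded B M → QuasiIso f → QuasiIso (M ◁ f)
  whiskerRight {K L : CochainComplex B ℤ} (f : K ⟶ L) (M : CochainComplex B ℤ) :
    bounded B K → bounded B L → bounded B M → QuasiIso f → QuasiIso (f ▷ M)

variable [ExactTensor B]
variable (P : ObjectProperty B) [P.ContainsZero] [P.IsClosedUnderKernels]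
  [P.IsClosedUnderCokernels] [P.IsClosedUnderFiniteProducts] [P.IsMonoidal]

instance :
    ((HomologicalComplex.quasiIso B (.up ℤ)).inverseImage (boundedIn P).ι).IsMonoidal where
  whiskerLeft M K L f hf :=
    (HomologicalComplex.mem_quasiIso_iff _).2 (ExactTensor.whiskerLeft f.hom M.obj
      K.property.1 L.property.1 M.property.1 ((HomologicalComplex.mem_quasiIso_iff _).1 hf))
  whiskerRight {K L} f hf M :=
    (HomologicalComplex.mem_quasiIso_iff _).2 (ExactTensor.whiskerRight f.hom M.obj
      K.property.1 L.property.1 M.property.1 ((HomologicalComplex.mem_quasiIso_iff _).1 hf))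

instance : (quasiIsoCb P.FullSubcategory).IsMonoidal := by
  have : quasiIsoCb P.FullSubcategory =
      ((HomologicalComplex.quasiIso B (.up ℤ)).inverseImage (boundedIn P).ι).inverseImage
        (equivBoundedIn P).functor := by
    ext K L f
    exact equivBoundedIn_quasiIso P f
  rw [this]
  infer_instance

/-- The tensor product on the bounded derived category, which is induced by the tensor product of
bounded complexes. -/
instance : MonoidalCategory (Db P.FullSubcategory) :=
  inferInstanceAs (MonoidalCategory (LocalizedMonoidal (Q P.FullSubcategory)
    (quasiIsoCb P.FullSubcategory) (Iso.refl _)))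

instance : (Q P.FullSubcategory).Monoidal :=
  inferInstanceAs (Localization.Monoidal.toMonoidalCategory (Q P.FullSubcategory)
    (quasiIsoCb P.FullSubcategory) (Iso.refl _)).Monoidal

end Tensor


/-! ### Exactness of the tensor product over a field -/

section ExactTensorInstances

open MonoidalCategory HomologicalComplex

universe u

section

variable {B : Type*} [Category* B] [Abelian B] [MonoidalCategory B] [MonoidalPreadditive B]
  [HasColimitsOfSize.{0, 0} B]
  [∀ X : B, PreservesColimitsOfSize.{0, 0} ((curriedTensor B).obj X)]
  [∀ X : B, PreservesColimitsOfSize.{0, 0} ((curriedTensor B).flip.obj X)]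

lemma ιTensorObj_d (K L : CochainComplex B ℤ) (p q n n' : ℤ) (h : p + q = n) (h' : n + 1 = n') :
    ιTensorObj K L p q n h ≫ (K ⊗ L).d n n' =
      K.d p (p + 1) ▷ L.X q ≫ ιTensorObj K L (p + 1) q n' (by change p + 1 + q = n'; lia) +
      p.negOnePow • (K.X p ◁ L.d q (q + 1) ≫
        ιTensorObj K L p (q + 1) n' (by change p + (q + 1) = n'; lia)) := by
  have h₁ := mapBifunctor.d₁_eq K L (curriedTensor B) (.up ℤ) (i₁ := p) (i₁' := p + 1) rfl q n'
    (by change p + 1 + q = n'; lia)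
  have h₂ := mapBifunctor.d₂_eq K L (curriedTensor B) (.up ℤ) p (i₂ := q) (i₂' := q + 1) rfl n'
    (by change p + (q + 1) = n'; lia)
  rw [← mapBifunctor.ι_D₁ K L (curriedTensor B) (.up ℤ) n n' p q h] at h₁
  rw [← mapBifunctor.ι_D₂ K L (curriedTensor B) (.up ℤ) n n' p q h] at h₂
  refine (Preadditive.comp_add _ _ _ _ _ _).trans ((congr_arg₂ (· + ·) h₁ h₂).trans ?_)
  congr 1
  exact one_smul _ _

lemma ιTensorObj_whiskerLeft (K : CochainComplex B ℤ) {L L' : CochainComplex B ℤ} (f : L ⟶ L')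
    (p q n : ℤ) (h : p + q = n) :
    ιTensorObj K L p q n h ≫ (K ◁ f).f n = K.X p ◁ f.f q ≫ ιTensorObj K L' p q n h := by
  refine (ι_mapBifunctorMap (𝟙 K) f (curriedTensor B) (.up ℤ) p q n h).trans ?_
  simp

lemma ιTensorObj_whiskerRight {K K' : CochainComplex B ℤ} (f : K ⟶ K') (L : CochainComplex B ℤ)
    (p q n : ℤ) (h : p + q = n) :
    ιTensorObj K L p q n h ≫ (f ▷ L).f n = f.f p ▷ L.X q ≫ ιTensorObj K' L p q n h := by
  refine (ι_mapBifunctorMap f (𝟙 L) (curriedTensor B) (.up ℤ) p q n h).trans ?_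
  simp

lemma tensorObj_hom_ext {K L : CochainComplex B ℤ} {n : ℤ} {Y : B} {f g : (K ⊗ L).X n ⟶ Y}
    (h : ∀ (p q : ℤ) (h : p + q = n), ιTensorObj K L p q n h ≫ f = ιTensorObj K L p q n h ≫ g) :
    f = g :=
  mapBifunctor.hom_ext h

end

instance exactTensor_moduleCat (k : Type u) [Field k] : ExactTensor (ModuleCat.{u} k) := by
  have key {K L : CochainComplex (ModuleCat.{u} k) ℤ} (f : K ⟶ L) (hK : bounded _ K)
      (hL : bounded _ L) (hf : QuasiIso f) :
      ∃ g : L ⟶ K, Nonempty (Homotopy (f ≫ g) (𝟙 K)) ∧ Nonempty (Homotopy (g ≫ f) (𝟙 L)) := by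
    obtain ⟨-, m, hm⟩ := hK
    obtain ⟨-, n, hn⟩ := hL
    have (i : ℤ) : Projective (K.X i) := ModuleCat.projective_of_categoryTheory_projective _
    have (i : ℤ) : Projective (L.X i) := ModuleCat.projective_of_categoryTheory_projective _
    have := CochainComplex.isKProjective_of_projective K m
    have := CochainComplex.isKProjective_of_projective L n
    have := HasDerivedCategory.standard (ModuleCat.{u} k)
    obtain ⟨e, rfl⟩ := (CochainComplex.IsKProjective.quasiIso_iff f).1 hf
    exact ⟨e.inv, ⟨e.homotopyHomInvId⟩, ⟨e.homotopyInvHomId⟩⟩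
  constructor
  · intro K L f M hK hL hM hf
    obtain ⟨g, ⟨h₁⟩, ⟨h₂⟩⟩ := key f hK hL hf
    let e : HomotopyEquiv (M ⊗ K) (M ⊗ L) :=
      { hom := M ◁ f
        inv := M ◁ g
        homotopyHomInvId := (Homotopy.ofEq (by rw [← MonoidalCategory.whiskerLeft_comp]; rfl)).trans
          ((mapBifunctorMapHomotopy₂ (𝟙 M) h₁ (curriedTensor _) (.up ℤ)).trans
            (Homotopy.ofEq (MonoidalCategory.whiskerLeft_id M K)))
        homotopyInvHomId := (Homotopy.ofEq (by rw [← MonoidalCategory.whiskerLeft_comp]; rfl)).trans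
          ((mapBifunctorMapHomotopy₂ (𝟙 M) h₂ (curriedTensor _) (.up ℤ)).trans
            (Homotopy.ofEq (MonoidalCategory.whiskerLeft_id M L))) }
    exact e.quasiIso_hom
  · intro K L f M hK hL hM hf
    obtain ⟨g, ⟨h₁⟩, ⟨h₂⟩⟩ := key f hK hL hf
    let e : HomotopyEquiv (K ⊗ M) (L ⊗ M) :=
      { hom := f ▷ M
        inv := g ▷ M
        homotopyHomInvId := (Homotopy.ofEq (by rw [← MonoidalCategory.comp_whiskerRight]; rfl)).trans
          ((mapBifunctorMapHomotopy₁ h₁ (𝟙 M) (curriedTensor _) (.up ℤ)).trans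
            (Homotopy.ofEq (MonoidalCategory.id_whiskerRight K M)))
        homotopyInvHomId := (Homotopy.ofEq (by rw [← MonoidalCategory.comp_whiskerRight]; rfl)).trans
          ((mapBifunctorMapHomotopy₁ h₂ (𝟙 M) (curriedTensor _) (.up ℤ)).trans
            (Homotopy.ofEq (MonoidalCategory.id_whiskerRight L M))) }
    exact e.quasiIso_hom

section FunctorCategory

variable (J : Type*) [Category* J] (k : Type u) [Field k]

instance : MonoidalPreadditive (J ⥤ ModuleCat.{u} k) where
  whiskerLeft_zero := by intros; ext1; ext1; exact MonoidalPreadditive.whiskerLeft_zero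
  zero_whiskerRight := by intros; ext1; ext1; exact MonoidalPreadditive.zero_whiskerRight
  whiskerLeft_add _ _ := by ext1; ext1; exact MonoidalPreadditive.whiskerLeft_add _ _
  add_whiskerRight _ _ := by ext1; ext1; exact MonoidalPreadditive.add_whiskerRight _ _

instance (X : J ⥤ ModuleCat.{u} k) :
    PreservesColimitsOfSize.{0, 0} ((curriedTensor (J ⥤ ModuleCat.{u} k)).obj X) where
  preservesColimitsOfShape := preservesColimitsOfShape_of_evaluation _ _ (fun j ↦
    inferInstanceAs (PreservesColimitsOfShape _
      ((evaluation J _).obj j ⋙ (curriedTensor (ModuleCat.{u} k)).obj (X.obj j))))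

instance (X : J ⥤ ModuleCat.{u} k) :
    PreservesColimitsOfSize.{0, 0} ((curriedTensor (J ⥤ ModuleCat.{u} k)).flip.obj X) where
  preservesColimitsOfShape := preservesColimitsOfShape_of_evaluation _ _ (fun j ↦
    inferInstanceAs (PreservesColimitsOfShape _
      ((evaluation J _).obj j ⋙ (curriedTensor (ModuleCat.{u} k)).flip.obj (X.obj j))))

variable {J k} (j : J)

/-- The functor on complexes given by the values at `j`. -/
abbrev evc : CochainComplex (J ⥤ ModuleCat.{u} k) ℤ ⥤ CochainComplex (ModuleCat.{u} k) ℤ :=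
  ((evaluation J (ModuleCat.{u} k)).obj j).mapHomologicalComplex (.up ℤ)


/-- The comparison, in one degree, between the tensor product of the values at `j` and the value
at `j` of the tensor product. -/
def evcTensorX (K L : CochainComplex (J ⥤ ModuleCat.{u} k) ℤ) (n : ℤ) :
    ((evc j).obj K ⊗ (evc j).obj L).X n ⟶ ((K ⊗ L).X n).obj j :=
  mapBifunctorDesc (K₁ := (evc j).obj K) (K₂ := (evc j).obj L) (c := .up ℤ)
    (F := curriedTensor (ModuleCat.{u} k)) (fun p q h ↦ (ιTensorObj K L p q n h).app j)

lemma ι_evcTensorX (K L : CochainComplex (J ⥤ ModuleCat.{u} k) ℤ) (p q n : ℤ) (h : p + q = n) :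
    ιTensorObj ((evc j).obj K) ((evc j).obj L) p q n h ≫ evcTensorX j K L n =
      (ιTensorObj K L p q n h).app j :=
  ι_mapBifunctorDesc (K₁ := (evc j).obj K) (K₂ := (evc j).obj L) (c := .up ℤ)
    (F := curriedTensor (ModuleCat.{u} k)) _ p q h

/-- The comparison between the tensor product of the values at `j` and the value at `j` of the
tensor product. -/
def evcTensor (K L : CochainComplex (J ⥤ ModuleCat.{u} k) ℤ) :
    (evc j).obj K ⊗ (evc j).obj L ⟶ (evc j).obj (K ⊗ L) where
  f n := evcTensorX j K L n
  comm' n n' hn := by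
    refine tensorObj_hom_ext (fun p q h ↦ ?_)
    have h₁ := ιTensorObj_d ((evc j).obj K) ((evc j).obj L) p q n n' h hn
    have h₂ := congr_app (ιTensorObj_d K L p q n n' h hn) j
    have e₁ := ι_evcTensorX j K L p q n h
    have e₂ := ι_evcTensorX j K L (p + 1) q n' (by rw [← hn, ← h]; ring)
    have e₃ := ι_evcTensorX j K L p (q + 1) n' (by rw [← hn, ← h]; ring)
    refine Eq.trans ?_ ((congr_arg (· ≫ evcTensorX j K L n') h₁).symm.trans (Category.assoc _ _ _))
    refine ((Category.assoc _ _ _).symm.trans (congr_arg (· ≫ ((K ⊗ L).d n n').app j) e₁)).trans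
      (h₂.trans ?_)
    rw [Preadditive.add_comp, Linear.units_smul_comp, Category.assoc, Category.assoc, e₂, e₃]
    rfl

instance (K L : CochainComplex (J ⥤ ModuleCat.{u} k) ℤ) (n : ℤ) : IsIso ((evcTensor j K L).f n) := by
  have hc := isColimitCofanMkObjOfIsColimit ((evaluation J (ModuleCat.{u} k)).obj j) _ _
    (coproductIsCoproduct (fun x : (ComplexShape.π (.up ℤ) (.up ℤ) (.up ℤ) ⁻¹' {n}) ↦
      (K.X x.1.1 ⊗ L.X x.1.2)))
  let φ : ((K ⊗ L).X n).obj j ⟶ ((evc j).obj K ⊗ (evc j).obj L).X n :=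
    Cofan.IsColimit.desc hc (fun x ↦ ιTensorObj ((evc j).obj K) ((evc j).obj L) x.1.1 x.1.2 n x.2)
  have hφ (p q : ℤ) (h : p + q = n) : (ιTensorObj K L p q n h).app j ≫ φ =
      ιTensorObj ((evc j).obj K) ((evc j).obj L) p q n h :=
    Cofan.IsColimit.fac hc _ ⟨⟨p, q⟩, h⟩
  refine ⟨φ, ?_, ?_⟩
  · refine tensorObj_hom_ext (fun p q h ↦ ?_)
    refine (Category.assoc _ _ _).symm.trans ((congr_arg (· ≫ φ) (ι_evcTensorX j K L p q n h)).trans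
      ((hφ p q h).trans (Category.comp_id _).symm))
  · refine Cofan.IsColimit.hom_ext hc _ _ (fun x ↦ ?_)
    have h₁ := hφ x.1.1 x.1.2 x.2
    have h₂ := ι_evcTensorX j K L x.1.1 x.1.2 n x.2
    exact (Category.assoc _ _ _).symm.trans ((congr_arg (· ≫ evcTensorX j K L n) h₁).trans
      (h₂.trans (Category.comp_id _).symm))

lemma evcTensor_whiskerLeft (M : CochainComplex (J ⥤ ModuleCat.{u} k) ℤ)
    {K L : CochainComplex (J ⥤ ModuleCat.{u} k) ℤ} (f : K ⟶ L) :
    evcTensor j M K ≫ (evc j).map (M ◁ f) = (evc j).obj M ◁ (evc j).map f ≫ evcTensor j M L := by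
  ext n : 1
  refine tensorObj_hom_ext (fun p q h ↦ ?_)
  refine ((Category.assoc _ _ _).symm.trans (congr_arg (· ≫ ((M ◁ f).f n).app j)
    (ι_evcTensorX j M K p q n h))).trans ((congr_app (ιTensorObj_whiskerLeft M f p q n h) j).trans ?_)
  refine Eq.trans ?_ ((Category.assoc _ _ _).symm.trans (congr_arg (· ≫ evcTensorX j M L n)
    (ιTensorObj_whiskerLeft ((evc j).obj M) ((evc j).map f) p q n h))).symm
  exact (congr_arg (((evc j).obj M).X p ◁ ((evc j).map f).f q ≫ ·)
    (ι_evcTensorX j M L p q n h)).symm.trans (Category.assoc _ _ _).symm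

lemma evcTensor_whiskerRight {K L : CochainComplex (J ⥤ ModuleCat.{u} k) ℤ} (f : K ⟶ L) 
    (M : CochainComplex (J ⥤ ModuleCat.{u} k) ℤ) :
    evcTensor j K M ≫ (evc j).map (f ▷ M) = (evc j).map f ▷ (evc j).obj M ≫ evcTensor j L M := by
  ext n : 1
  refine tensorObj_hom_ext (fun p q h ↦ ?_)
  refine ((Category.assoc _ _ _).symm.trans (congr_arg (· ≫ ((f ▷ M).f n).app j)
    (ι_evcTensorX j K M p q n h))).trans ((congr_app (ιTensorObj_whiskerRight f M p q n h) j).trans ?_)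
  refine Eq.trans ?_ ((Category.assoc _ _ _).symm.trans (congr_arg (· ≫ evcTensorX j L M n)
    (ιTensorObj_whiskerRight ((evc j).map f) ((evc j).obj M) p q n h))).symm
  exact (congr_arg (((evc j).map f).f p ▷ ((evc j).obj M).X q ≫ ·)
    (ι_evcTensorX j L M p q n h)).symm.trans (Category.assoc _ _ _).symm

instance (K L : CochainComplex (J ⥤ ModuleCat.{u} k) ℤ) : IsIso (evcTensor j K L) :=
  HomologicalComplex.Hom.isIso_of_components _

variable (J k)

lemma bounded_evc (K : CochainComplex (J ⥤ ModuleCat.{u} k) ℤ) (hK : bounded _ K) :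
    bounded _ ((evc j).obj K) := by
  obtain ⟨⟨m, hm⟩, ⟨n, hn⟩⟩ := hK
  refine ⟨⟨m, ?_⟩, ⟨n, ?_⟩⟩
  · rw [CochainComplex.isStrictlyGE_iff]
    intro i hi
    exact ((evaluation J (ModuleCat.{u} k)).obj j).map_isZero (K.isZero_of_isStrictlyGE m i hi)
  · rw [CochainComplex.isStrictlyLE_iff]
    intro i hi
    exact ((evaluation J (ModuleCat.{u} k)).obj j).map_isZero (K.isZero_of_isStrictlyLE n i hi)

instance : ExactTensor (J ⥤ ModuleCat.{u} k) where
  whiskerLeft {K L} f M hK hL hM hf := by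
    rw [quasiIso_iff_evaluation] at hf ⊢
    intro j
    have := ExactTensor.whiskerLeft _ _ (bounded_evc J k j K hK) (bounded_evc J k j L hL)
      (bounded_evc J k j M hM) (hf j)
    rw [← quasiIso_iff_comp_left (evcTensor j M K), evcTensor_whiskerLeft]
    infer_instance
  whiskerRight {K L} f M hK hL hM hf := by
    rw [quasiIso_iff_evaluation] at hf ⊢
    intro j
    have := ExactTensor.whiskerRight _ _ (bounded_evc J k j K hK) (bounded_evc J k j L hL)
      (bounded_evc J k j M hM) (hf j)
    rw [← quasiIso_iff_comp_left (evcTensor j K M), evcTensor_whiskerRight]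
    infer_instance

end FunctorCategory

end ExactTensorInstances

/-! ### The algebra of a finite family of objects -/

section HomAlg

variable {ι C : Type*} [Category* C] [Preadditive C] (X : ι → C)

/-- The product `∏ Hom(X i, X j)` over all pairs of indices. For a finite family of objects it is
a ring: the product of two composable morphisms is their composition (in diagrammatic order),
and the product of two morphisms that are not composable is zero. -/
def HomAlg : Type _ := ∀ i j : ι, X i ⟶ X j

instance : AddCommGroup (HomAlg X) := inferInstanceAs (AddCommGroup (∀ i j : ι, X i ⟶ X j))

instance (k : Type*) [CommRing k] [Linear k C] : Module k (HomAlg X) :=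
  inferInstanceAs (Module k (∀ i j : ι, X i ⟶ X j))

variable [Finite ι]

open Classical in
instance : Ring (HomAlg X) where
  __ : AddCommGroup (HomAlg X) := inferInstance
  mul f g i j := letI := Fintype.ofFinite ι; ∑ l, f i l ≫ g l j
  one i j := if h : i = j then eqToHom (by rw [h]) else 0
  left_distrib f g h := by
    funext i j
    let := Fintype.ofFinite ι
    change ∑ l, f i l ≫ (g l j + h l j) = ∑ l, f i l ≫ g l j + ∑ l, f i l ≫ h l j
    simp [Finset.sum_add_distrib]
  right_distrib f g h := by
    funext i j
    let := Fintype.ofFinite ι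
    change ∑ l, (f i l + g i l) ≫ h l j = ∑ l, f i l ≫ h l j + ∑ l, g i l ≫ h l j
    simp [Finset.sum_add_distrib]
  zero_mul f := by
    funext i j
    let := Fintype.ofFinite ι
    change ∑ l, (0 : X i ⟶ X l) ≫ f l j = 0
    simp
  mul_zero f := by
    funext i j
    let := Fintype.ofFinite ι
    change ∑ l, f i l ≫ (0 : X l ⟶ X j) = 0
    simp
  mul_assoc f g h := by
    funext i j
    let := Fintype.ofFinite ι
    change ∑ l, (∑ m, f i m ≫ g m l) ≫ h l j = ∑ l, f i l ≫ (∑ m, g l m ≫ h m j)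
    simp only [Preadditive.sum_comp, Preadditive.comp_sum, Category.assoc]
    exact Finset.sum_comm
  one_mul f := by
    funext i j
    let := Fintype.ofFinite ι
    change ∑ l, (if h : i = l then eqToHom (by rw [h]) else 0) ≫ f l j = f i j
    rw [Finset.sum_eq_single i]
    · simp
    · intro l _ hl
      rw [dif_neg hl.symm, zero_comp]
    · simp
  mul_one f := by
    funext i j
    let := Fintype.ofFinite ι
    change ∑ l, f i l ≫ (if h : l = j then eqToHom (by rw [h]) else 0) = f i j
    rw [Finset.sum_eq_single j]
    · simp
    · intro l _ hl
      rw [dif_neg hl, comp_zero]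
    · simp

instance (k : Type*) [CommRing k] [Linear k C] : Algebra k (HomAlg X) :=
  Algebra.ofModule
    (fun r f g ↦ by
      funext i j
      let := Fintype.ofFinite ι
      change ∑ l, (r • f i l) ≫ g l j = r • ∑ l, f i l ≫ g l j
      simp [Finset.smul_sum])
    (fun r f g ↦ by
      funext i j
      let := Fintype.ofFinite ι
      change ∑ l, f i l ≫ (r • g l j) = r • ∑ l, f i l ≫ g l j
      simp [Finset.smul_sum])

end HomAlg

/-! ### Tensor triangulated functors, points, and the algebra of a tensor triangulated category -/

section TensorTriangulated

variable (k : Type*) [CommRing k]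
  (T : Type*) [Category* T] [Preadditive T] [HasZeroObject T] [HasShift T ℤ]
  [∀ n : ℤ, (shiftFunctor T n).Additive] [Pretriangulated T] [Linear k T]
  [∀ n : ℤ, (shiftFunctor T n).Linear k] [MonoidalCategory T]
  (S : Type*) [Category* S] [Preadditive S] [HasZeroObject S] [HasShift S ℤ]
  [∀ n : ℤ, (shiftFunctor S n).Additive] [Pretriangulated S] [Linear k S]
  [∀ n : ℤ, (shiftFunctor S n).Linear k] [MonoidalCategory S]

/-- A `k`-linear exact functor between `k`-linear tensor triangulated categories that preserves
the tensor products and the unit objects. -/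
structure TTFunctor where
  functor : T ⥤ S
  [additive : functor.Additive]
  [linear : functor.Linear k]
  [commShift : functor.CommShift ℤ]
  [isTriangulated : functor.IsTriangulated]
  [monoidal : functor.Monoidal]

variable {k T S}

namespace TTFunctor

attribute [instance] additive linear commShift isTriangulated monoidal

/-- The morphisms of exact functors: natural transformations that are compatible with the
shift. -/
@[ext]
structure Hom (F G : TTFunctor k T S) where
  natTrans : F.functor ⟶ G.functor
  commShift : NatTrans.CommShift natTrans ℤ

attribute [instance] Hom.commShift

instance : Category (TTFunctor k T S) where
  Hom F G := Hom F G
  id F := ⟨𝟙 F.functor, inferInstance⟩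
  comp α β := ⟨α.natTrans ≫ β.natTrans, inferInstance⟩
  id_comp _ := Hom.ext (Category.id_comp _)
  comp_id _ := Hom.ext (Category.comp_id _)
  assoc _ _ _ := Hom.ext (Category.assoc _ _ _)

variable {F G H : TTFunctor k T S}

/-- The shift compatible natural transformations form a subspace. -/
def homSubmodule (F G : TTFunctor k T S) : Submodule k (F.functor ⟶ G.functor) where
  carrier := {τ | NatTrans.CommShift τ ℤ}
  zero_mem' := ⟨fun n ↦ by ext X; simp⟩
  add_mem' {τ τ'} (_ : NatTrans.CommShift τ ℤ) (_ : NatTrans.CommShift τ' ℤ) := ⟨fun n ↦ by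
    ext X
    have h₁ := NatTrans.shift_app_comm τ n X
    have h₂ := NatTrans.shift_app_comm τ' n X
    simp [Functor.map_add, h₁, h₂]⟩
  smul_mem' r {τ} (_ : NatTrans.CommShift τ ℤ) := ⟨fun n ↦ by
    ext X
    have h₁ := NatTrans.shift_app_comm τ n X
    simp [Functor.map_smul, h₁]⟩

/-- The morphisms of exact functors, as elements of a subspace of the natural transformations. -/
def homEquiv (F G : TTFunctor k T S) : (F ⟶ G) ≃ homSubmodule F G where
  toFun τ := ⟨τ.natTrans, τ.commShift⟩
  invFun τ := ⟨τ.1, τ.2⟩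
  left_inv _ := rfl
  right_inv _ := rfl

instance : Preadditive (TTFunctor k T S) where
  homGroup F G := (homEquiv F G).addCommGroup
  add_comp _ _ _ _ _ _ := Hom.ext (Preadditive.add_comp _ _ _ _ _ _)
  comp_add _ _ _ _ _ _ := Hom.ext (Preadditive.comp_add _ _ _ _ _ _)

instance : Linear k (TTFunctor k T S) where
  homModule F G := (homEquiv F G).module k
  smul_comp _ _ _ _ _ _ := Hom.ext (Linear.smul_comp _ _ _ _ _ _)
  comp_smul _ _ _ _ _ _ := Hom.ext (Linear.comp_smul _ _ _ _ _ _)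

variable {R : Type*} [Category* R] [Preadditive R] [HasZeroObject R] [HasShift R ℤ]
  [∀ n : ℤ, (shiftFunctor R n).Additive] [Pretriangulated R] [Linear k R]
  [∀ n : ℤ, (shiftFunctor R n).Linear k] [MonoidalCategory R]

/-- The composition of two `k`-linear exact tensor functors. -/
def comp (u : TTFunctor k R T) (F : TTFunctor k T S) : TTFunctor k R S where
  functor := u.functor ⋙ F.functor

/-- Precomposition with a `k`-linear exact tensor functor, on morphisms of functors. -/
def whisker (u : TTFunctor k R T) {F G : TTFunctor k T S} (τ : F ⟶ G) : u.comp F ⟶ u.comp G where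
  natTrans := Functor.whiskerLeft u.functor τ.natTrans
  commShift := inferInstanceAs (NatTrans.CommShift
    (Functor.whiskerLeft u.functor τ.natTrans : u.functor ⋙ F.functor ⟶ u.functor ⋙ G.functor) ℤ)

end TTFunctor

variable (k T S) in
/-- The set `T(S)` of isomorphism classes of `k`-linear exact tensor functors from `T` to `S`. -/
def Points : Type _ := Quotient (isIsomorphicSetoid (TTFunctor k T S))

/-- The point given by a functor. -/
def TTFunctor.toPoint (F : TTFunctor k T S) : Points k T S :=
  Quotient.mk (isIsomorphicSetoid _) F

/-- A functor in the isomorphism class. -/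
def Points.rep (p : Points k T S) : TTFunctor k T S := Quotient.out p

/-- The map `T(S) → R(S)` given by precomposition with a functor `u : R → T`. -/
def TTFunctor.onPoints {R : Type*} [Category* R] [Preadditive R] [HasZeroObject R] [HasShift R ℤ]
    [∀ n : ℤ, (shiftFunctor R n).Additive] [Pretriangulated R] [Linear k R]
    [∀ n : ℤ, (shiftFunctor R n).Linear k] [MonoidalCategory R]
    (u : TTFunctor k R T) (F : Points k T S) : Points k R S :=
  (u.comp F.rep).toPoint

end TensorTriangulated

/-! ### Path algebras and representations of quivers -/

section Quivers

open MonoidalCategory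

universe u v w

/-- The property of being a finite dimensional vector space. -/
def fdim (k : Type u) [Field k] : ObjectProperty (ModuleCat.{u} k) := fun M ↦ Module.Finite k M

section

variable (k : Type u) [Field k]

instance : (fdim k).ContainsZero where
  exists_zero := ⟨ModuleCat.of k PUnit.{u + 1}, ModuleCat.isZero_of_subsingleton _,
    inferInstanceAs (Module.Finite k PUnit.{u + 1})⟩

instance : (fdim k).IsClosedUnderSubobjects where
  prop_of_mono f _ (_ : Module.Finite _ _) :=
    Module.Finite.of_injective f.hom ((ModuleCat.mono_iff_injective f).1 inferInstance)

instance : (fdim k).IsClosedUnderQuotients where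
  prop_of_epi f _ (_ : Module.Finite _ _) :=
    Module.Finite.of_surjective f.hom ((ModuleCat.epi_iff_surjective f).1 inferInstance)

lemma fdim_of_isLimit {J : Type} [Finite J] {F : Discrete J ⥤ ModuleCat.{u} k} {c : Cone F}
    (hc : IsLimit c) (hF : ∀ j, fdim k (F.obj j)) : fdim k c.pt := by
  have (j : J) : Module.Finite k (F.obj ⟨j⟩) := hF ⟨j⟩
  refine Module.Finite.of_injective (LinearMap.pi (fun j : J ↦ (c.π.app ⟨j⟩).hom))
    (fun x y h ↦ Concrete.isLimit_ext F hc x y (fun ⟨j⟩ ↦ congr_fun h j))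

instance : (fdim k).IsClosedUnderFiniteProducts where
  isClosedUnderLimitsOfShape J _ := ⟨by
    rintro X ⟨p⟩
    exact fdim_of_isLimit k p.isLimit p.prop_diag_obj⟩

instance : (fdim k).IsMonoidal where
  prop_unit := Module.Finite.self k
  prop_tensor X Y (_ : Module.Finite _ _) (_ : Module.Finite _ _) :=
    Module.Finite.tensorProduct k X Y

/-- The tensor triangulated category `Dᵇ(k)`: the bounded derived category of the category of
finite dimensional vector spaces. -/
abbrev DbVect := Db (fdim k).FullSubcategory

/-- For a `k`-linear tensor triangulated category `T`, the product `A(T)` of the spaces of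
morphisms between all pairs of `k`-valued points. It is an algebra if there are finitely many
points. -/
abbrev TTAlg (T : Type*) [Category* T] [Preadditive T] [HasZeroObject T] [HasShift T ℤ]
    [∀ n : ℤ, (shiftFunctor T n).Additive] [Pretriangulated T] [Linear k T]
    [∀ n : ℤ, (shiftFunctor T n).Linear k] [MonoidalCategory T] :=
  HomAlg (Points.rep : Points k T (DbVect k) → TTFunctor k T (DbVect k))

end

variable (k : Type u) [Field k] (V : Type w) [Quiver.{v} V]

/-- The vertices of a quiver, as objects of the free `k`-linear category on it: a morphism from
`a` to `b` is a finite formal linear combination of paths from `a` to `b`. -/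
def vertexObj (a : V) : Free k (Paths V) := Free.of k ((Paths.of V).obj a)

/-- The path algebra `kQ` of a quiver (with finitely many vertices). An element consists of a
linear combination of paths from `a` to `b` for all vertices `a` and `b`. The product `p * q` of
two paths is `p` followed by `q` (and zero if they are not composable). -/
abbrev PathAlg := HomAlg (vertexObj k V)

/-- The category of all (possibly infinite dimensional) representations of a quiver, without
relations. It has the vertexwise tensor product. -/
abbrev BigRep := Paths V ⥤ ModuleCat.{u} k

variable {k V}

/-- The vector space of a representation at a vertex. -/
abbrev BigRep.space (W : BigRep k V) (a : V) : ModuleCat.{u} k := W.obj ((Paths.of V).obj a)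

/-- The coefficients of a linear combination of paths. -/
def coeffs {a b : V} (x : vertexObj k V a ⟶ vertexObj k V b) :
    ((Paths.of V).obj a ⟶ (Paths.of V).obj b) →₀ k := x

/-- The action of a linear combination of paths from `a` to `b` on a representation. -/
def BigRep.act (W : BigRep k V) {a b : V} (x : vertexObj k V a ⟶ vertexObj k V b) :
    W.space a ⟶ W.space b :=
  (coeffs x).sum (fun p r ↦ r • W.map p)

lemma BigRep.act_naturality {W W' : BigRep k V} (φ : W ⟶ W') {a b : V}
    (x : vertexObj k V a ⟶ vertexObj k V b) :
    W.act x ≫ φ.app ((Paths.of V).obj b) = φ.app ((Paths.of V).obj a) ≫ W'.act x := by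
  simp only [BigRep.act, Finsupp.sum]
  rw [Preadditive.sum_comp, Preadditive.comp_sum]
  simp only [Linear.smul_comp, Linear.comp_smul, NatTrans.naturality]

/-- The finite dimensional representations satisfying the relations in `R`. -/
def repProp (R : Set (PathAlg k V)) : ObjectProperty (BigRep k V) :=
  fun W ↦ (∀ a : V, Module.Finite k (W.space a)) ∧ ∀ r ∈ R, ∀ a b : V, W.act (r a b) = 0

variable (R : Set (PathAlg k V))

instance : (repProp R).ContainsZero where
  exists_zero := ⟨(Functor.const _).obj (ModuleCat.of k PUnit.{u + 1}),
    (Functor.isZero_iff _).2 (fun _ ↦ ModuleCat.isZero_of_subsingleton (ModuleCat.of k PUnit.{u + 1})),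
    fun _ ↦ inferInstanceAs (Module.Finite k PUnit.{u + 1}),
    fun _ _ _ _ ↦ (ModuleCat.isZero_of_subsingleton (ModuleCat.of k PUnit.{u + 1})).eq_of_src _ _⟩

instance : (repProp R).IsClosedUnderSubobjects where
  prop_of_mono {W W'} f _ h := ⟨fun a ↦ (fdim k).prop_of_mono (f.app _) (h.1 a), fun r hr a b ↦ by
    rw [← cancel_mono (f.app ((Paths.of V).obj b)), BigRep.act_naturality, h.2 r hr, comp_zero,
      zero_comp]⟩

instance : (repProp R).IsClosedUnderQuotients where
  prop_of_epi {W W'} f _ h := ⟨fun a ↦ (fdim k).prop_of_epi (f.app _) (h.1 a), fun r hr a b ↦ by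
    rw [← cancel_epi (f.app ((Paths.of V).obj a)), ← BigRep.act_naturality, h.2 r hr, comp_zero,
      zero_comp]⟩

instance : (repProp R).IsClosedUnderFiniteProducts where
  isClosedUnderLimitsOfShape J _ := ⟨by
    rintro X ⟨p⟩
    have hp (a : V) := isLimitOfPreserves ((evaluation _ _).obj ((Paths.of V).obj a)) p.isLimit
    refine ⟨fun a ↦ fdim_of_isLimit k (hp a) (fun j ↦ (p.prop_diag_obj j).1 a), fun r hr a b ↦
      (hp b).hom_ext (fun j ↦ ?_)⟩
    refine (BigRep.act_naturality (p.π.app j) (r a b)).trans ?_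
    rw [(p.prop_diag_obj j).2 r hr, comp_zero]
    exact zero_comp.symm⟩

end Quivers

section BoundedFunctors

variable {A : Type*} [Category* A] [Abelian A] {B : Type*} [Category* B] [Abelian B]

/-- The functor on bounded complexes given by applying an additive functor to all terms. -/
def mapCb (G : A ⥤ B) [G.Additive] : Cb A ⥤ Cb B :=
  (bounded B).lift ((bounded A).ι ⋙ G.mapHomologicalComplex (.up ℤ)) (by
    rintro ⟨K, ⟨m, hm⟩, ⟨n, hn⟩⟩
    refine ⟨⟨m, ?_⟩, ⟨n, ?_⟩⟩
    · rw [CochainComplex.isStrictlyGE_iff]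
      intro i hi
      exact G.map_isZero (K.isZero_of_isStrictlyGE m i hi)
    · rw [CochainComplex.isStrictlyLE_iff]
      intro i hi
      exact G.map_isZero (K.isZero_of_isStrictlyLE n i hi))

/-- The natural transformation on bounded complexes given by a natural transformation. -/
def mapCbNat {G G' : A ⥤ B} [G.Additive] [G'.Additive] (α : G ⟶ G') : mapCb G ⟶ mapCb G' where
  app K := ObjectProperty.homMk ((NatTrans.mapHomologicalComplex α (.up ℤ)).app K.obj)
  naturality _ _ f := by
    ext1
    exact (NatTrans.mapHomologicalComplex α (.up ℤ)).naturality f.hom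

end BoundedFunctors

/-! ### Finite ordered quivers with tensor relations -/

section BoundQuivers

universe u v w

open MonoidalCategory

/-- A finite ordered quiver with tensor relations over the field `k`: a quiver with finitely many
vertices and arrows and no nontrivial oriented cycles, together with a set of relations which
involve only nontrivial paths and such that the finite dimensional representations satisfying
the relations contain the unit object and are closed under the vertexwise tensor product. -/
structure BoundQuiver (k : Type u) [Field k] where
  V : Type w
  [quiver : Quiver.{v} V]
  [finite_vertices : Finite V]
  finite_arrows (a b : V) : Finite (a ⟶ b)
  acyclic (a : V) (p : Quiver.Path a a) : p = Quiver.Path.nil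
  rel : Set (PathAlg k V)
  nontrivial (r : PathAlg k V) (hr : r ∈ rel) (a : V) : coeffs (r a a) (𝟙 _) = 0
  unit_mem : repProp rel (𝟙_ (BigRep k V))
  tensor_mem (W W' : BigRep k V) (h : repProp rel W) (h' : repProp rel W') : repProp rel (W ⊗ W')

namespace BoundQuiver

attribute [instance] quiver finite_vertices

variable {k : Type u} [Field k] (X : BoundQuiver.{u, v, w} k)

instance : (repProp X.rel).IsMonoidal where
  prop_unit := X.unit_mem
  prop_tensor W W' h h' := X.tensor_mem W W' h h'

/-- The abelian tensor category of finite dimensional representations. -/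
abbrev Rep := (repProp X.rel).FullSubcategory

/-- The tensor triangulated category `D(Q)`, the bounded derived category of representations. -/
abbrev D := Db X.Rep

/-- The algebra `kQ/(R)`. -/
abbrev BoundPathAlg := (TwoSidedIdeal.span X.rel).ringCon.Quotient

/-- The projection `kQ → kQ/(R)`. -/
def proj : PathAlg k X.V →ₐ[k] X.BoundPathAlg := RingCon.mkₐ k _

/-- The trivial path at a vertex. -/
def trivialPath (a : X.V) : PathAlg k X.V :=
  open Classical in fun i j ↦ if h : i = a ∧ j = a then eqToHom (by rw [h.1, h.2]) else 0

/-- The set of `k`-valued points of `D(Q)`. -/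
abbrev DPoints := Points k X.D (DbVect k)

/-- The functor `V ↦ V_a`. -/
def eval (a : X.V) : X.Rep ⥤ (fdim k).FullSubcategory :=
  (fdim k).lift ((repProp X.rel).ι ⋙ (evaluation _ _).obj ((Paths.of X.V).obj a))
    (fun W ↦ W.property.1 a)

instance (a : X.V) : (X.eval a).Additive where

variable {X} in
/-- The natural transformation `V_a ⟶ V_b` given by a linear combination of paths. -/
def evalMap {a b : X.V} (x : vertexObj k X.V a ⟶ vertexObj k X.V b) : X.eval a ⟶ X.eval b where
  app W := ObjectProperty.homMk (W.obj.act x)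
  naturality W W' f := by
    ext1
    exact (BigRep.act_naturality f.hom x).symm

/-- The functor that sends a bounded complex of representations `K` to the complex `K_a`, as an
object of `Dᵇ(k)`. -/
def evalD (a : X.V) : Cb X.Rep ⥤ DbVect k := mapCb (X.eval a) ⋙ Q _

variable {X} in
/-- The natural transformation `K_a ⟶ K_b` given by a linear combination of paths. -/
def evalDMap {a b : X.V} (x : vertexObj k X.V a ⟶ vertexObj k X.V b) : X.evalD a ⟶ X.evalD b :=
  Functor.whiskerRight (mapCbNat (evalMap x)) (Q _)

variable {X}

/-- The total space of a representation, i.e. the underlying vector space of the corresponding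
right module over the path algebra. -/
abbrev Tot (W : X.Rep) : Type _ := ∀ a : X.V, W.obj.space a

/-- The right action of the path algebra on the total space. -/
def rightAct (W : X.Rep) (t : Tot W) (x : PathAlg k X.V) : Tot W :=
  letI := Fintype.ofFinite X.V
  fun b ↦ ∑ a, (W.obj.act (x a b)).hom (t a)

/-- The map on total spaces induced by a morphism of representations. -/
def totMap {W W' : X.Rep} (φ : W ⟶ W') (t : Tot W) : Tot W' := fun a ↦ (φ.hom.app _).hom (t a)

variable {Y : BoundQuiver.{u, v, w} k}

/-- An identification of the functor `G` with the restriction of scalars along the homomorphism of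
algebras `f`, when representations are identified with right modules (their total spaces). -/
structure RestrictionIso (f : X.BoundPathAlg →ₐ[k] Y.BoundPathAlg) (G : Y.Rep ⥤ X.Rep) where
  equiv (W : Y.Rep) : Tot (G.obj W) ≃ₗ[k] Tot W
  natural {W W' : Y.Rep} (φ : W ⟶ W') (t : Tot (G.obj W)) :
    equiv W' (totMap (G.map φ) t) = totMap φ (equiv W t)
  act (W : Y.Rep) (x : PathAlg k X.V) (y : PathAlg k Y.V) (h : f (X.proj x) = Y.proj y)
    (t : Tot (G.obj W)) : equiv W (rightAct (G.obj W) t x) = rightAct W (equiv W t) y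

end BoundQuiver

end BoundQuivers

end QuiverPoints

end

universe u v w

open QuiverPoints

noncomputable section

namespace QuiverPoints

section TensorComponents

open MonoidalCategory HomologicalComplex

variable {B : Type*} [Category* B] [Abelian B] [MonoidalCategory B] [MonoidalPreadditive B]
  [HasColimitsOfSize.{0, 0} B]
  [∀ X : B, PreservesColimitsOfSize.{0, 0} ((curriedTensor B).obj X)]
  [∀ X : B, PreservesColimitsOfSize.{0, 0} ((curriedTensor B).flip.obj X)]

lemma tensorObj₃_hom_ext {K L M : CochainComplex B ℤ} {n : ℤ} {Y : B}
    {f g : ((K ⊗ L) ⊗ M).X n ⟶ Y}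
    (h : ∀ (p q r : ℤ) (h : p + q + r = n),
      ιTensorObj K L p q (p + q) rfl ▷ M.X r ≫ ιTensorObj (K ⊗ L) M (p + q) r n h ≫ f =
      ιTensorObj K L p q (p + q) rfl ▷ M.X r ≫ ιTensorObj (K ⊗ L) M (p + q) r n h ≫ g) : f = g := by
  refine mapBifunctor₁₂.hom_ext (F₁₂ := curriedTensor B) (G := curriedTensor B) (K₁ := K) (K₂ := L)
    (K₃ := M) (c₁₂ := .up ℤ) (c₄ := .up ℤ) (fun p q r hr ↦ ?_)
  have e := mapBifunctor₁₂.ι_eq (curriedTensor B) (curriedTensor B) K L M (.up ℤ) (.up ℤ)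
    p q r (p + q) n rfl hr
  rw [e]
  exact (Category.assoc _ _ _).trans ((h p q r hr).trans (Category.assoc _ _ _).symm)

lemma ι_associator (K L M : CochainComplex B ℤ) (p q r n : ℤ) (h : p + q + r = n) :
    ιTensorObj K L p q (p + q) rfl ▷ M.X r ≫ ιTensorObj (K ⊗ L) M (p + q) r n h ≫
      (α_ K L M).hom.f n =
    (α_ (K.X p) (L.X q) (M.X r)).hom ≫ K.X p ◁ ιTensorObj L M q r (q + r) rfl ≫
      ιTensorObj K (L ⊗ M) p (q + r) n (by rw [← h]; ring) := by
  have e := mapBifunctor₁₂.ι_eq (curriedTensor B) (curriedTensor B) K L M (.up ℤ) (.up ℤ)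
    p q r (p + q) n rfl h
  have e' := mapBifunctor₂₃.ι_eq (curriedTensor B) (curriedTensor B) K L M (.up ℤ) (.up ℤ) (.up ℤ)
    p q r (q + r) n rfl (by change p + (q + r) = n; rw [← h]; ring)
  have e'' := ι_mapBifunctorAssociatorX_hom (curriedAssociatorNatIso B) K L M (.up ℤ) (.up ℤ)
    (.up ℤ) p q r n h
  rw [e, e'] at e''
  exact (Category.assoc _ _ _).symm.trans e''

lemma leftUnitor_inv_f (K : CochainComplex B ℤ) (n : ℤ) :
    (λ_ K).inv.f n = (λ_ (K.X n)).inv ≫ (singleObjXSelf (.up ℤ) 0 (𝟙_ B)).inv ▷ K.X n ≫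
      ιTensorObj (𝟙_ (CochainComplex B ℤ)) K 0 n n (zero_add n) :=
  leftUnitor'_inv K n

lemma rightUnitor_inv_f (K : CochainComplex B ℤ) (n : ℤ) :
    (ρ_ K).inv.f n = (ρ_ (K.X n)).inv ≫ K.X n ◁ (singleObjXSelf (.up ℤ) 0 (𝟙_ B)).inv ≫
      ιTensorObj K (𝟙_ (CochainComplex B ℤ)) n 0 n (add_zero n) :=
  rightUnitor'_inv K n

end TensorComponents

section EvcMonoidal

open MonoidalCategory HomologicalComplex

variable {J : Type*} [Category* J] {k : Type u} [Field k] (j : J)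

/-- The value at `j` of the unit complex is the unit complex. -/
def evcUnit : 𝟙_ (CochainComplex (ModuleCat.{u} k) ℤ) ≅
    (evc j).obj (𝟙_ (CochainComplex (J ⥤ ModuleCat.{u} k) ℤ)) :=
  ((singleMapHomologicalComplex ((evaluation J (ModuleCat.{u} k)).obj j) (.up ℤ) 0).app
    (𝟙_ (J ⥤ ModuleCat.{u} k))).symm

lemma singleObjXSelf_evcUnit :
    (singleObjXSelf (.up ℤ) (0 : ℤ) (𝟙_ (ModuleCat.{u} k))).inv ≫ (evcUnit (k := k) j).hom.f 0 =
      (singleObjXSelf (.up ℤ) (0 : ℤ) (𝟙_ (J ⥤ ModuleCat.{u} k))).inv.app j := by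
  have := singleMapHomologicalComplex_inv_app_self ((evaluation J (ModuleCat.{u} k)).obj j)
    (.up ℤ) (0 : ℤ) (𝟙_ (J ⥤ ModuleCat.{u} k))
  change _ ≫ ((singleMapHomologicalComplex ((evaluation J (ModuleCat.{u} k)).obj j) (.up ℤ) 0).inv.app
    (𝟙_ (J ⥤ ModuleCat.{u} k))).f 0 = _
  rw [this]
  exact Iso.inv_hom_id_assoc _ _

lemma evcTensor_associativity (K L M : CochainComplex (J ⥤ ModuleCat.{u} k) ℤ) :
    evcTensor j K L ▷ (evc j).obj M ≫ evcTensor j (K ⊗ L) M ≫ (evc j).map (α_ K L M).hom =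
      (α_ ((evc j).obj K) ((evc j).obj L) ((evc j).obj M)).hom ≫
        (evc j).obj K ◁ evcTensor j L M ≫ evcTensor j K (L ⊗ M) := by
  ext n : 1
  refine tensorObj₃_hom_ext (fun p q r h ↦ ?_)
  have h' : p + (q + r) = n := by rw [← h]; ring
  have a₁ := ιTensorObj_whiskerRight (evcTensor j K L) ((evc j).obj M) (p + q) r n h
  have a₂ : ιTensorObj ((evc j).obj K) ((evc j).obj L) p q (p + q) rfl ≫
    (evcTensor j K L).f (p + q) = (ιTensorObj K L p q (p + q) rfl).app j := ι_evcTensorX j K L p q _ rfl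
  have a₃ := ι_evcTensorX j (K ⊗ L) M (p + q) r n h
  have a₄ := congr_app (ι_associator K L M p q r n h) j
  have b₁ := ι_associator ((evc j).obj K) ((evc j).obj L) ((evc j).obj M) p q r n h
  have b₂ := ιTensorObj_whiskerLeft ((evc j).obj K) (evcTensor j L M) p (q + r) n h'
  have b₃ : ιTensorObj ((evc j).obj L) ((evc j).obj M) q r (q + r) rfl ≫
    (evcTensor j L M).f (q + r) = (ιTensorObj L M q r (q + r) rfl).app j := ι_evcTensorX j L M q r _ rfl
  have b₄ := ι_evcTensorX j K (L ⊗ M) p (q + r) n h'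
  refine Eq.trans (b := (ιTensorObj K L p q (p + q) rfl ▷ M.X r ≫
    ιTensorObj (K ⊗ L) M (p + q) r n h ≫ (α_ K L M).hom.f n).app j) ?_ ?_
  · rw [HomologicalComplex.comp_f, HomologicalComplex.comp_f]
    have a₁' := reassoc_of% a₁
    refine (congr_arg (ιTensorObj ((evc j).obj K) ((evc j).obj L) p q (p + q) rfl ▷
      ((evc j).obj M).X r ≫ ·) (a₁' _)).trans ?_
    rw [← comp_whiskerRight_assoc, a₂]
    have a₃' := reassoc_of% a₃
    exact congr_arg ((ιTensorObj K L p q (p + q) rfl).app j ▷ (M.X r).obj j ≫ ·) (a₃' _)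
  · rw [a₄, HomologicalComplex.comp_f, HomologicalComplex.comp_f]
    have b₁' := reassoc_of% b₁
    refine Eq.trans ?_ (b₁' _).symm
    have b₂' := reassoc_of% b₂
    refine Eq.trans ?_ (congr_arg (fun φ ↦ (α_ ((K.X p).obj j) ((L.X q).obj j) ((M.X r).obj j)).hom ≫
      ((evc j).obj K).X p ◁ ιTensorObj ((evc j).obj L) ((evc j).obj M) q r (q + r) rfl ≫ φ)
        (b₂' _)).symm
    have b₃' := (MonoidalCategory.whiskerLeft_comp (((evc j).obj K).X p) _ _).symm.trans
      (congr_arg (((evc j).obj K).X p ◁ ·) b₃)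
    have b₃'' := reassoc_of% b₃'
    refine Eq.trans ?_ (congr_arg (fun φ ↦ (α_ ((K.X p).obj j) ((L.X q).obj j)
      ((M.X r).obj j)).hom ≫ φ) (b₃'' _)).symm
    exact (congr_arg (fun φ ↦ (α_ ((K.X p).obj j) ((L.X q).obj j) ((M.X r).obj j)).hom ≫
      (K.X p).obj j ◁ (ιTensorObj L M q r (q + r) rfl).app j ≫ φ) b₄).symm

lemma evcTensor_leftUnitality (K : CochainComplex (J ⥤ ModuleCat.{u} k) ℤ) :
    (λ_ ((evc j).obj K)).inv ≫ (evcUnit j).hom ▷ (evc j).obj K ≫ evcTensor j _ K =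
      (evc j).map (λ_ K).inv := by
  ext n : 1
  have a₁ := leftUnitor_inv_f ((evc j).obj K) n
  have a₂ := ιTensorObj_whiskerRight (evcUnit (k := k) j).hom ((evc j).obj K) 0 n n (zero_add n)
  have a₃ := ι_evcTensorX j (𝟙_ (CochainComplex (J ⥤ ModuleCat.{u} k) ℤ)) K 0 n n (zero_add n)
  have a₄ := congr_app (leftUnitor_inv_f K n) j
  refine Eq.trans ?_ a₄.symm
  rw [HomologicalComplex.comp_f, HomologicalComplex.comp_f, a₁]
  simp only [Category.assoc]
  rw [reassoc_of% a₂, ← comp_whiskerRight_assoc, singleObjXSelf_evcUnit]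
  exact congr_arg (fun φ ↦ (λ_ ((K.X n).obj j)).inv ≫
    (singleObjXSelf (.up ℤ) (0 : ℤ) (𝟙_ (J ⥤ ModuleCat.{u} k))).inv.app j ▷ (K.X n).obj j ≫ φ) a₃

lemma evcTensor_rightUnitality (K : CochainComplex (J ⥤ ModuleCat.{u} k) ℤ) :
    (ρ_ ((evc j).obj K)).inv ≫ (evc j).obj K ◁ (evcUnit j).hom ≫ evcTensor j K _ =
      (evc j).map (ρ_ K).inv := by
  ext n : 1
  have a₁ := rightUnitor_inv_f ((evc j).obj K) n
  have a₂ := ιTensorObj_whiskerLeft ((evc j).obj K) (evcUnit (k := k) j).hom n 0 n (add_zero n)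
  have a₃ := ι_evcTensorX j K (𝟙_ (CochainComplex (J ⥤ ModuleCat.{u} k) ℤ)) n 0 n (add_zero n)
  have a₄ := congr_app (rightUnitor_inv_f K n) j
  refine Eq.trans ?_ a₄.symm
  rw [HomologicalComplex.comp_f, HomologicalComplex.comp_f, a₁]
  simp only [Category.assoc]
  rw [reassoc_of% a₂, ← MonoidalCategory.whiskerLeft_comp_assoc, singleObjXSelf_evcUnit]
  exact congr_arg (fun φ ↦ (ρ_ ((K.X n).obj j)).inv ≫
    (K.X n).obj j ◁ (singleObjXSelf (.up ℤ) (0 : ℤ) (𝟙_ (J ⥤ ModuleCat.{u} k))).inv.app j ≫ φ) a₃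

variable (J k) in
/-- The values at `j` define a monoidal functor on complexes. -/
def evcCoreMonoidal : (evc (J := J) (k := k) j).CoreMonoidal where
  εIso := evcUnit j
  μIso K L := asIso (evcTensor j K L)
  μIso_hom_natural_left f L := (evcTensor_whiskerRight j f L).symm
  μIso_hom_natural_right K f := (evcTensor_whiskerLeft j K f).symm
  associativity K L M := evcTensor_associativity j K L M
  left_unitality K := by
    rw [← cancel_epi (λ_ _).inv, Iso.inv_hom_id]
    refine Eq.trans ?_ ((reassoc_of% evcTensor_leftUnitality j K) _).symm
    rw [← Functor.map_comp, Iso.inv_hom_id, CategoryTheory.Functor.map_id]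
  right_unitality K := by
    rw [← cancel_epi (ρ_ _).inv, Iso.inv_hom_id]
    refine Eq.trans ?_ ((reassoc_of% evcTensor_rightUnitality j K) _).symm
    rw [← Functor.map_comp, Iso.inv_hom_id, CategoryTheory.Functor.map_id]

instance : (evc (J := J) (k := k) j).Monoidal := (evcCoreMonoidal J k j).toMonoidal

end EvcMonoidal

section LiftMonoidal

open MonoidalCategory

variable {C D : Type*} [Category* C] [Category* D] [MonoidalCategory C] [MonoidalCategory D]

/-- The restriction of a monoidal functor to full monoidal subcategories. -/
def liftCoreMonoidal (P : ObjectProperty C) [P.IsMonoidal] (P' : ObjectProperty D) [P'.IsMonoidal]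
    (F : C ⥤ D) [F.Monoidal] (h : ∀ X : P.FullSubcategory, P' (F.obj X.obj)) :
    (P'.lift (P.ι ⋙ F) h).CoreMonoidal where
  εIso := P'.isoMk (Functor.Monoidal.εIso F)
  μIso X Y := P'.isoMk (Functor.Monoidal.μIso F X.obj Y.obj)
  μIso_hom_natural_left f Y := by ext1; exact Functor.LaxMonoidal.μ_natural_left F f.hom Y.obj
  μIso_hom_natural_right X f := by ext1; exact Functor.LaxMonoidal.μ_natural_right F X.obj f.hom
  associativity X Y Z := by ext1; exact Functor.LaxMonoidal.associativity F X.obj Y.obj Z.obj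
  left_unitality X := by ext1; exact Functor.LaxMonoidal.left_unitality F X.obj
  right_unitality X := by ext1; exact Functor.LaxMonoidal.right_unitality F X.obj

end LiftMonoidal

end QuiverPoints

namespace QuiverPoints

section CommShiftLemmas

variable {C D E : Type*} [Category* C] [Category* D] [Category* E] (A : Type*) [AddMonoid A]
  [HasShift C A] [HasShift D A] [HasShift E A]

lemma commShift_of_whiskerLeft_essSurj (L : C ⥤ D)
    [L.EssSurj] [L.CommShift A] {F G : D ⥤ E} [F.CommShift A] [G.CommShift A]
    (τ : F ⟶ G) [NatTrans.CommShift (Functor.whiskerLeft L τ) A] : NatTrans.CommShift τ A where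
  shift_comm a := by
    ext Y
    let e := L.objObjPreimageIso Y
    let X := L.objPreimage Y
    have h := NatTrans.shift_app_comm (Functor.whiskerLeft L τ) a X
    simp only [Functor.comp_obj, Functor.commShiftIso_comp_hom_app, Functor.whiskerLeft_app,
      Category.assoc] at h
    have h' : (F.commShiftIso a).hom.app (L.obj X) ≫ (τ.app (L.obj X))⟦a⟧' =
        τ.app _ ≫ (G.commShiftIso a).hom.app (L.obj X) := by
      rw [← cancel_epi (F.map ((L.commShiftIso a).hom.app X)), h]
      exact (τ.naturality_assoc _ _).symm
    dsimp
    rw [← cancel_epi (F.map (e.hom⟦a⟧'))]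
    have n₁ := (F.commShiftIso a).hom.naturality e.hom
    have n₂ := (G.commShiftIso a).hom.naturality e.hom
    dsimp at n₁ n₂
    rw [reassoc_of% n₁, ← Functor.map_comp, τ.naturality, Functor.map_comp, reassoc_of% h',
      ← n₂, τ.naturality_assoc]

lemma commShift_of_whiskerRight_faithful {F G : C ⥤ D} [F.CommShift A] [G.CommShift A]
    (τ : F ⟶ G) (H : D ⥤ E) [H.CommShift A] [H.Faithful]
    [NatTrans.CommShift (Functor.whiskerRight τ H) A] : NatTrans.CommShift τ A where
  shift_comm a := by
    ext X
    apply H.map_injective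
    have h := NatTrans.shift_app_comm (Functor.whiskerRight τ H) a X
    simp only [Functor.comp_obj, Functor.commShiftIso_comp_hom_app, Functor.whiskerRight_app,
      Category.assoc] at h
    have n := (H.commShiftIso a).hom.naturality (τ.app X)
    dsimp at n h ⊢
    rw [← cancel_mono ((H.commShiftIso a).hom.app _), Functor.map_comp, Functor.map_comp,
      Category.assoc, Category.assoc, n, h]

end CommShiftLemmas

section MapDb

variable {A B C : Type*} [Category* A] [Abelian A] [Category* B] [Abelian B] [Category* C]
  [Abelian C]

/-- The functor between bounded homotopy categories induced by an additive functor. -/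
def mapKb (G : A ⥤ B) [G.Additive] : Kb A ⥤ Kb B :=
  (boundedK B).lift ((boundedK A).ι ⋙ G.mapHomotopyCategory (.up ℤ)) (fun K ↦ by
    obtain ⟨L, rfl⟩ := quotientb_obj_surjective K
    exact (boundedK_quotient_obj_iff _).2 ((mapCb G).obj L).property)

instance (G : A ⥤ B) [G.Additive] : (mapKb G).CommShift ℤ :=
  inferInstanceAs (((boundedK B).lift ((boundedK A).ι ⋙ G.mapHomotopyCategory (.up ℤ)) _).CommShift ℤ)

instance (G : A ⥤ B) [G.Additive] : (mapKb G).IsTriangulated :=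
  inferInstanceAs (((boundedK B).lift ((boundedK A).ι ⋙ G.mapHomotopyCategory (.up ℤ)) _).IsTriangulated)

instance (G : A ⥤ B) [G.Additive] : (mapKb G).Additive where
  map_add {_ _ f g} := by
    ext1
    exact (G.mapHomotopyCategory (.up ℤ)).map_add (f := f.hom) (g := g.hom)

instance (k : Type*) [Ring k] [Linear k A] [Linear k B] (G : A ⥤ B) [G.Additive] [G.Linear k] :
    (mapKb G).Linear k where
  map_smul f r := by
    ext1
    exact (G.mapHomotopyCategory (.up ℤ)).map_smul r f.hom

/-- The functor induced on the bounded homotopy categories is the restriction of the functor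
between the homotopy categories. -/
def mapKbι (G : A ⥤ B) [G.Additive] :
    mapKb G ⋙ (boundedK B).ι ≅ (boundedK A).ι ⋙ G.mapHomotopyCategory (.up ℤ) :=
  (boundedK B).liftCompιIso _ _

instance (G : A ⥤ B) [G.Additive] : NatTrans.CommShift (mapKbι G).hom ℤ :=
  inferInstanceAs (NatTrans.CommShift ((boundedK B).liftCompιIso
    ((boundedK A).ι ⋙ G.mapHomotopyCategory (.up ℤ)) _).hom ℤ)

/-- An additive functor which preserves the quasi-isomorphisms of bounded complexes. -/
class PreservesQis (G : A ⥤ B) [G.Additive] : Prop where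
  map {K L : Cb A} (f : K ⟶ L) : quasiIsoCb A f → quasiIsoCb B ((mapCb G).map f)

lemma mapKb_inverts (G : A ⥤ B) [G.Additive] [PreservesQis G] :
    (acyclicKb A).trW.IsInvertedBy (mapKb G ⋙ Qh B) := by
  intro K L f hf
  obtain ⟨K, rfl⟩ := quotientb_obj_surjective K
  obtain ⟨L, rfl⟩ := quotientb_obj_surjective L
  obtain ⟨f, rfl⟩ := (quotientb A).map_surjective f
  exact Localization.inverts (Qh B) (acyclicKb B).trW _
    ((trW_quotientb_iff B _).2 (PreservesQis.map f ((trW_quotientb_iff A f).1 hf)))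

/-- The functor between bounded derived categories induced by an exact functor. -/
def mapDb (G : A ⥤ B) [G.Additive] [PreservesQis G] : Db A ⥤ Db B :=
  Localization.lift (mapKb G ⋙ Qh B) (mapKb_inverts G) (Qh A)

instance (G : A ⥤ B) [G.Additive] [PreservesQis G] :
    Localization.Lifting (Qh A) (acyclicKb A).trW (mapKb G ⋙ Qh B) (mapDb G) :=
  inferInstanceAs (Localization.Lifting (Qh A) (acyclicKb A).trW (mapKb G ⋙ Qh B)
    (Localization.lift (mapKb G ⋙ Qh B) (mapKb_inverts G) (Qh A)))

/-- The functor induced on the bounded derived categories extends the one on the homotopy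
categories. -/
def mapDbFach (G : A ⥤ B) [G.Additive] [PreservesQis G] : Qh A ⋙ mapDb G ≅ mapKb G ⋙ Qh B :=
  Localization.Lifting.iso (Qh A) (acyclicKb A).trW (mapKb G ⋙ Qh B) (mapDb G)

instance (G : A ⥤ B) [G.Additive] [PreservesQis G] : (mapDb G).CommShift ℤ :=
  Functor.commShiftOfLocalization (Qh A) (acyclicKb A).trW ℤ (mapKb G ⋙ Qh B) (mapDb G)

instance (G : A ⥤ B) [G.Additive] [PreservesQis G] : NatTrans.CommShift (mapDbFach G).hom ℤ :=
  NatTrans.commShift_iso_hom_of_localization (Qh A) (acyclicKb A).trW ℤ (mapKb G ⋙ Qh B) (mapDb G)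

instance : (Qh A).mapArrow.EssSurj := Localization.essSurj_mapArrow (Qh A) (acyclicKb A).trW

instance (G : A ⥤ B) [G.Additive] [PreservesQis G] : (mapDb G).IsTriangulated :=
  Functor.isTriangulated_of_precomp_iso (mapDbFach G)

instance (G : A ⥤ B) [G.Additive] [PreservesQis G] : (mapDb G).Additive := by
  rw [Localization.functor_additive_iff (Qh A) (acyclicKb A).trW]
  exact Functor.additive_of_iso (mapDbFach G).symm

instance (k : Type*) [Ring k] [Linear k A] [Linear k B] (G : A ⥤ B) [G.Additive] [G.Linear k]
    [PreservesQis G] : (mapDb G).Linear k := by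
  rw [← Localization.functor_linear_iff (Qh A) (acyclicKb A).trW k (mapKb G ⋙ Qh B)]
  infer_instance

/-- The functor induced on the bounded derived categories extends the one on complexes. -/
def mapDbFac (G : A ⥤ B) [G.Additive] [PreservesQis G] : Q A ⋙ mapDb G ≅ mapCb G ⋙ Q B :=
  Functor.isoWhiskerLeft (quotientb A) (mapDbFach G)

/-- The natural transformation on bounded homotopy categories given by a natural transformation. -/
def mapKbNat {G G' : A ⥤ B} [G.Additive] [G'.Additive] (α : G ⟶ G') : mapKb G ⟶ mapKb G' where
  app K := ObjectProperty.homMk ((NatTrans.mapHomotopyCategory α (.up ℤ)).app K.obj)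
  naturality _ _ f := by
    ext1
    exact (NatTrans.mapHomotopyCategory α (.up ℤ)).naturality f.hom

instance {G G' : A ⥤ B} [G.Additive] [G'.Additive] (α : G ⟶ G') :
    NatTrans.CommShift (NatTrans.mapHomologicalComplex α (.up ℤ)) ℤ where
  shift_comm n := by
    ext K i
    simp only [NatTrans.comp_app, Functor.whiskerRight_app, Functor.whiskerLeft_app,
      HomologicalComplex.comp_f, Functor.mapHomologicalComplex_commShiftIso_hom_app_f]
    exact (Category.id_comp _).trans (Category.comp_id _).symm

lemma commShift_mapHomotopyCategory {G G' : A ⥤ B} [G.Additive] [G'.Additive] (α : G ⟶ G') :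
    NatTrans.CommShift (NatTrans.mapHomotopyCategory α (.up ℤ)) ℤ := by
  have : Functor.whiskerLeft (HomotopyCategory.quotient A (.up ℤ))
      (NatTrans.mapHomotopyCategory α (.up ℤ)) =
      (G.mapHomotopyCategoryFactors (.up ℤ)).hom ≫
        Functor.whiskerRight (NatTrans.mapHomologicalComplex α (.up ℤ))
          (HomotopyCategory.quotient B (.up ℤ)) ≫
        (G'.mapHomotopyCategoryFactors (.up ℤ)).inv := by
    ext K
    exact (Category.id_comp _).symm.trans (congr_arg (𝟙 _ ≫ ·) (Category.comp_id _).symm)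
  have : NatTrans.CommShift (Functor.whiskerLeft (HomotopyCategory.quotient A (.up ℤ))
      (NatTrans.mapHomotopyCategory α (.up ℤ))) ℤ := by
    rw [this]
    infer_instance
  exact commShift_of_whiskerLeft_essSurj ℤ (HomotopyCategory.quotient A (.up ℤ)) _

instance {G G' : A ⥤ B} [G.Additive] [G'.Additive] (α : G ⟶ G') :
    NatTrans.CommShift (mapKbNat α) ℤ := by
  have := commShift_mapHomotopyCategory α
  have : Functor.whiskerRight (mapKbNat α) (boundedK B).ι =
      (mapKbι G).hom ≫ Functor.whiskerLeft (boundedK A).ι (NatTrans.mapHomotopyCategory α (.up ℤ)) ≫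
        (mapKbι G').inv := by
    ext K
    exact (Category.id_comp _).symm.trans (congr_arg (𝟙 _ ≫ ·) (Category.comp_id _).symm)
  have : NatTrans.CommShift (Functor.whiskerRight (mapKbNat α) (boundedK B).ι) ℤ := by
    rw [this]
    infer_instance
  exact commShift_of_whiskerRight_faithful ℤ _ (boundedK B).ι

/-- The natural transformation on bounded derived categories given by a natural transformation. -/
def mapDbNat {G G' : A ⥤ B} [G.Additive] [G'.Additive] [PreservesQis G] [PreservesQis G']
    (α : G ⟶ G') : mapDb G ⟶ mapDb G' :=
  Localization.liftNatTrans (Qh A) (acyclicKb A).trW (mapKb G ⋙ Qh B) (mapKb G' ⋙ Qh B) _ _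
    (Functor.whiskerRight (mapKbNat α) (Qh B))

lemma whiskerLeft_Qh_mapDbNat {G G' : A ⥤ B} [G.Additive] [G'.Additive] [PreservesQis G]
    [PreservesQis G'] (α : G ⟶ G') :
    Functor.whiskerLeft (Qh A) (mapDbNat α) =
      (mapDbFach G).hom ≫ Functor.whiskerRight (mapKbNat α) (Qh B) ≫ (mapDbFach G').inv := by
  ext K
  exact Localization.liftNatTrans_app _ _ _ _ _ _ _ _

instance {G G' : A ⥤ B} [G.Additive] [G'.Additive] [PreservesQis G] [PreservesQis G']
    (α : G ⟶ G') : NatTrans.CommShift (mapDbNat α) ℤ := by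
  have := Localization.essSurj (Qh A) (acyclicKb A).trW
  have : NatTrans.CommShift (Functor.whiskerLeft (Qh A) (mapDbNat α)) ℤ := by
    rw [whiskerLeft_Qh_mapDbNat]
    infer_instance
  exact commShift_of_whiskerLeft_essSurj ℤ (Qh A) _

lemma whiskerLeft_Q_mapDbNat {G G' : A ⥤ B} [G.Additive] [G'.Additive] [PreservesQis G]
    [PreservesQis G'] (α : G ⟶ G') :
    Functor.whiskerLeft (Q A) (mapDbNat α) =
      (mapDbFac G).hom ≫ Functor.whiskerRight (mapCbNat α) (Q B) ≫ (mapDbFac G').inv := by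
  ext K
  exact Localization.liftNatTrans_app _ _ _ _ _ _ _ _

section Counit

variable {G : A ⥤ B} {G' : B ⥤ A} [G.Additive] [G'.Additive] (c : G ⋙ G' ⟶ 𝟭 A)

/-- The natural transformation on complexes given by a natural transformation from a composition
to the identity. -/
def mapCounit : G.mapHomologicalComplex (.up ℤ) ⋙ G'.mapHomologicalComplex (.up ℤ) ⟶
    𝟭 (CochainComplex A ℤ) where
  app K :=
    { f i := c.app (K.X i)
      comm' i j _ := (c.naturality (K.d i j)).symm }
  naturality K L f := by
    ext i
    exact c.naturality (f.f i)

instance : NatTrans.CommShift (mapCounit c) ℤ where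
  shift_comm n := by
    ext K i
    simp only [NatTrans.comp_app, Functor.whiskerRight_app, Functor.whiskerLeft_app,
      HomologicalComplex.comp_f, Functor.commShiftIso_comp_hom_app, Functor.commShiftIso_id_hom_app]
    simp only [Functor.mapHomologicalComplex_commShiftIso_hom_app_f, Functor.mapHomologicalComplex_map_f]
    refine (congr_arg (· ≫ _) (Category.comp_id _)).trans ?_
    refine Eq.trans ?_ (Category.comp_id _).symm
    exact (congr_arg (· ≫ c.app (K.X (i + n))) (G'.map_id _)).trans (Category.id_comp _)

/-- The natural transformation on homotopy categories given by a natural transformation from a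
composition to the identity. -/
def mapHoCounit : G.mapHomotopyCategory (.up ℤ) ⋙ G'.mapHomotopyCategory (.up ℤ) ⟶
    𝟭 (HomotopyCategory A (.up ℤ)) where
  app K := (HomotopyCategory.quotient A (.up ℤ)).map ((mapCounit c).app K.as)
  naturality K L f := by
    obtain ⟨K, rfl⟩ := K.quotient_obj_surjective
    obtain ⟨L, rfl⟩ := L.quotient_obj_surjective
    obtain ⟨f, rfl⟩ := (HomotopyCategory.quotient _ _).map_surjective f
    exact (HomotopyCategory.quotient A (.up ℤ)).congr_map ((mapCounit c).naturality f)

instance : NatTrans.CommShift (mapHoCounit c) ℤ := by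
  have : Functor.whiskerLeft (HomotopyCategory.quotient A (.up ℤ)) (mapHoCounit c) =
      (Functor.associator _ _ _).inv ≫
        Functor.whiskerRight (G.mapHomotopyCategoryFactors (.up ℤ)).hom
          (G'.mapHomotopyCategory (.up ℤ)) ≫ (Functor.associator _ _ _).hom ≫
        Functor.whiskerLeft (G.mapHomologicalComplex (.up ℤ))
          (G'.mapHomotopyCategoryFactors (.up ℤ)).hom ≫ (Functor.associator _ _ _).inv ≫
        Functor.whiskerRight (mapCounit c) (HomotopyCategory.quotient A (.up ℤ)) ≫
        (Functor.leftUnitor _).hom ≫ (Functor.rightUnitor _).inv := by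
    ext K
    have h : (G'.mapHomotopyCategory (.up ℤ)).map (𝟙 ((G.mapHomotopyCategory (.up ℤ)).obj
      ((HomotopyCategory.quotient A (.up ℤ)).obj K))) = 𝟙 _ := CategoryTheory.Functor.map_id _ _
    change _ = 𝟙 _ ≫ (G'.mapHomotopyCategory (.up ℤ)).map (𝟙 _) ≫ 𝟙 _ ≫ 𝟙 _ ≫ 𝟙 _ ≫ _ ≫ 𝟙 _ ≫ 𝟙 _
    erw [h]
    simp only [Category.id_comp]
    exact (Category.comp_id _).symm
  have : NatTrans.CommShift (Functor.whiskerLeft (HomotopyCategory.quotient A (.up ℤ))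
      (mapHoCounit c)) ℤ := by
    rw [this]
    infer_instance
  exact commShift_of_whiskerLeft_essSurj ℤ (HomotopyCategory.quotient A (.up ℤ)) _

/-- The natural transformation on bounded homotopy categories given by a natural transformation
from a composition to the identity. -/
def mapKbCounit : mapKb G ⋙ mapKb G' ⟶ 𝟭 (Kb A) where
  app K := ObjectProperty.homMk ((mapHoCounit c).app K.obj)
  naturality _ _ f := by
    ext1
    exact (mapHoCounit c).naturality f.hom

instance : NatTrans.CommShift (mapKbCounit c) ℤ := by
  have : Functor.whiskerRight (mapKbCounit c) (boundedK A).ι =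
      (Functor.associator _ _ _).hom ≫ Functor.whiskerLeft (mapKb G) (mapKbι G').hom ≫
        (Functor.associator _ _ _).inv ≫
        Functor.whiskerRight (mapKbι G).hom (G'.mapHomotopyCategory (.up ℤ)) ≫
        (Functor.associator _ _ _).hom ≫
        Functor.whiskerLeft (boundedK A).ι (mapHoCounit c) ≫
        (Functor.rightUnitor _).hom ≫ (Functor.leftUnitor _).inv := by
    ext K
    have h : (G'.mapHomotopyCategory (.up ℤ)).map (𝟙 ((G.mapHomotopyCategory (.up ℤ)).obj K.obj)) =
      𝟙 _ := CategoryTheory.Functor.map_id _ _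
    change (mapHoCounit c).app K.obj = 𝟙 _ ≫ 𝟙 _ ≫ 𝟙 _ ≫
      (G'.mapHomotopyCategory (.up ℤ)).map (𝟙 _) ≫ 𝟙 _ ≫ (mapHoCounit c).app K.obj ≫ 𝟙 _ ≫ 𝟙 _
    erw [h]
    simp only [Category.id_comp]
    exact (Category.comp_id _).symm
  have : NatTrans.CommShift (Functor.whiskerRight (mapKbCounit c) (boundedK A).ι) ℤ := by
    rw [this]
    infer_instance
  exact commShift_of_whiskerRight_faithful ℤ _ (boundedK A).ι

variable [PreservesQis G] [PreservesQis G']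

/-- Auxiliary definition for `mapDbCounit`. -/
def mapDbCounitAux : Qh A ⋙ mapDb G ⋙ mapDb G' ⟶ Qh A :=
  (Functor.associator _ _ _).inv ≫ Functor.whiskerRight (mapDbFach G).hom (mapDb G') ≫
    (Functor.associator _ _ _).hom ≫ Functor.whiskerLeft (mapKb G) (mapDbFach G').hom ≫
    (Functor.associator _ _ _).inv ≫ Functor.whiskerRight (mapKbCounit c) (Qh A) ≫
    (Functor.leftUnitor _).hom

instance : NatTrans.CommShift (mapDbCounitAux c) ℤ := by
  dsimp only [mapDbCounitAux]
  infer_instance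

/-- The natural transformation on bounded derived categories given by a natural transformation
from a composition to the identity. -/
def mapDbCounit : mapDb G ⋙ mapDb G' ⟶ 𝟭 (Db A) :=
  letI : Localization.Lifting (Qh A) (acyclicKb A).trW (Qh A ⋙ mapDb G ⋙ mapDb G')
    (mapDb G ⋙ mapDb G') := ⟨Iso.refl _⟩
  letI : Localization.Lifting (Qh A) (acyclicKb A).trW (Qh A) (𝟭 (Db A)) :=
    ⟨Functor.rightUnitor _⟩
  Localization.liftNatTrans (Qh A) (acyclicKb A).trW (Qh A ⋙ mapDb G ⋙ mapDb G') (Qh A) _ _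
    (mapDbCounitAux c)

lemma mapDbCounit_app_Qh (K : Kb A) :
    (mapDbCounit c).app ((Qh A).obj K) = (mapDbCounitAux c).app K := by
  refine (Localization.liftNatTrans_app _ _ _ _ _ _ _ _).trans ?_
  exact (Category.id_comp _).trans (Category.comp_id _)

instance : NatTrans.CommShift (mapDbCounit c) ℤ := by
  have := Localization.essSurj (Qh A) (acyclicKb A).trW
  have : Functor.whiskerLeft (Qh A) (mapDbCounit c) =
      mapDbCounitAux c ≫ (Functor.rightUnitor _).inv := by
    ext K
    exact (mapDbCounit_app_Qh c K).trans (Category.comp_id _).symm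
  have : NatTrans.CommShift (Functor.whiskerLeft (Qh A) (mapDbCounit c)) ℤ := by
    rw [this]
    infer_instance
  exact commShift_of_whiskerLeft_essSurj ℤ (Qh A) _

/-- The natural transformation on bounded complexes given by a natural transformation
from a composition to the identity. -/
def mapCbCounit : mapCb G ⋙ mapCb G' ⟶ 𝟭 (Cb A) where
  app K := ObjectProperty.homMk ((mapCounit c).app K.obj)
  naturality _ _ f := by
    ext1
    exact (mapCounit c).naturality f.hom

lemma mapDbCounit_app_Q (K : Cb A) :
    (mapDbCounit c).app ((Q A).obj K) =
      (mapDb G').map ((mapDbFac G).hom.app K) ≫ (mapDbFac G').hom.app ((mapCb G).obj K) ≫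
        (Q A).map ((mapCbCounit c).app K) := by
  refine (mapDbCounit_app_Qh c _).trans ?_
  change 𝟙 _ ≫ (mapDb G').map ((mapDbFac G).hom.app K) ≫ 𝟙 _ ≫
    (mapDbFac G').hom.app ((mapCb G).obj K) ≫ 𝟙 _ ≫ (Q A).map ((mapCbCounit c).app K) ≫ 𝟙 _ = _
  simp only [Category.id_comp]
  congr 2

end Counit

end MapDb

end QuiverPoints

namespace QuiverPoints

section GradedLine

variable (k : Type*) [Field k] {S : Type*} [Category* S] [Preadditive S] [HasShift S ℤ]
  [∀ n : ℤ, (shiftFunctor S n).Additive] [Linear k S]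

/-- The objects of `S` behave like finite dimensional graded vector spaces, with respect to the
shifts of a given object. -/
structure IsGradedLine (U : S) : Prop where
  hom_eq_zero {n m : ℤ} (h : n ≠ m) (f : U⟦n⟧ ⟶ U⟦m⟧) : f = 0
  hom_eq_smul {n : ℤ} (f : U⟦n⟧ ⟶ U⟦n⟧) : ∃ c : k, f = c • 𝟙 _
  id_mem_span (M : S) : 𝟙 M ∈ Submodule.span k
    {f : M ⟶ M | ∃ (n : ℤ) (q : M ⟶ U⟦n⟧) (p : U⟦n⟧ ⟶ M), f = q ≫ p}

namespace IsGradedLine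

variable {k} {U : S} (hU : IsGradedLine k U)

include hU

lemma hom_ext {M N : S} {f g : M ⟶ N} (h : ∀ (n : ℤ) (x : U⟦n⟧ ⟶ M), x ≫ f = x ≫ g) : f = g := by
  have key : ∀ e ∈ Submodule.span k
      {f : M ⟶ M | ∃ (n : ℤ) (q : M ⟶ U⟦n⟧) (p : U⟦n⟧ ⟶ M), f = q ≫ p}, e ≫ f = e ≫ g := by
    intro e he
    induction he using Submodule.span_induction with
    | mem e he =>
      obtain ⟨n, q, p, rfl⟩ := he
      rw [Category.assoc, Category.assoc, h]
    | zero => simp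
    | add _ _ _ _ h₁ h₂ => simp [h₁, h₂]
    | smul c _ _ h => simp [h]
  simpa using key _ (hU.id_mem_span M)

lemma exists_hom {M N : S} (φ : ∀ n : ℤ, (U⟦n⟧ ⟶ M) →ₗ[k] (U⟦n⟧ ⟶ N)) :
    ∃ g : M ⟶ N, ∀ (n : ℤ) (x : U⟦n⟧ ⟶ M), x ≫ g = φ n x := by
  have key : ∀ e ∈ Submodule.span k
      {f : M ⟶ M | ∃ (n : ℤ) (q : M ⟶ U⟦n⟧) (p : U⟦n⟧ ⟶ M), f = q ≫ p},
        ∃ g : M ⟶ N, ∀ (n : ℤ) (x : U⟦n⟧ ⟶ M), x ≫ g = φ n (x ≫ e) := by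
    intro e he
    induction he using Submodule.span_induction with
    | mem e he =>
      obtain ⟨m, q, p, rfl⟩ := he
      refine ⟨q ≫ φ m p, fun n x ↦ ?_⟩
      by_cases h : n = m
      · subst h
        obtain ⟨c, hc⟩ := hU.hom_eq_smul (x ≫ q)
        rw [← Category.assoc, ← Category.assoc, hc]
        simp
      · rw [← Category.assoc, ← Category.assoc, hU.hom_eq_zero h (x ≫ q)]
        simp
    | zero => exact ⟨0, by simp⟩
    | add _ _ _ _ h₁ h₂ =>
      obtain ⟨g₁, h₁⟩ := h₁
      obtain ⟨g₂, h₂⟩ := h₂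
      exact ⟨g₁ + g₂, by simp [h₁, h₂]⟩
    | smul c _ _ h =>
      obtain ⟨g, h⟩ := h
      exact ⟨c • g, by simp [h]⟩
  simpa using key _ (hU.id_mem_span M)

variable (H : S ⥤ S) [H.Additive] [H.Linear k] [H.CommShift ℤ] (u : U ≅ H.obj U)

omit hU in
/-- The isomorphism between the shifts of two objects given by an isomorphism. -/
def shiftIso (n : ℤ) : U⟦n⟧ ≅ H.obj (U⟦n⟧) :=
  (shiftFunctor S n).mapIso u ≪≫ (H.commShiftIso n).symm.app U

omit hU in
lemma shiftIso_comp (n a m : ℤ) (h : m + a = n) :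
    (shiftIso H u n).hom ≫ H.map ((shiftFunctorAdd' S m a n h).hom.app U) ≫
      (H.commShiftIso a).hom.app (U⟦m⟧) =
    (shiftFunctorAdd' S m a n h).hom.app U ≫ (shiftIso H u m).hom⟦a⟧' := by
  have e := H.commShiftIso_add' h
  simp only [shiftIso, Iso.trans_hom, Functor.mapIso_hom, Iso.app_hom, Iso.symm_hom, e,
    Functor.CommShift.isoAdd'_inv_app, Category.assoc, Functor.map_comp]
  rw [← Functor.map_comp_assoc, Iso.inv_hom_id_app]
  have := (shiftFunctorAdd' S m a n h).hom.naturality u.hom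
  dsimp at this ⊢
  rw [CategoryTheory.Functor.map_id, Category.id_comp, Iso.inv_hom_id_app]
  erw [Category.comp_id]
  rw [← Category.assoc, this, Category.assoc]

/-- The components of the natural transformation from the identity to an endofunctor. -/
lemma exists_unit_app (M : S) : ∃ g : M ⟶ H.obj M, ∀ (n : ℤ) (x : U⟦n⟧ ⟶ M),
    x ≫ g = (shiftIso H u n).hom ≫ H.map x :=
  hU.exists_hom (fun n ↦
    { toFun x := (shiftIso H u n).hom ≫ H.map x
      map_add' := by simp [Functor.map_add]
      map_smul' := by simp [Functor.map_smul] })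

/-- A natural transformation from the identity to an endofunctor, which is given on an object. -/
def unit : 𝟭 S ⟶ H where
  app M := (hU.exists_unit_app H u M).choose
  naturality M N f := by
    refine hU.hom_ext (fun n x ↦ ?_)
    have h₁ := (hU.exists_unit_app H u M).choose_spec n x
    have h₂ := (hU.exists_unit_app H u N).choose_spec n (x ≫ f)
    dsimp
    rw [reassoc_of% h₁, ← Category.assoc, h₂, Functor.map_comp]

lemma comp_unit_app {M : S} (n : ℤ) (x : U⟦n⟧ ⟶ M) :
    x ≫ (hU.unit H u).app M = (shiftIso H u n).hom ≫ H.map x :=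
  (hU.exists_unit_app H u M).choose_spec n x

lemma unit_app_shift (n : ℤ) : (hU.unit H u).app (U⟦n⟧) = (shiftIso H u n).hom := by
  have := hU.comp_unit_app H u n (𝟙 _)
  rwa [Category.id_comp, CategoryTheory.Functor.map_id, Category.comp_id] at this

instance commShift_unit : NatTrans.CommShift (hU.unit H u) ℤ where
  shift_comm a := by
    ext M
    refine hU.hom_ext (fun n x ↦ ?_)
    let m := n - a
    have h : m + a = n := by simp [m]
    obtain ⟨y, hy⟩ := (shiftFunctor S a).map_surjective
      ((shiftFunctorAdd' S m a n h).inv.app U ≫ x)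
    obtain rfl : x = (shiftFunctorAdd' S m a n h).hom.app U ≫ y⟦a⟧' := by rw [hy]; simp
    have h₁ := hU.comp_unit_app H u n ((shiftFunctorAdd' S m a n h).hom.app U ≫ y⟦a⟧')
    have h₂ := hU.comp_unit_app H u m y
    have h₃ := (H.commShiftIso a).hom.naturality y
    have h₄ := shiftIso_comp H u n a m h
    simp only [NatTrans.comp_app, Functor.commShiftIso_id_hom_app, Functor.whiskerRight_app,
      Functor.whiskerLeft_app, Functor.id_obj]
    dsimp at h₁ h₂ h₃ ⊢
    rw [Category.id_comp]
    refine Eq.trans ?_ ((congr_arg (· ≫ (H.commShiftIso a).hom.app M) h₁).symm.trans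
      (Category.assoc _ _ _))
    rw [Functor.map_comp, Category.assoc, Category.assoc, Category.assoc, h₃, reassoc_of% h₄,
      ← Functor.map_comp, ← Functor.map_comp, h₂]

lemma isIso_unit_app (M : S) : IsIso ((hU.unit H u).app M) := by
  have key : ∀ e ∈ Submodule.span k
      {f : M ⟶ M | ∃ (n : ℤ) (q : M ⟶ U⟦n⟧) (p : U⟦n⟧ ⟶ M), f = q ≫ p},
        ∃ g : H.obj M ⟶ M, (hU.unit H u).app M ≫ g = e ∧ g ≫ (hU.unit H u).app M = H.map e := by
    intro e he
    induction he using Submodule.span_induction with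
    | mem e he =>
      obtain ⟨m, q, p, rfl⟩ := he
      have h₁ := (hU.unit H u).naturality q
      have h₂ := (hU.unit H u).naturality p
      rw [unit_app_shift] at h₁ h₂
      dsimp at h₁ h₂
      refine ⟨H.map q ≫ (shiftIso H u m).inv ≫ p, ?_, ?_⟩
      · rw [← reassoc_of% h₁, Iso.hom_inv_id_assoc]
      · rw [Category.assoc, Category.assoc, h₂, Iso.inv_hom_id_assoc, Functor.map_comp]
    | zero => exact ⟨0, by simp⟩
    | add _ _ _ _ h₁ h₂ =>
      obtain ⟨g₁, h₁, h₁'⟩ := h₁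
      obtain ⟨g₂, h₂, h₂'⟩ := h₂
      exact ⟨g₁ + g₂, by simp [h₁, h₂], by simp [h₁', h₂', Functor.map_add]⟩
    | smul c _ _ h =>
      obtain ⟨g, h, h'⟩ := h
      exact ⟨c • g, by simp [h], by simp [h', Functor.map_smul]⟩
  obtain ⟨g, h₁, h₂⟩ := key _ (hU.id_mem_span M)
  exact ⟨g, h₁, by simpa using h₂⟩

instance isIso_unit : IsIso (hU.unit H u) :=
  have := hU.isIso_unit_app H u
  NatIso.isIso_of_isIso_app _

end IsGradedLine

end GradedLine

end QuiverPoints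

namespace QuiverPoints

section Singles

variable (A : Type*) [Category* A] [Abelian A]

instance : (quotientb A).Additive where
  map_add {_ _ f g} := by
    ext1
    exact (HomotopyCategory.quotient A (.up ℤ)).map_add (f := f.hom) (g := g.hom)

instance : (Q A).Additive := inferInstanceAs (quotientb A ⋙ Qh A).Additive

section

variable (k : Type*) [Ring k] [Linear k A]

instance : (quotientb A).Linear k where
  map_smul f r := by
    ext1
    exact (HomotopyCategory.quotient A (.up ℤ)).map_smul r f.hom

instance : (Q A).Linear k := inferInstanceAs ((quotientb A ⋙ Qh A).Linear k)

end

/-- The complexes concentrated in one degree. -/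
def singleb (n : ℤ) : A ⥤ Cb A :=
  (bounded A).lift (HomologicalComplex.single A (.up ℤ) n) (fun M ↦
    ⟨⟨n, inferInstanceAs (((CochainComplex.singleFunctor A n).obj M).IsStrictlyGE n)⟩,
      ⟨n, inferInstanceAs (((CochainComplex.singleFunctor A n).obj M).IsStrictlyLE n)⟩⟩)

instance (n : ℤ) : (singleb A n).Additive where
  map_add {_ _ f g} := by
    ext1
    exact (HomologicalComplex.single A (.up ℤ) n).map_add (f := f) (g := g)

instance (k : Type*) [Ring k] [Linear k A] (n : ℤ) : (singleb A n).Linear k where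
  map_smul f r := by
    ext1
    exact (CochainComplex.singleFunctor A n).map_smul r f

instance (n : ℤ) : (singleb A n).Full where
  map_surjective f := by
    obtain ⟨g, hg⟩ := (HomologicalComplex.single A (.up ℤ) n).map_surjective f.hom
    exact ⟨g, by ext1; exact hg⟩

instance (n : ℤ) : (singleb A n).Faithful where
  map_injective h :=
    (HomologicalComplex.single A (.up ℤ) n).map_injective ((bounded A).ι.congr_map h)

variable {A}

/-- The shift of the image in the derived category of a bounded complex. -/
def shiftQIso {K L : Cb A} (n : ℤ) (e : K.obj⟦n⟧ ≅ L.obj) : ((Q A).obj K)⟦n⟧ ≅ (Q A).obj L :=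
  ((Qh A).commShiftIso n).symm.app ((quotientb A).obj K) ≪≫
    (Qh A).mapIso ((boundedK A).ι.preimageIso
      (((boundedK A).ι.commShiftIso n).app ((quotientb A).obj K) ≪≫
        ((HomotopyCategory.quotient A (.up ℤ)).commShiftIso n).symm.app K.obj ≪≫
        (HomotopyCategory.quotient A (.up ℤ)).mapIso e))

/-- The shift of an object concentrated in one degree. -/
def shiftSingleIso (M : A) (n a a' : ℤ) (h : n + a = a') :
    ((Q A).obj ((singleb A a').obj M))⟦n⟧ ≅ (Q A).obj ((singleb A a).obj M) :=
  shiftQIso n (((CochainComplex.singleFunctors A).shiftIso n a a' h).app M)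

end Singles

section Projective

variable {A : Type*} [Category* A] [Abelian A] [∀ M : A, Projective M]

lemma exists_homotopy_inverse {K L : Cb A} (f : K ⟶ L) (hf : quasiIsoCb A f) :
    HomologicalComplex.homotopyEquivalences A (.up ℤ) f.hom := by
  obtain ⟨-, m, _⟩ := K.property
  obtain ⟨-, n, _⟩ := L.property
  have := CochainComplex.isKProjective_of_projective K.obj m
  have := CochainComplex.isKProjective_of_projective L.obj n
  have := HasDerivedCategory.standard A
  exact (CochainComplex.IsKProjective.quasiIso_iff f.hom).1 hf

lemma isIso_of_trW {K L : Kb A} (f : K ⟶ L) (hf : (acyclicKb A).trW f) : IsIso f := by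
  obtain ⟨K, rfl⟩ := quotientb_obj_surjective K
  obtain ⟨L, rfl⟩ := quotientb_obj_surjective L
  obtain ⟨f, rfl⟩ := (quotientb A).map_surjective f
  exact Localization.inverts (quotientb A)
    ((HomologicalComplex.homotopyEquivalences A (.up ℤ)).inverseImage (bounded A).ι) f
    (exists_homotopy_inverse f ((trW_quotientb_iff A f).1 hf))

instance : (Qh A).IsEquivalence :=
  have := Functor.IsLocalization.for_id (acyclicKb A).trW (fun _ _ f hf ↦ isIso_of_trW f hf)
  Functor.isEquivalence_of_iso (F := (Localization.uniq (𝟭 (Kb A)) (Qh A) (acyclicKb A).trW).functor)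
    ((Functor.leftUnitor _).symm ≪≫
      Localization.compUniqFunctor (𝟭 (Kb A)) (Qh A) (acyclicKb A).trW)

instance : (Q A).Full := inferInstanceAs (quotientb A ⋙ Qh A).Full

instance : (Q A).EssSurj := inferInstanceAs (quotientb A ⋙ Qh A).EssSurj

instance preservesQis_of_projective {B : Type*} [Category* B] [Abelian B] (G : A ⥤ B) [G.Additive] :
    PreservesQis G where
  map f hf := by
    obtain ⟨e, he⟩ := exists_homotopy_inverse f hf
    refine homotopyEquivalences_le_quasiIso B (.up ℤ) _ ?_
    exact ⟨G.mapHomotopyEquiv e, congr_arg (G.mapHomologicalComplex (.up ℤ)).map he⟩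

lemma Q_map_eq_zero {K L : Cb A} (f : K ⟶ L) (hf : (Q A).map f = 0) (hK : ∀ i j, K.obj.d i j = 0)
    (hL : ∀ i j, L.obj.d i j = 0) : f = 0 := by
  have h : (quotientb A).map f = 0 := (Qh A).map_injective (hf.trans ((Qh A).map_zero _ _).symm)
  have e := HomotopyCategory.homotopyOfEq f.hom 0
    (((boundedK A).ι.congr_map h).trans
      ((HomotopyCategory.quotient A (.up ℤ)).map_zero _ _).symm)
  ext1
  ext i
  rw [e.comm i]
  simp [dNext, prevD, hK, hL]

end Projective

section ZeroDifferential

variable {A : Type*} [Category* A] [Abelian A] [∀ M : A, Projective M]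

/-- The cohomology of a complex, as a complex with zero differential. -/
def homologyComplex (K : CochainComplex A ℤ) : CochainComplex A ℤ where
  X i := K.homology i
  d _ _ := 0

/-- A quasi-isomorphism from the cohomology of a complex with projective terms. -/
def fromHomologyComplex (K : CochainComplex A ℤ) : homologyComplex K ⟶ K where
  f i := Projective.factorThru (𝟙 (K.homology i)) (K.homologyπ i) ≫ K.iCycles i
  comm' i j _ := by simp [homologyComplex]

instance (K : CochainComplex A ℤ) : QuasiIso (fromHomologyComplex K) where
  quasiIsoAt i := by
    rw [quasiIsoAt_iff_isIso_homologyMap]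
    have h₁ := HomologicalComplex.homologyπ_naturality (fromHomologyComplex K) i
    have h₂ : HomologicalComplex.cyclesMap (fromHomologyComplex K) i =
        (homologyComplex K).iCycles i ≫ Projective.factorThru (𝟙 (K.homology i)) (K.homologyπ i) := by
      rw [← cancel_mono (K.iCycles i), HomologicalComplex.cyclesMap_i, Category.assoc]
      rfl
    rw [h₂, Category.assoc] at h₁
    replace h₁ := h₁.trans (congr_arg (fun φ ↦ (homologyComplex K).iCycles i ≫ φ)
      (Projective.factorThru_comp (𝟙 (K.homology i)) (K.homologyπ i)))
    have := (homologyComplex K).isIso_homologyπ (i - 1) i (by simp) rfl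
    have := (homologyComplex K).isIso_iCycles i (i + 1) (by simp) rfl
    have h₃ : IsIso ((homologyComplex K).homologyπ i ≫
      HomologicalComplex.homologyMap (fromHomologyComplex K) i) := by
      rw [h₁]
      exact IsIso.comp_isIso' this (inferInstanceAs (IsIso (𝟙 (K.homology i))))
    exact IsIso.of_isIso_comp_left ((homologyComplex K).homologyπ i) _

lemma bounded_homologyComplex (K : CochainComplex A ℤ) (hK : bounded A K) :
    bounded A (homologyComplex K) := by
  obtain ⟨⟨m, hm⟩, ⟨n, hn⟩⟩ := hK
  refine ⟨⟨m, ?_⟩, ⟨n, ?_⟩⟩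
  · rw [CochainComplex.isStrictlyGE_iff]
    exact fun i hi ↦ K.isZero_of_isGE m i hi
  · rw [CochainComplex.isStrictlyLE_iff]
    exact fun i hi ↦ K.isZero_of_isLE n i hi

omit [∀ M : A, Projective M] in
lemma id_eq_sum_single (K : Cb A) (hd : ∀ i j, K.obj.d i j = 0) :
    ∃ (s : Finset ℤ) (p : ∀ i, K ⟶ (singleb A i).obj (K.obj.X i))
      (q : ∀ i, (singleb A i).obj (K.obj.X i) ⟶ K), 𝟙 K = ∑ i ∈ s, p i ≫ q i := by
  obtain ⟨K, ⟨m, hm⟩, ⟨n, hn⟩⟩ := K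
  let p (i : ℤ) : K ⟶ (HomologicalComplex.single A (.up ℤ) i).obj (K.X i) :=
    HomologicalComplex.mkHomToSingle (𝟙 _) (fun j _ ↦ by rw [Category.comp_id]; exact hd _ _)
  let q (i : ℤ) : (HomologicalComplex.single A (.up ℤ) i).obj (K.X i) ⟶ K :=
    HomologicalComplex.mkHomFromSingle (𝟙 _) (fun j _ ↦ by rw [Category.id_comp]; exact hd _ _)
  have hpq (i : ℤ) : (p i ≫ q i).f i = 𝟙 _ := by simp [p, q]
  have hpq' (i j : ℤ) (hij : i ≠ j) : (p i ≫ q i).f j = 0 := by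
    rw [HomologicalComplex.comp_f, (HomologicalComplex.isZero_single_obj_X (.up ℤ) i
      (K.X i) j hij.symm).eq_of_tgt ((p i).f j) 0, zero_comp]
  refine ⟨Finset.Icc m n, fun i ↦ ObjectProperty.homMk (p i), fun i ↦ ObjectProperty.homMk (q i), ?_⟩
  apply (bounded A).ι.map_injective
  rw [Functor.map_sum]
  apply HomologicalComplex.hom_ext
  intro j
  refine Eq.trans ?_ ((HomologicalComplex.eval A (.up ℤ) j).map_sum
    (fun i ↦ p i ≫ q i) (Finset.Icc m n)).symm
  by_cases hj : j ∈ Finset.Icc m n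
  · rw [Finset.sum_eq_single j]
    · exact (hpq j).symm
    · exact fun i _ hij ↦ hpq' i j hij
    · exact fun h ↦ (h hj).elim
  · refine IsZero.eq_of_src ?_ _ _
    rw [Finset.mem_Icc] at hj
    by_cases h : j < m
    · exact K.isZero_of_isStrictlyGE m j h
    · exact K.isZero_of_isStrictlyLE n j (by lia)

end ZeroDifferential

end QuiverPoints

namespace QuiverPoints

open MonoidalCategory

section UnitComplex

variable {B : Type*} [Category* B] [Abelian B] [MonoidalCategory B] [MonoidalPreadditive B]
  [HasColimitsOfSize.{0, 0} B]
  [∀ X : B, PreservesColimitsOfSize.{0, 0} ((curriedTensor B).obj X)]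
  [∀ X : B, PreservesColimitsOfSize.{0, 0} ((curriedTensor B).flip.obj X)]
  (P : ObjectProperty B) [P.ContainsZero] [P.IsClosedUnderKernels]
  [P.IsClosedUnderCokernels] [P.IsClosedUnderFiniteProducts] [P.IsMonoidal]

/-- The unit of the tensor product of bounded complexes is concentrated in degree zero. -/
def singleUnitIso : (singleb P.FullSubcategory 0).obj (𝟙_ P.FullSubcategory) ≅
    𝟙_ (Cb P.FullSubcategory) :=
  (equivBoundedIn P).functor.preimageIso
    (((boundedIn P).isoMk ((HomologicalComplex.singleMapHomologicalComplex P.ι (.up ℤ) 0).app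
        (𝟙_ P.FullSubcategory)) :
      (equivBoundedIn P).functor.obj ((singleb P.FullSubcategory 0).obj (𝟙_ P.FullSubcategory)) ≅
        𝟙_ (boundedIn P).FullSubcategory) ≪≫ Functor.Monoidal.εIso (equivBoundedIn P).functor)

/-- The unit of the bounded derived category is concentrated in degree zero. -/
def QsingleUnitIso [ExactTensor B] :
    (Q P.FullSubcategory).obj ((singleb P.FullSubcategory 0).obj (𝟙_ P.FullSubcategory)) ≅
      𝟙_ (Db P.FullSubcategory) :=
  (Q P.FullSubcategory).mapIso (singleUnitIso P) ≪≫
    (Functor.Monoidal.εIso (Q P.FullSubcategory)).symm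

omit [MonoidalCategory B] [MonoidalPreadditive B] [P.IsMonoidal] [HasColimitsOfSize.{0, 0} B]
  [∀ X : B, PreservesColimitsOfSize.{0, 0} ((curriedTensor B).obj X)]
  [∀ X : B, PreservesColimitsOfSize.{0, 0} ((curriedTensor B).flip.obj X)] in
lemma preservesHomology_ι : P.ι.PreservesHomology where
  preservesKernels _ _ f := P.preservesKernels_ι f
  preservesCokernels _ _ f := P.preservesCokernels_ι f

end UnitComplex

namespace IsGradedLine

lemma of_iso (k : Type*) [Field k] {S : Type*} [Category* S] [Preadditive S] [HasShift S ℤ]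
    [∀ n : ℤ, (shiftFunctor S n).Additive] [Linear k S] {U U' : S} (hU : IsGradedLine k U)
    (e : U ≅ U') : IsGradedLine k U' where
  hom_eq_zero {n m} h f := by
    have := hU.hom_eq_zero h (e.hom⟦n⟧' ≫ f ≫ e.inv⟦m⟧')
    rw [← cancel_epi (e.hom⟦n⟧'), ← cancel_mono (e.inv⟦m⟧'), Category.assoc, this]
    simp
  hom_eq_smul {n} f := by
    obtain ⟨c, hc⟩ := hU.hom_eq_smul (e.hom⟦n⟧' ≫ f ≫ e.inv⟦n⟧')
    refine ⟨c, ?_⟩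
    rw [← cancel_epi (e.hom⟦n⟧'), ← cancel_mono (e.inv⟦n⟧'), Category.assoc, hc]
    simp [← Functor.map_comp]
  id_mem_span M := by
    refine Submodule.span_mono ?_ (hU.id_mem_span M)
    rintro _ ⟨n, q, p, rfl⟩
    exact ⟨n, q ≫ e.hom⟦n⟧', e.inv⟦n⟧' ≫ p, by simp [← Functor.map_comp_assoc]⟩

end IsGradedLine

section Vect

variable (k : Type u) [Field k]

/-- The category of finite dimensional vector spaces. -/
abbrev Vect := (fdim k).FullSubcategory

instance (M : Vect k) : Projective M where
  factors {E X} f e _ := by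
    have := preservesHomology_ι (fdim k)
    have : Epi e.hom := inferInstanceAs (Epi ((fdim k).ι.map e))
    have : Projective M.obj := ModuleCat.projective_of_categoryTheory_projective _
    exact ⟨ObjectProperty.homMk (Projective.factorThru f.hom e.hom), by
      ext1; exact Projective.factorThru_comp _ _⟩

variable {k}

lemma Vect.id_mem_span (M : Vect k) : 𝟙 M ∈ Submodule.span k
    {f : M ⟶ M | ∃ (q : M ⟶ 𝟙_ (Vect k)) (p : 𝟙_ (Vect k) ⟶ M), f = q ≫ p} := by
  have : Module.Finite k M.obj := M.property
  let b := Module.finBasis k M.obj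
  let q (i : Fin (Module.finrank k M.obj)) : M ⟶ 𝟙_ (Vect k) :=
    ObjectProperty.homMk (ModuleCat.ofHom (b.coord i))
  let p (i : Fin (Module.finrank k M.obj)) : 𝟙_ (Vect k) ⟶ M :=
    ObjectProperty.homMk (ModuleCat.ofHom (LinearMap.toSpanSingleton k M.obj (b i)))
  have : 𝟙 M = ∑ i, q i ≫ p i := by
    apply (fdim k).ι.map_injective
    rw [Functor.map_sum]
    ext x
    rw [ModuleCat.hom_sum, LinearMap.sum_apply]
    exact (b.sum_repr x).symm
  rw [this]
  exact Submodule.sum_mem _ (fun i _ ↦ Submodule.subset_span ⟨_, _, rfl⟩)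

lemma Vect.exists_eq_smul_id (f : 𝟙_ (Vect k) ⟶ 𝟙_ (Vect k)) : ∃ c : k, f = c • 𝟙 _ := by
  refine ⟨f.hom.hom (1 : k), ?_⟩
  ext1
  ext
  exact (mul_one _).symm

lemma Vect.id_unit_ne_zero : 𝟙 (𝟙_ (Vect k)) ≠ 0 := fun h ↦
  one_ne_zero (α := k) (LinearMap.congr_fun
    (congr_arg ModuleCat.Hom.hom ((fdim k).ι.congr_map h)) (1 : k))

lemma isGradedLine_single :
    IsGradedLine k ((Q (Vect k)).obj ((singleb (Vect k) 0).obj (𝟙_ (Vect k)))) := by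
  let e (n : ℤ) := shiftSingleIso (𝟙_ (Vect k)) n (-n) 0 (by simp)
  refine ⟨fun {n m} h f ↦ ?_, fun {n} f ↦ ?_, fun M ↦ ?_⟩
  · obtain ⟨g, hg⟩ := (Q (Vect k)).map_surjective ((e n).inv ≫ f ≫ (e m).hom)
    have : g = 0 := by
      ext1
      apply HomologicalComplex.from_single_hom_ext
      exact (HomologicalComplex.isZero_single_obj_X (.up ℤ) (-m) _ (-n) (by simpa using h)).eq_of_tgt
        _ _
    rw [this, Functor.map_zero] at hg
    rw [← cancel_epi (e n).inv, ← cancel_mono (e m).hom, Category.assoc, ← hg]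
    simp
  · obtain ⟨g, hg⟩ := (Q (Vect k)).map_surjective ((e n).inv ≫ f ≫ (e n).hom)
    obtain ⟨g, rfl⟩ := (singleb (Vect k) (-n)).map_surjective g
    obtain ⟨c, rfl⟩ := Vect.exists_eq_smul_id g
    refine ⟨c, ?_⟩
    rw [← cancel_epi (e n).inv, ← cancel_mono (e n).hom, Category.assoc, ← hg]
    simp
  · obtain ⟨K, ⟨i⟩⟩ : ∃ K : Cb (Vect k), Nonempty ((Q (Vect k)).obj K ≅ M) :=
      ⟨_, ⟨(Q (Vect k)).objObjPreimageIso M⟩⟩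
    let H : Cb (Vect k) := ⟨homologyComplex K.obj, bounded_homologyComplex _ K.property⟩
    let s : H ⟶ K := ObjectProperty.homMk (fromHomologyComplex K.obj)
    have : IsIso ((Q (Vect k)).map s) := Localization.inverts (Q (Vect k)) (quasiIsoCb (Vect k)) s
      ((HomologicalComplex.mem_quasiIso_iff _).2
        (inferInstanceAs (QuasiIso (fromHomologyComplex K.obj))))
    let j : (Q (Vect k)).obj H ≅ M := asIso ((Q (Vect k)).map s) ≪≫ i
    suffices h : 𝟙 H ∈ Submodule.span k {f : H ⟶ H | ∃ (n : ℤ)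
        (q : H ⟶ (singleb (Vect k) n).obj (𝟙_ (Vect k)))
        (p : (singleb (Vect k) n).obj (𝟙_ (Vect k)) ⟶ H), f = q ≫ p} by
      let φ : (H ⟶ H) →ₗ[k] (M ⟶ M) :=
        { toFun f := j.inv ≫ (Q (Vect k)).map f ≫ j.hom
          map_add' := by simp
          map_smul' := by simp }
      have hφ : φ (𝟙 H) = 𝟙 M := by simp [φ]
      rw [← hφ]
      refine Submodule.mem_map_of_mem (f := φ) h |> fun h' ↦ ?_
      rw [Submodule.map_span] at h'
      refine Submodule.span_mono ?_ h'
      rintro _ ⟨_, ⟨n, q, p, rfl⟩, rfl⟩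
      obtain ⟨m, rfl⟩ : ∃ m, n = -m := ⟨-n, by simp⟩
      exact ⟨m, j.inv ≫ (Q (Vect k)).map q ≫ (e m).inv, (e m).hom ≫ (Q (Vect k)).map p ≫ j.hom, by
        simp [φ]⟩
    obtain ⟨t, p, q, h⟩ := id_eq_sum_single H (fun _ _ ↦ rfl)
    rw [h]
    refine Submodule.sum_mem _ (fun i _ ↦ ?_)
    let ψ : (H.obj.X i ⟶ H.obj.X i) →ₗ[k] (H ⟶ H) :=
      { toFun f := p i ≫ (singleb (Vect k) i).map f ≫ q i
        map_add' := by simp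
        map_smul' := by simp }
    have hψ : ψ (𝟙 _) = p i ≫ q i := by simp [ψ]
    rw [← hψ]
    have h' := Submodule.mem_map_of_mem (f := ψ) (Vect.id_mem_span (H.obj.X i))
    rw [Submodule.map_span] at h'
    refine Submodule.span_mono ?_ h'
    rintro _ ⟨_, ⟨q', p', rfl⟩, rfl⟩
    exact ⟨i, p i ≫ (singleb (Vect k) i).map q', (singleb (Vect k) i).map p' ≫ q i, by simp [ψ]⟩

lemma isGradedLine_unit : IsGradedLine k (𝟙_ (DbVect k)) :=
  isGradedLine_single.of_iso k (QsingleUnitIso (fdim k))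

lemma id_unit_DbVect_ne_zero : 𝟙 (𝟙_ (DbVect k)) ≠ 0 := by
  intro h
  have h₁ : (Q (Vect k)).map ((singleb (Vect k) 0).map (𝟙 (𝟙_ (Vect k)))) = 0 := by
    rw [CategoryTheory.Functor.map_id, CategoryTheory.Functor.map_id, ← Iso.hom_inv_id (QsingleUnitIso (fdim k)),
      ← Category.id_comp (QsingleUnitIso (fdim k)).inv, h, zero_comp, comp_zero]
  have h₂ := Q_map_eq_zero _ h₁ (fun _ _ ↦ rfl) (fun _ _ ↦ rfl)
  exact Vect.id_unit_ne_zero ((singleb (Vect k) 0).map_injective (h₂.trans (Functor.map_zero _ _ _).symm))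

end Vect

end QuiverPoints

namespace QuiverPoints

open MonoidalCategory

section InverseMonoidal

variable {B : Type*} [Category* B] [Abelian B] [MonoidalCategory B] [MonoidalPreadditive B]
  [HasColimitsOfSize.{0, 0} B]
  [∀ X : B, PreservesColimitsOfSize.{0, 0} ((curriedTensor B).obj X)]
  [∀ X : B, PreservesColimitsOfSize.{0, 0} ((curriedTensor B).flip.obj X)]
  (P : ObjectProperty B) [P.ContainsZero] [P.IsClosedUnderKernels]
  [P.IsClosedUnderCokernels] [P.IsClosedUnderFiniteProducts] [P.IsMonoidal]

instance : (equivBoundedIn P).inverse.Monoidal :=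
  inferInstanceAs (Monoidal.equivalenceTransported (equivBoundedIn P).symm).functor.Monoidal

end InverseMonoidal

lemma isZero_of_isZero_Q {A : Type*} [Category* A] [Abelian A] [∀ M : A, Projective M] {K L : Cb A}
    (hK : IsZero ((Q A).obj K)) (hL : IsZero L) (f : K ⟶ L) : quasiIsoCb A f := by
  rw [← trW_quotientb_iff]
  have h₁ : IsZero ((quotientb A).obj K) := by
    rw [IsZero.iff_id_eq_zero]
    exact (Qh A).map_injective (hK.eq_of_src _ _)
  have h₂ : IsZero ((quotientb A).obj L) := (quotientb A).map_isZero hL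
  have : IsIso ((quotientb A).map f) := ⟨0, h₁.eq_of_src _ _, h₂.eq_of_src _ _⟩
  exact ObjectProperty.trW_of_isIso _ _

instance {A B : Type*} [Category* A] [Abelian A] [Category* B] [Abelian B] (G : A ⥤ B)
    [G.Additive] : (mapCb G).Additive where
  map_add {_ _ f g} := by
    ext1
    exact (G.mapHomologicalComplex (.up ℤ)).map_add (f := f.hom) (g := g.hom)

namespace BoundQuiver

variable {k : Type u} [Field k] (X : BoundQuiver.{u, v, w} k)

instance (a : X.V) : (X.eval a).Linear k where

lemma quasiIsoCb_iff_eval {K L : Cb X.Rep} (f : K ⟶ L) :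
    quasiIsoCb X.Rep f ↔ ∀ a : X.V, quasiIsoCb (Vect k) ((mapCb (X.eval a)).map f) := by
  simp only [equivBoundedIn_quasiIso, HomologicalComplex.mem_quasiIso_iff]
  exact HomologicalComplex.quasiIso_iff_evaluation _

instance (a : X.V) : PreservesQis (X.eval a) where
  map f hf := (X.quasiIsoCb_iff_eval f).1 hf a

/-- The functor `K ↦ K_a` on bounded complexes of finite dimensional representations. -/
def evalBoundedIn (a : X.V) :
    (boundedIn (repProp X.rel)).FullSubcategory ⥤ (boundedIn (fdim k)).FullSubcategory :=
  (boundedIn (fdim k)).lift ((boundedIn (repProp X.rel)).ι ⋙ evc ((Paths.of X.V).obj a))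
    (fun K ↦ ⟨bounded_evc _ _ _ _ K.property.1, fun i ↦ (K.property.2 i).1 a⟩)

instance (a : X.V) : (X.evalBoundedIn a).Monoidal :=
  (liftCoreMonoidal (boundedIn (repProp X.rel)) (boundedIn (fdim k))
    (evc ((Paths.of X.V).obj a)) _).toMonoidal

/-- The two descriptions of the functor `K ↦ K_a` on bounded complexes agree. -/
def mapCbEvalIso (a : X.V) : (equivBoundedIn (repProp X.rel)).functor ⋙ X.evalBoundedIn a ⋙
    (equivBoundedIn (fdim k)).inverse ≅ mapCb (X.eval a) :=
  NatIso.ofComponents (fun K ↦ Iso.refl _) (fun f ↦ by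
    refine (Category.comp_id _).trans (Eq.trans ?_ (Category.id_comp _).symm)
    rfl)

instance (a : X.V) : (mapCb (X.eval a)).Monoidal :=
  letI : (X.evalBoundedIn a ⋙ (equivBoundedIn (fdim k)).inverse).Monoidal :=
    Functor.Monoidal.instComp (X.evalBoundedIn a) (equivBoundedIn (fdim k)).inverse
  Functor.Monoidal.transport (X.mapCbEvalIso a)

instance (a : X.V) : Localization.Lifting (Q X.Rep) (quasiIsoCb X.Rep)
    (mapCb (X.eval a) ⋙ Q (Vect k)) (mapDb (X.eval a)) :=
  ⟨mapDbFac (X.eval a)⟩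

instance (a : X.V) : (mapDb (X.eval a)).Monoidal :=
  Localization.Monoidal.functorMonoidalOfComp (Q X.Rep) (quasiIsoCb X.Rep) (mapDb (X.eval a))
    (mapCb (X.eval a) ⋙ Q (Vect k))

/-- The evaluation at a vertex, as a point of the tensor triangulated category. -/
def evalTT (a : X.V) : TTFunctor k X.D (DbVect k) where
  functor := mapDb (X.eval a)

lemma isZero_of_eval {M : X.D} (h : ∀ a, IsZero ((mapDb (X.eval a)).obj M)) : IsZero M := by
  have := Localization.essSurj (Q X.Rep) (quasiIsoCb X.Rep)
  let K := (Q X.Rep).objPreimage M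
  let e : (Q X.Rep).obj K ≅ M := (Q X.Rep).objObjPreimageIso M
  obtain ⟨Z, hZ⟩ : ∃ Z : Cb X.Rep, IsZero Z :=
    ⟨_, (singleb X.Rep 0).map_isZero HasZeroObject.zero.choose_spec⟩
  let f : K ⟶ Z := 0
  have hf : quasiIsoCb X.Rep f := (X.quasiIsoCb_iff_eval f).2 (fun a ↦
    isZero_of_isZero_Q ((h a).of_iso
      (((mapDbFac (X.eval a)).app K).symm ≪≫ (mapDb (X.eval a)).mapIso e))
        ((mapCb (X.eval a)).map_isZero hZ) _)
  have := Localization.inverts (Q X.Rep) (quasiIsoCb X.Rep) f hf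
  exact ((Q X.Rep).map_isZero hZ).of_iso (e.symm ≪≫ asIso ((Q X.Rep).map f))

lemma isIso_of_eval {M N : X.D} (f : M ⟶ N) (h : ∀ a, IsIso ((mapDb (X.eval a)).map f)) :
    IsIso f := by
  obtain ⟨Z, g, δ, mem⟩ := Pretriangulated.distinguished_cocone_triangle f
  have hZ : IsZero Z := X.isZero_of_eval (fun a ↦
    (Pretriangulated.Triangle.isZero₃_iff_isIso₁ _
      ((mapDb (X.eval a)).map_distinguished _ mem)).2 (h a))
  exact (Pretriangulated.Triangle.isZero₃_iff_isIso₁ _ mem).1 hZ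

end BoundQuiver

end QuiverPoints

namespace QuiverPoints

namespace HomAlg

section

variable {ι C : Type*} [Category* C] [Preadditive C] {X : ι → C}

@[ext]
lemma ext {f g : HomAlg X} (h : ∀ i j, f i j = g i j) : f = g :=
  funext fun i ↦ funext fun j ↦ h i j

@[simp]
lemma add_apply (f g : HomAlg X) (i j : ι) : (f + g) i j = f i j + g i j := rfl

@[simp]
lemma zero_apply (i j : ι) : (0 : HomAlg X) i j = 0 := rfl

@[simp]
lemma smul_apply {k : Type*} [CommRing k] [Linear k C] (c : k) (f : HomAlg X) (i j : ι) :
    (c • f) i j = c • f i j := rfl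

open Classical in
/-- The element of the algebra given by a morphism between two of the objects. -/
def of {i j : ι} (x : X i ⟶ X j) : HomAlg X := fun a b ↦
  if h : i = a ∧ b = j then eqToHom (by rw [h.1]) ≫ x ≫ eqToHom (by rw [h.2]) else 0

@[simp]
lemma of_apply_self {i j : ι} (x : X i ⟶ X j) : of x i j = x := by simp [of]

lemma of_apply_of_ne_left {i j : ι} (x : X i ⟶ X j) {a b : ι} (h : i ≠ a) : of x a b = 0 :=
  dif_neg (by simp [h])

lemma of_apply_of_ne_right {i j : ι} (x : X i ⟶ X j) {a b : ι} (h : b ≠ j) : of x a b = 0 :=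
  dif_neg (by simp [h])

variable (k : Type*) [CommRing k] [Linear k C]

/-- The inclusion of the space of morphisms between two of the objects. -/
def ofₗ (i j : ι) : (X i ⟶ X j) →ₗ[k] HomAlg X where
  toFun := of
  map_add' x y := by
    ext a b
    by_cases h : i = a
    · by_cases h' : b = j
      · subst h h'; simp
      · simp [of_apply_of_ne_right _ h']
    · simp [of_apply_of_ne_left _ h]
  map_smul' c x := by
    ext a b
    by_cases h : i = a
    · by_cases h' : b = j
      · subst h h'; simp
      · simp [of_apply_of_ne_right _ h']
    · simp [of_apply_of_ne_left _ h]

@[simp]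
lemma ofₗ_apply {i j : ι} (x : X i ⟶ X j) : ofₗ k i j x = of x := rfl

end

variable {ι C : Type*} [Category* C] [Preadditive C] {X : ι → C} [Fintype ι]

lemma mul_apply (f g : HomAlg X) (i j : ι) : (f * g) i j = ∑ l, f i l ≫ g l j := by
  change (letI := Fintype.ofFinite ι; ∑ l, f i l ≫ g l j) = _
  congr!

lemma one_apply_self (i : ι) : (1 : HomAlg X) i i = 𝟙 _ := dif_pos rfl

lemma one_apply_of_ne {i j : ι} (h : i ≠ j) : (1 : HomAlg X) i j = 0 := dif_neg h

lemma sum_apply {α : Type*} (s : Finset α) (f : α → HomAlg X) (i j : ι) :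
    (∑ a ∈ s, f a) i j = ∑ a ∈ s, f a i j := by
  induction s using Finset.cons_induction with
  | empty => rfl
  | cons a s ha h => rw [Finset.sum_cons, Finset.sum_cons, add_apply, h]

lemma of_mul_apply {i j : ι} (x : X i ⟶ X j) (f : HomAlg X) (l : ι) :
    (of x * f) i l = x ≫ f j l := by
  rw [mul_apply, Finset.sum_eq_single j, of_apply_self]
  · intro b _ hb
    rw [of_apply_of_ne_right _ hb, zero_comp]
  · simp

lemma of_mul_apply_of_ne {i j : ι} (x : X i ⟶ X j) (f : HomAlg X) {a : ι} (l : ι) (h : i ≠ a) :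
    (of x * f) a l = 0 := by
  rw [mul_apply]
  exact Finset.sum_eq_zero (fun b _ ↦ by rw [of_apply_of_ne_left _ h, zero_comp])

lemma mul_of_apply {i j : ι} (x : X i ⟶ X j) (f : HomAlg X) (l : ι) :
    (f * of x) l j = f l i ≫ x := by
  rw [mul_apply, Finset.sum_eq_single i, of_apply_self]
  · intro b _ hb
    rw [of_apply_of_ne_left _ hb.symm, comp_zero]
  · simp

lemma mul_of_apply_of_ne {i j : ι} (x : X i ⟶ X j) (f : HomAlg X) (l : ι) {b : ι} (h : b ≠ j) :
    (f * of x) l b = 0 := by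
  rw [mul_apply]
  exact Finset.sum_eq_zero (fun b _ ↦ by rw [of_apply_of_ne_right _ h, comp_zero])

lemma of_mul_of {i j l : ι} (x : X i ⟶ X j) (y : X j ⟶ X l) : of x * of y = of (x ≫ y) := by
  ext a b
  by_cases h : i = a
  · subst h
    rw [of_mul_apply]
    by_cases h' : b = l
    · subst h'; simp
    · simp [of_apply_of_ne_right _ h']
  · rw [of_mul_apply_of_ne _ _ _ h, of_apply_of_ne_left _ h]

lemma of_id_mul_mul_of_id (f : HomAlg X) (i j : ι) :
    of (𝟙 (X i)) * f * of (𝟙 (X j)) = of (f i j) := by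
  ext a b
  by_cases h : i = a
  · subst h
    by_cases h' : b = j
    · subst h'
      rw [mul_of_apply, of_mul_apply]
      simp
    · rw [mul_of_apply_of_ne _ _ _ h', of_apply_of_ne_right _ h']
  · rw [mul_assoc, of_mul_apply_of_ne _ _ _ h, of_apply_of_ne_left _ h]

lemma sum_of (f : HomAlg X) : ∑ i, ∑ j, of (f i j) = f := by
  ext a b
  rw [sum_apply, Finset.sum_eq_single a, sum_apply, Finset.sum_eq_single b, of_apply_self]
  · intro j _ hj
    exact of_apply_of_ne_right _ hj.symm
  · simp
  · intro i _ hi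
    rw [sum_apply]
    exact Finset.sum_eq_zero (fun j _ ↦ of_apply_of_ne_left _ hi)
  · simp

section Map

variable (k : Type*) [CommRing k] [Linear k C] {ι' D : Type*} [Category* D] [Preadditive D]
  [Linear k D] {Y : ι' → D} [Fintype ι'] (e : ι ≃ ι')

/-- The homomorphism of algebras given by compatible linear maps between the spaces of
morphisms. -/
def map (φ : ∀ i j, (X i ⟶ X j) →ₗ[k] (Y (e i) ⟶ Y (e j))) (h₁ : ∀ i, φ i i (𝟙 _) = 𝟙 _)
    (h₂ : ∀ {i j l} (x : X i ⟶ X j) (y : X j ⟶ X l), φ i l (x ≫ y) = φ i j x ≫ φ j l y) :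
    HomAlg X →ₐ[k] HomAlg Y :=
  let Φ (f : HomAlg X) : HomAlg Y := fun a b ↦
    eqToHom (by simp) ≫ φ (e.symm a) (e.symm b) (f (e.symm a) (e.symm b)) ≫ eqToHom (by simp)
  have hΦ (f : HomAlg X) (i j : ι) : Φ f (e i) (e j) = φ i j (f i j) := by
    have (i' j' : ι) (hi : i' = i) (hj : j' = j) : eqToHom (by rw [hi]) ≫ φ i' j' (f i' j') ≫
        eqToHom (by rw [hj]) = φ i j (f i j) := by
      subst hi hj
      simp
    exact this _ _ (by simp) (by simp)
  have hext {f g : HomAlg Y} (h : ∀ i j, f (e i) (e j) = g (e i) (e j)) : f = g := by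
    ext a b
    obtain ⟨i, rfl⟩ := e.surjective a
    obtain ⟨j, rfl⟩ := e.surjective b
    exact h i j
  AlgHom.ofLinearMap
    { toFun := Φ
      map_add' f g := hext fun i j ↦ by rw [hΦ, add_apply, add_apply, hΦ, hΦ, map_add]
      map_smul' c f := hext fun i j ↦ by
        rw [hΦ, smul_apply, RingHom.id_apply, smul_apply, hΦ, map_smul] }
    (hext fun i j ↦ by
      refine (hΦ _ i j).trans ?_
      by_cases h : i = j
      · subst h
        rw [one_apply_self, one_apply_self, h₁]
      · rw [one_apply_of_ne h, one_apply_of_ne (e.injective.ne h), map_zero])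
    (fun f g ↦ hext fun i j ↦ by
      refine (hΦ _ i j).trans ?_
      rw [mul_apply, mul_apply, map_sum, ← e.sum_comp]
      refine Finset.sum_congr rfl (fun l _ ↦ ?_)
      rw [h₂]
      exact congr_arg₂ (· ≫ ·) (hΦ f i l).symm (hΦ g l j).symm)

variable (φ : ∀ i j, (X i ⟶ X j) →ₗ[k] (Y (e i) ⟶ Y (e j))) (h₁ : ∀ i, φ i i (𝟙 _) = 𝟙 _)
    (h₂ : ∀ {i j l} (x : X i ⟶ X j) (y : X j ⟶ X l), φ i l (x ≫ y) = φ i j x ≫ φ j l y)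

lemma map_apply (f : HomAlg X) (i j : ι) : map k e φ h₁ h₂ f (e i) (e j) = φ i j (f i j) := by
  have (i' j' : ι) (hi : i' = i) (hj : j' = j) : eqToHom (by rw [hi]) ≫ φ i' j' (f i' j') ≫
      eqToHom (by rw [hj]) = φ i j (f i j) := by
    subst hi hj
    simp
  exact this _ _ (by simp) (by simp)

lemma map_bijective (h : ∀ i j, Function.Bijective (φ i j)) :
    Function.Bijective (map k e φ h₁ h₂) := by
  refine ⟨fun f g hfg ↦ ?_, fun g ↦ ?_⟩
  · ext i j
    apply (h i j).1
    rw [← map_apply k e φ h₁ h₂, ← map_apply k e φ h₁ h₂, hfg]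
  · choose f hf using fun i j ↦ (h i j).2 (g (e i) (e j))
    refine ⟨f, ?_⟩
    ext a b
    obtain ⟨i, rfl⟩ := e.surjective a
    obtain ⟨j, rfl⟩ := e.surjective b
    exact (map_apply k e φ h₁ h₂ f i j).trans (hf i j)

end Map

end HomAlg

end QuiverPoints

namespace QuiverPoints

open MonoidalCategory

section Act

variable {k : Type u} [Field k] {V : Type w} [Quiver.{v} V]

/-- A path, as an element of the path algebra. -/
def ofPath {a b : V} (p : (Paths.of V).obj a ⟶ (Paths.of V).obj b) :
    vertexObj k V a ⟶ vertexObj k V b := (Free.embedding k (Paths V)).map p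

lemma ofPath_id (a : V) : ofPath (k := k) (𝟙 ((Paths.of V).obj a)) = 𝟙 _ := rfl

lemma ofPath_comp {a b c : V} (p : (Paths.of V).obj a ⟶ (Paths.of V).obj b)
    (q : (Paths.of V).obj b ⟶ (Paths.of V).obj c) :
    ofPath (k := k) (p ≫ q) = ofPath p ≫ ofPath q :=
  (Free.embedding k (Paths V)).map_comp p q

lemma eq_sum_ofPath {a b : V} (x : vertexObj k V a ⟶ vertexObj k V b) :
    x = (coeffs x).sum (fun p r ↦ r • ofPath p) := by
  refine (Finsupp.sum_single (coeffs x)).symm.trans (Finsupp.sum_congr (fun p _ ↦ ?_))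
  refine Eq.trans ?_ (Finsupp.smul_single (coeffs x p) p (1 : k)).symm
  rw [smul_eq_mul, mul_one]

lemma hom_induction {a b : V} {motive : (vertexObj k V a ⟶ vertexObj k V b) → Prop}
    (x : vertexObj k V a ⟶ vertexObj k V b) (zero : motive 0)
    (add : ∀ x y, motive x → motive y → motive (x + y))
    (path : ∀ (c : k) (p : (Paths.of V).obj a ⟶ (Paths.of V).obj b), motive (c • ofPath p)) :
    motive x := by
  rw [eq_sum_ofPath x]
  exact Finset.sum_induction _ motive add zero (fun p _ ↦ path _ p)

namespace BigRep

variable (W : BigRep k V)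

/-- The action of linear combinations of paths on a representation, as a linear map. -/
def actₗ (a b : V) : (vertexObj k V a ⟶ vertexObj k V b) →ₗ[k] (W.space a ⟶ W.space b) :=
  Finsupp.lift (W.space a ⟶ W.space b) k ((Paths.of V).obj a ⟶ (Paths.of V).obj b)
    (fun p ↦ W.map p)

@[simp]
lemma actₗ_apply {a b : V} (x : vertexObj k V a ⟶ vertexObj k V b) : W.actₗ a b x = W.act x := rfl

lemma act_add {a b : V} (x y : vertexObj k V a ⟶ vertexObj k V b) :
    W.act (x + y) = W.act x + W.act y :=
  (W.actₗ a b).map_add x y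

lemma act_zero (a b : V) : W.act (0 : vertexObj k V a ⟶ vertexObj k V b) = 0 :=
  (W.actₗ a b).map_zero

lemma act_smul {a b : V} (c : k) (x : vertexObj k V a ⟶ vertexObj k V b) :
    W.act (c • x) = c • W.act x :=
  (W.actₗ a b).map_smul c x

lemma act_ofPath {a b : V} (p : (Paths.of V).obj a ⟶ (Paths.of V).obj b) :
    W.act (ofPath p) = W.map p :=
  (Finsupp.sum_single_index (a := p) (b := (1 : k)) (h := fun p r ↦ r • W.map p)
    (zero_smul _ _)).trans (one_smul _ _)

lemma act_id (a : V) : W.act (𝟙 (vertexObj k V a)) = 𝟙 _ :=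
  (W.act_ofPath (𝟙 _)).trans (W.map_id _)

lemma act_comp {a b c : V} (x : vertexObj k V a ⟶ vertexObj k V b)
    (y : vertexObj k V b ⟶ vertexObj k V c) : W.act (x ≫ y) = W.act x ≫ W.act y := by
  induction x using hom_induction with
  | zero => rw [zero_comp, act_zero, act_zero, zero_comp]
  | add x x' h h' => rw [Preadditive.add_comp, act_add, act_add, Preadditive.add_comp, h, h']
  | path r p =>
    induction y using hom_induction with
    | zero => rw [comp_zero, act_zero, act_zero, comp_zero]
    | add x x' h h' => rw [Preadditive.comp_add, act_add, act_add, Preadditive.comp_add, h, h']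
    | path r' q =>
      rw [Linear.smul_comp, Linear.comp_smul, ← ofPath_comp]
      simp only [act_smul, act_ofPath, Functor.map_comp, Linear.smul_comp, Linear.comp_smul]
      rw [smul_comm]

end BigRep

end Act

namespace BoundQuiver

variable {k : Type u} [Field k] (X : BoundQuiver.{u, v, w} k)

instance : Fintype X.V := Fintype.ofFinite _

/-- The path relation between distinct vertices. -/
def lt (a b : X.V) : Prop := a ≠ b ∧ Nonempty (Quiver.Path a b)

lemma eq_of_path {a b : X.V} (p : Quiver.Path a b) (q : Quiver.Path b a) : a = b := by
  have := congr_arg Quiver.Path.length (X.acyclic a (p.comp q))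
  rw [Quiver.Path.length_comp] at this
  exact Quiver.Path.eq_of_length_zero p (by simp at this; exact this.1)

instance : IsTrans X.V X.lt where
  trans a b c := by
    rintro ⟨h, ⟨p⟩⟩ ⟨h', ⟨q⟩⟩
    refine ⟨?_, ⟨p.comp q⟩⟩
    rintro rfl
    exact h (X.eq_of_path p q)

instance : Std.Irrefl X.lt where
  irrefl _ h := h.1 rfl

lemma wellFounded_lt : WellFounded X.lt := Finite.wellFounded_of_trans_of_irrefl _

instance finite_path (a b : X.V) : Finite (Quiver.Path a b) := by
  induction b using X.wellFounded_lt.induction with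
  | _ b ih =>
    have hc (c : X.V) (e : c ⟶ b) : Finite (Quiver.Path a c) := by
      refine ih c ⟨?_, ⟨e.toPath⟩⟩
      rintro rfl
      exact Nat.zero_ne_one (congr_arg Quiver.Path.length (X.acyclic c e.toPath)).symm
    have (c : X.V) : Finite (c ⟶ b) := X.finite_arrows c b
    have (c : X.V) : Finite (Σ (_ : c ⟶ b), Quiver.Path a c) := by
      by_cases h : Nonempty (c ⟶ b)
      · have := hc c h.some
        infer_instance
      · rw [not_nonempty_iff] at h
        infer_instance
    let φ : Quiver.Path a b → Option (Σ (c : X.V) (_ : c ⟶ b), Quiver.Path a c) := fun p ↦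
      match p with
      | .nil => none
      | .cons p e => some ⟨_, e, p⟩
    refine Finite.of_injective φ (fun p q h ↦ ?_)
    cases p with
    | nil =>
      rw [X.acyclic a q]
    | cons p e =>
      cases q with
      | nil => simp [φ] at h
      | cons q e' =>
        have h' : (⟨_, e, p⟩ : Σ (c : X.V) (_ : c ⟶ b), Quiver.Path a c) = ⟨_, e', q⟩ :=
          Option.some.inj h
        cases h'
        rfl

instance (a b : X.V) : Module.Finite k (vertexObj k X.V a ⟶ vertexObj k X.V b) :=
  have : Finite ((Paths.of X.V).obj a ⟶ (Paths.of X.V).obj b) := X.finite_path a b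
  inferInstanceAs (Module.Finite k (((Paths.of X.V).obj a ⟶ (Paths.of X.V).obj b) →₀ k))

/-- The class of a linear combination of paths. -/
def projOf (a b : X.V) : (vertexObj k X.V a ⟶ vertexObj k X.V b) →ₗ[k] X.BoundPathAlg :=
  X.proj.toLinearMap ∘ₗ HomAlg.ofₗ k a b

lemma projOf_apply {a b : X.V} (x : vertexObj k X.V a ⟶ vertexObj k X.V b) :
    X.projOf a b x = X.proj (HomAlg.of x) := rfl

lemma proj_eq_zero_of_mem {r : PathAlg k X.V} (hr : r ∈ X.rel) : X.proj r = 0 := by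
  refine (RingCon.eq _).2 ?_
  exact (TwoSidedIdeal.mem_iff _ _).1 (TwoSidedIdeal.subset_span hr)

lemma proj_surjective : Function.Surjective X.proj := RingCon.mk'_surjective _

lemma proj_eq_zero_iff (x : PathAlg k X.V) : X.proj x = 0 ↔ x ∈ TwoSidedIdeal.span X.rel :=
  (RingCon.eq _).trans (TwoSidedIdeal.mem_iff _ _).symm

lemma proj_eq_sum (x : PathAlg k X.V) : X.proj x = ∑ a, ∑ b, X.projOf a b (x a b) := by
  conv_lhs => rw [← HomAlg.sum_of x]
  simp only [map_sum, projOf_apply]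

lemma act_eq_zero_of_proj_eq_zero (W : X.Rep) {x : PathAlg k X.V} (hx : X.proj x = 0) (a b : X.V) :
    W.obj.act (x a b) = 0 := by
  rw [proj_eq_zero_iff] at hx
  induction hx using TwoSidedIdeal.span_induction generalizing a b with
  | mem r hr => exact W.property.2 r hr a b
  | zero => exact W.obj.act_zero a b
  | add x y _ _ hx hy => rw [HomAlg.add_apply, BigRep.act_add, hx, hy, add_zero]
  | neg x _ hx => exact ((W.obj.actₗ a b).map_neg (x a b)).trans (neg_eq_zero.2 (hx a b))
  | left_absorb x y _ hy =>
    rw [HomAlg.mul_apply, ← BigRep.actₗ_apply, map_sum]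
    exact Finset.sum_eq_zero (fun c _ ↦ by rw [BigRep.actₗ_apply, BigRep.act_comp, hy, comp_zero])
  | right_absorb x y _ hy =>
    rw [HomAlg.mul_apply, ← BigRep.actₗ_apply, map_sum]
    exact Finset.sum_eq_zero (fun c _ ↦ by rw [BigRep.actₗ_apply, BigRep.act_comp, hy, zero_comp])

end BoundQuiver

end QuiverPoints

namespace QuiverPoints

open MonoidalCategory

lemma BigRep.act_comp_functor {k : Type u} [Field k] {V : Type w} [Quiver.{v} V] (W : BigRep k V)
    (G : ModuleCat.{u} k ⥤ ModuleCat.{u} k) [G.Additive] [G.Linear k] {a b : V}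
    (x : vertexObj k V a ⟶ vertexObj k V b) : BigRep.act (W ⋙ G) x = G.map (W.act x) := by
  induction x using hom_induction with
  | zero => rw [act_zero, act_zero, G.map_zero]
  | add x y h h' => rw [act_add, act_add, G.map_add, h, h']
  | path c p => rw [act_smul, act_smul, G.map_smul, act_ofPath, act_ofPath]; rfl

namespace BoundQuiver

variable {k : Type u} [Field k] (X : BoundQuiver.{u, v, w} k)

/-! ### The representations given by the right ideals generated by the trivial paths -/

/-- The classes of linear combinations of paths from `a` to `b`. -/
abbrev pathSpace (a b : X.V) : Submodule k X.BoundPathAlg := (X.projOf a b).range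

/-- The coordinates of the class of a linear combination of paths. -/
def pathClass (a b : X.V) : (vertexObj k X.V a ⟶ vertexObj k X.V b) →ₗ[k]
    (Fin (Module.finrank k (X.pathSpace a b)) → k) :=
  (Module.finBasis k (X.pathSpace a b)).equivFun.toLinearMap ∘ₗ (X.projOf a b).rangeRestrict

lemma pathClass_surjective (a b : X.V) : Function.Surjective (X.pathClass a b) :=
  (Module.finBasis k (X.pathSpace a b)).equivFun.surjective.comp
    (X.projOf a b).surjective_rangeRestrict

lemma pathClass_eq_zero_iff {a b : X.V} (x : vertexObj k X.V a ⟶ vertexObj k X.V b) :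
    X.pathClass a b x = 0 ↔ X.projOf a b x = 0 := by
  refine ((Module.finBasis k (X.pathSpace a b)).equivFun.map_eq_zero_iff).trans ?_
  exact Subtype.ext_iff

/-- A section of `pathClass`. -/
def pathLift (a b : X.V) : (Fin (Module.finrank k (X.pathSpace a b)) → k) →ₗ[k]
    (vertexObj k X.V a ⟶ vertexObj k X.V b) :=
  ((X.pathClass a b).exists_rightInverse_of_surjective
    (LinearMap.range_eq_top.2 (X.pathClass_surjective a b))).choose

lemma pathClass_pathLift {a b : X.V} (y : Fin (Module.finrank k (X.pathSpace a b)) → k) :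
    X.pathClass a b (X.pathLift a b y) = y :=
  LinearMap.congr_fun ((X.pathClass a b).exists_rightInverse_of_surjective
    (LinearMap.range_eq_top.2 (X.pathClass_surjective a b))).choose_spec y

lemma projOf_comp {a b c : X.V} (x : vertexObj k X.V a ⟶ vertexObj k X.V b)
    (y : vertexObj k X.V b ⟶ vertexObj k X.V c) :
    X.projOf a c (x ≫ y) = X.projOf a b x * X.projOf b c y := by
  simp only [projOf_apply, ← map_mul, HomAlg.of_mul_of]

lemma pathClass_comp_eq_of_eq {a b c : X.V} {x x' : vertexObj k X.V a ⟶ vertexObj k X.V b}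
    (h : X.pathClass a b x = X.pathClass a b x') (y : vertexObj k X.V b ⟶ vertexObj k X.V c) :
    X.pathClass a c (x ≫ y) = X.pathClass a c (x' ≫ y) := by
  rw [← sub_eq_zero, ← map_sub, pathClass_eq_zero_iff] at h ⊢
  rw [← Preadditive.sub_comp, projOf_comp, h, zero_mul]

/-- The representation given by the right ideal generated by a trivial path. -/
def projBigRep (a : X.V) : BigRep k X.V where
  obj b := ModuleCat.of k (Fin (Module.finrank k (X.pathSpace a b)) → k)
  map {b c} p := ModuleCat.ofHom (X.pathClass a c ∘ₗ Linear.rightComp k (vertexObj k X.V a)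
    (ofPath (V := X.V) (a := b) (b := c) p) ∘ₗ X.pathLift a b)
  map_id b := by
    ext1
    refine LinearMap.ext (fun y ↦ ?_)
    obtain ⟨x, rfl⟩ := X.pathClass_surjective a b y
    refine (X.pathClass_comp_eq_of_eq (X.pathClass_pathLift _) _).trans ?_
    rw [show ofPath (V := X.V) (a := b) (b := b) (k := k) (𝟙 b) = 𝟙 _ from rfl, Category.comp_id]
    rfl
  map_comp {b c d} p q := by
    ext1
    refine LinearMap.ext (fun y ↦ ?_)
    obtain ⟨x, rfl⟩ := X.pathClass_surjective a b y
    have h₁ := X.pathClass_comp_eq_of_eq (X.pathClass_pathLift (X.pathClass a b x))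
      (ofPath (V := X.V) (a := b) (b := c) p)
    refine Eq.trans ?_ (X.pathClass_comp_eq_of_eq (X.pathClass_pathLift _)
      (ofPath (V := X.V) (a := c) (b := d) q)).symm
    refine Eq.trans ?_ (X.pathClass_comp_eq_of_eq h₁ (ofPath (V := X.V) (a := c) (b := d) q)).symm
    refine (X.pathClass_comp_eq_of_eq (X.pathClass_pathLift _) _).trans ?_
    refine congr_arg (X.pathClass a d) (Eq.trans ?_ (Category.assoc _ _ _).symm)
    exact congr_arg (x ≫ ·) (ofPath_comp (V := X.V) (a := b) (b := c) (c := d) p q)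

lemma projBigRep_act (a : X.V) {b c : X.V} (y : vertexObj k X.V b ⟶ vertexObj k X.V c)
    (x : vertexObj k X.V a ⟶ vertexObj k X.V b) :
    ((X.projBigRep a).act y).hom (X.pathClass a b x) = X.pathClass a c (x ≫ y) := by
  induction y using hom_induction with
  | zero => rw [BigRep.act_zero, comp_zero, map_zero]; rfl
  | add y y' h h' =>
    rw [BigRep.act_add, Preadditive.comp_add, map_add, ← h, ← h']
    rfl
  | path r p =>
    rw [BigRep.act_smul, BigRep.act_ofPath, Linear.comp_smul, map_smul]
    exact congr_arg (r • ·) (X.pathClass_comp_eq_of_eq (X.pathClass_pathLift _) _)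

/-- The representation given by the right ideal generated by a trivial path. -/
def projRep (a : X.V) : X.Rep := ⟨X.projBigRep a,
  fun b ↦ inferInstanceAs (Module.Finite k (Fin (Module.finrank k (X.pathSpace a b)) → k)),
  fun r hr b c ↦ by
    ext1
    refine LinearMap.ext (fun y ↦ ?_)
    obtain ⟨x, rfl⟩ := X.pathClass_surjective a b y
    refine (X.projBigRep_act a (r b c) x).trans ?_
    refine (X.pathClass_eq_zero_iff _).2 ?_
    rw [projOf_comp, X.projOf_apply (r b c), ← HomAlg.of_id_mul_mul_of_id, map_mul, map_mul,
      X.proj_eq_zero_of_mem hr, mul_zero, zero_mul, mul_zero]⟩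

section

variable (W : X.Rep) (a b : X.V)

/-- The action of classes of linear combinations of paths on a representation. -/
def classAct : (Fin (Module.finrank k (X.pathSpace a b)) → k) →ₗ[k]
    (W.obj.space a →ₗ[k] W.obj.space b) :=
  (ModuleCat.homLinearEquiv (S := k)).toLinearMap ∘ₗ W.obj.actₗ a b ∘ₗ X.pathLift a b

variable {a b}

lemma act_eq_of_pathClass_eq {x y : vertexObj k X.V a ⟶ vertexObj k X.V b}
    (h : X.pathClass a b x = X.pathClass a b y) : W.obj.act x = W.obj.act y := by
  rw [← sub_eq_zero, ← map_sub, pathClass_eq_zero_iff, projOf_apply] at h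
  have := X.act_eq_zero_of_proj_eq_zero W h a b
  rwa [HomAlg.of_apply_self, ← BigRep.actₗ_apply, map_sub, sub_eq_zero] at this

lemma classAct_pathClass (x : vertexObj k X.V a ⟶ vertexObj k X.V b) :
    X.classAct W a b (X.pathClass a b x) = (W.obj.act x).hom :=
  congr_arg ModuleCat.Hom.hom (X.act_eq_of_pathClass_eq W (X.pathClass_pathLift _))

lemma classAct_act {c : X.V} (z : Fin (Module.finrank k (X.pathSpace a b)) → k)
    (y : vertexObj k X.V b ⟶ vertexObj k X.V c) :
    X.classAct W a c (((X.projBigRep a).act y).hom z) =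
      (W.obj.act y).hom ∘ₗ X.classAct W a b z := by
  obtain ⟨x, rfl⟩ := X.pathClass_surjective a b z
  rw [projBigRep_act, classAct_pathClass, classAct_pathClass, BigRep.act_comp, ModuleCat.hom_comp]

lemma classAct_map {c : X.V} (z : Fin (Module.finrank k (X.pathSpace a b)) → k)
    (p : (Paths.of X.V).obj b ⟶ (Paths.of X.V).obj c) (t : W.obj.space a) :
    X.classAct W a c (((X.projBigRep a).map p).hom z) t =
      (W.obj.map p).hom (X.classAct W a b z t) := by
  have := LinearMap.congr_fun (X.classAct_act W z (ofPath p)) t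
  rw [BigRep.act_ofPath, BigRep.act_ofPath] at this
  exact this

end

/-- The morphism to a representation given by a vector. -/
def projDesc {a : X.V} (W : X.Rep) (t : W.obj.space a) : X.projRep a ⟶ W :=
  ObjectProperty.homMk
    { app b := ModuleCat.ofHom ((X.classAct W a b).flip t)
      naturality b c p := by
        ext1
        exact LinearMap.ext (fun z ↦ X.classAct_map W (a := a) (b := b) (c := c) z p t) }

lemma projDesc_pathClass {a : X.V} (W : X.Rep) (t : W.obj.space a) {b : X.V}
    (x : vertexObj k X.V a ⟶ vertexObj k X.V b) :
    ((X.projDesc W t).hom.app ((Paths.of X.V).obj b)).hom (X.pathClass a b x) =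
      (W.obj.act x).hom t :=
  LinearMap.congr_fun (X.classAct_pathClass W x) t

variable {X} in
lemma evalNat_naturality {a b : X.V} (t : X.eval a ⟶ X.eval b) {W W' : X.Rep} (φ : W ⟶ W')
    (s : W.obj.space a) : (t.app W').hom.hom ((φ.hom.app ((Paths.of X.V).obj a)).hom s) =
      (φ.hom.app ((Paths.of X.V).obj b)).hom ((t.app W).hom.hom s) :=
  LinearMap.congr_fun (congr_arg ModuleCat.Hom.hom ((fdim k).ι.congr_map (t.naturality φ))) s

lemma exists_eq_evalMap {a b : X.V} (t : X.eval a ⟶ X.eval b) :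
    ∃ x : vertexObj k X.V a ⟶ vertexObj k X.V b, t = evalMap x := by
  let i : (X.projRep a).obj.space a := X.pathClass a a (𝟙 _)
  obtain ⟨x, hx⟩ := X.pathClass_surjective a b ((t.app (X.projRep a)).hom.hom i)
  have key (W : X.Rep) (s : W.obj.space a) :
      (t.app W).hom.hom s = (W.obj.act x).hom s := by
    have h₂ := evalNat_naturality t (X.projDesc W s) i
    have h₃ : ((X.projDesc W s).hom.app ((Paths.of X.V).obj a)).hom i = s := by
      refine (X.projDesc_pathClass W s (𝟙 (vertexObj k X.V a))).trans ?_
      rw [BigRep.act_id]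
      rfl
    rw [h₃] at h₂
    rw [h₂, ← X.projDesc_pathClass W s x]
    exact congr_arg _ hx.symm
  refine ⟨x, NatTrans.ext (funext (fun W ↦ ?_))⟩
  apply (fdim k).ι.map_injective
  exact ModuleCat.hom_ext (LinearMap.ext (key W))

/-! ### The left adjoint of the evaluation at a vertex -/

/-- The functor that sends a vector space `E` to the sum of `dim E` copies of the representation
given by the right ideal generated by a trivial path. -/
def copower (a : X.V) : Vect k ⥤ X.Rep :=
  (repProp X.rel).lift ((fdim k).ι ⋙ tensoringLeft (ModuleCat k) ⋙
    (Functor.whiskeringLeft _ _ _).obj (X.projBigRep a)) (fun E ↦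
      ⟨fun b ↦ have h : fdim k ((X.projBigRep a).space b) := (X.projRep a).property.1 b
        have h' : fdim k (E.obj ⊗ (X.projBigRep a).space b) := (fdim k).prop_tensor E.property h
        h', fun r hr b c ↦ by
        refine (BigRep.act_comp_functor (X.projBigRep a)
          ((tensoringLeft (ModuleCat k)).obj E.obj) (r b c)).trans ?_
        exact (congr_arg ((tensoringLeft (ModuleCat k)).obj E.obj).map
          ((X.projRep a).property.2 r hr b c)).trans (Functor.map_zero _ _ _)⟩)

instance (a : X.V) : (X.copower a).Additive where
  map_add {E E' f g} := by
    ext1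
    ext1
    ext1 b
    exact MonoidalPreadditive.add_whiskerRight f.hom g.hom

instance (a : X.V) : (X.copower a).Linear k where
  map_smul {E E'} f c := by
    ext1
    ext1
    ext1 b
    exact MonoidalLinear.smul_whiskerRight c f.hom _

/-- The counit of the adjunction between `copower` and the evaluation at a vertex. -/
def copowerCounit (a : X.V) : X.eval a ⋙ X.copower a ⟶ 𝟭 X.Rep where
  app W := ObjectProperty.homMk
    { app b := ModuleCat.ofHom (TensorProduct.lift (X.classAct W a b).flip)
      naturality b c p := by
        exact ModuleCat.MonoidalCategory.tensor_ext
          (fun t z ↦ X.classAct_map W (a := a) (b := b) (c := c) z p t) }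
  naturality W W' φ := by
    ext1
    ext1
    ext1 b
    refine ModuleCat.MonoidalCategory.tensor_ext (fun t z ↦ ?_)
    obtain ⟨x, rfl⟩ := X.pathClass_surjective a b z
    have h₁ := LinearMap.congr_fun (X.classAct_pathClass W x) t
    have h₂ := LinearMap.congr_fun (X.classAct_pathClass W' x) ((φ.hom.app _).hom t)
    have h₃ := LinearMap.congr_fun (congr_arg ModuleCat.Hom.hom (BigRep.act_naturality φ.hom x)) t
    exact h₂.trans (h₃.symm.trans (congr_arg (φ.hom.app _).hom h₁).symm)

lemma exists_eq_smul_id {a : X.V} (x : vertexObj k X.V a ⟶ vertexObj k X.V a) :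
    ∃ c : k, x = c • 𝟙 _ := by
  induction x using hom_induction with
  | zero => exact ⟨0, (zero_smul _ _).symm⟩
  | add x y h h' =>
    obtain ⟨c, rfl⟩ := h
    obtain ⟨c', rfl⟩ := h'
    exact ⟨c + c', (add_smul _ _ _).symm⟩
  | path c p => exact ⟨c, by rw [← ofPath_id, show p = 𝟙 _ from X.acyclic a p]⟩

instance (a : X.V) (W : X.Rep) : IsIso ((X.eval a).map ((X.copowerCounit a).app W)) := by
  have h (t : W.obj.space a) (c : k) :
      (((X.copowerCounit a).app W).hom.app ((Paths.of X.V).obj a)).hom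
        (TensorProduct.tmul k t (X.pathClass a a (c • 𝟙 _))) = c • t := by
    refine (LinearMap.congr_fun (X.classAct_pathClass W (c • 𝟙 _)) t).trans ?_
    have e : W.obj.act (c • 𝟙 (vertexObj k X.V a)) = c • 𝟙 _ := by
      rw [BigRep.act_smul, BigRep.act_id]
    exact LinearMap.congr_fun (congr_arg ModuleCat.Hom.hom e) t
  let g₀ : W.obj.space a →ₗ[k] TensorProduct k (W.obj.space a)
      (Fin (Module.finrank k (X.pathSpace a a)) → k) :=
    (TensorProduct.mk k _ _).flip (X.pathClass a a (𝟙 _))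
  let g : W.obj.space a ⟶ ((X.copower a).obj ((X.eval a).obj W)).obj.space a :=
    ModuleCat.ofHom g₀
  refine ⟨ObjectProperty.homMk g, ?_, ?_⟩
  · ext1
    refine ModuleCat.MonoidalCategory.tensor_ext (fun t z ↦ ?_)
    obtain ⟨x, rfl⟩ := X.pathClass_surjective a a z
    obtain ⟨c, rfl⟩ := X.exists_eq_smul_id x
    refine (congr_arg g.hom (h t c)).trans ?_
    change TensorProduct.tmul k (c • t) (X.pathClass a a (𝟙 _)) =
      TensorProduct.tmul k t (X.pathClass a a (c • 𝟙 _))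
    rw [map_smul, TensorProduct.smul_tmul]
  · ext1
    ext1
    refine LinearMap.ext (fun t ↦ ?_)
    refine Eq.trans ?_ ((h t 1).trans (one_smul _ _))
    exact congr_arg (fun x ↦ (((X.copowerCounit a).app W).hom.app ((Paths.of X.V).obj a)).hom
      (TensorProduct.tmul k t (X.pathClass a a x))) (one_smul _ _).symm

end BoundQuiver

end QuiverPoints

namespace QuiverPoints

open MonoidalCategory

/-! ### Tensor products with zero objects, and subunits -/

section

variable {B : Type*} [Category* B] [Abelian B] [MonoidalCategory B] [MonoidalPreadditive B]
  [HasColimitsOfSize.{0, 0} B]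
  [∀ X : B, PreservesColimitsOfSize.{0, 0} ((curriedTensor B).obj X)]
  [∀ X : B, PreservesColimitsOfSize.{0, 0} ((curriedTensor B).flip.obj X)]
  (P : ObjectProperty B) [P.ContainsZero] [P.IsClosedUnderKernels]
  [P.IsClosedUnderCokernels] [P.IsClosedUnderFiniteProducts] [P.IsMonoidal]

lemma isZero_tensor_Cb (K L : Cb P.FullSubcategory) (h : (∀ i, IsZero (K.obj.X i)) ∨
    ∀ i, IsZero (L.obj.X i)) : IsZero (K ⊗ L) := by
  have hι {M : P.FullSubcategory} (hM : IsZero M) : IsZero M.obj := P.ι.map_isZero hM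
  have : IsZero ((equivBoundedIn P).functor.obj (K ⊗ L)) := by
    refine IsZero.of_iso ?_ (Functor.Monoidal.μIso (equivBoundedIn P).functor K L).symm
    rw [IsZero.iff_id_eq_zero]
    ext1
    refine HomologicalComplex.hom_ext _ _ (fun n ↦ (isZero_tensor_X _ _ _ (fun i j _ ↦ ?_)).eq_of_src _ _)
    exact h.imp (fun h ↦ hι (h i)) (fun h ↦ hι (h j))
  rw [IsZero.iff_id_eq_zero] at this ⊢
  exact (equivBoundedIn P).functor.map_injective (by
    rw [CategoryTheory.Functor.map_id, this]; rfl)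

variable [ExactTensor B]

lemma exists_isZero_Cb (A : Type*) [Category* A] [Abelian A] :
    ∃ Z : Cb A, IsZero Z ∧ ∀ i, IsZero (Z.obj.X i) := by
  obtain ⟨Z, hZ⟩ := HasZeroObject.zero (C := A)
  refine ⟨(singleb A 0).obj Z, (singleb A 0).map_isZero hZ, fun i ↦ ?_⟩
  exact ((bounded A).ι ⋙ HomologicalComplex.eval A (.up ℤ) i).map_isZero
    ((singleb A 0).map_isZero hZ)

lemma isZero_tensor_Db (M N : Db P.FullSubcategory) (h : IsZero M ∨ IsZero N) : IsZero (M ⊗ N) := by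
  have := Localization.essSurj (Q P.FullSubcategory) (quasiIsoCb P.FullSubcategory)
  obtain ⟨Z, hZ, hZ'⟩ := exists_isZero_Cb P.FullSubcategory
  have hQ : IsZero ((Q P.FullSubcategory).obj Z) := (Q P.FullSubcategory).map_isZero hZ
  rcases h with h | h
  · refine IsZero.of_iso ((Q P.FullSubcategory).map_isZero (isZero_tensor_Cb P Z
      ((Q P.FullSubcategory).objPreimage N) (Or.inl hZ'))) ?_
    exact (h.iso hQ ⊗ᵢ ((Q P.FullSubcategory).objObjPreimageIso N).symm) ≪≫
      Functor.Monoidal.μIso (Q P.FullSubcategory) _ _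
  · refine IsZero.of_iso ((Q P.FullSubcategory).map_isZero (isZero_tensor_Cb P
      ((Q P.FullSubcategory).objPreimage M) Z (Or.inr hZ'))) ?_
    exact (((Q P.FullSubcategory).objObjPreimageIso M).symm ⊗ᵢ h.iso hQ) ≪≫
      Functor.Monoidal.μIso (Q P.FullSubcategory) _ _

lemma whiskerLeft_eq_zero (M : Db P.FullSubcategory) {N N' : Db P.FullSubcategory} (f : N ⟶ N')
    (hf : f = 0) : M ◁ f = 0 := by
  obtain ⟨Z, hZ⟩ := HasZeroObject.zero (C := Db P.FullSubcategory)
  have : f = (0 : N ⟶ Z) ≫ (0 : Z ⟶ N') := by rw [hf, zero_comp]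
  rw [this, MonoidalCategory.whiskerLeft_comp, (isZero_tensor_Db P M Z (Or.inr hZ)).eq_of_tgt
    (M ◁ (0 : N ⟶ Z)) 0, zero_comp]

end

section

variable {k : Type u} [Field k]

lemma isZero_or_isIso_of_subunit {L : DbVect k} (ε : L ⟶ 𝟙_ (DbVect k)) (h : IsIso (L ◁ ε)) :
    IsZero L ∨ IsIso ε := by
  have hU := isGradedLine_unit (k := k)
  by_cases hε : ε = 0
  · left
    have h₀ := whiskerLeft_eq_zero (fdim k) L ε hε
    have h₁ : IsZero (L ⊗ 𝟙_ (DbVect k)) := by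
      rw [IsZero.iff_id_eq_zero, ← cancel_epi (L ◁ ε), comp_zero, Category.comp_id, h₀]
    exact h₁.of_iso (ρ_ L).symm
  · right
    obtain ⟨s, hs⟩ : ∃ s : 𝟙_ (DbVect k) ⟶ L, s ≫ ε ≠ 0 := by
      by_contra! H
      apply hε
      refine hU.hom_ext (fun n x ↦ ?_)
      rw [comp_zero]
      let z := (shiftFunctorZero (DbVect k) ℤ).app (𝟙_ (DbVect k))
      by_cases hn : n = 0
      · subst hn
        rw [← cancel_epi z.inv, comp_zero, ← Category.assoc]
        exact H _
      · rw [← cancel_mono z.inv, zero_comp]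
        exact hU.hom_eq_zero hn _
    obtain ⟨c, hc⟩ : ∃ c : k, s ≫ ε = c • 𝟙 _ := by
      let z := (shiftFunctorZero (DbVect k) ℤ).app (𝟙_ (DbVect k))
      obtain ⟨c, hc⟩ := hU.hom_eq_smul (n := 0) (z.hom ≫ (s ≫ ε) ≫ z.inv)
      refine ⟨c, ?_⟩
      rw [← cancel_epi z.hom, ← cancel_mono z.inv, Category.assoc, hc]
      simp
    have hc₀ : c ≠ 0 := by
      rintro rfl
      rw [zero_smul] at hc
      exact hs hc
    let s' := c⁻¹ • s
    have hs' : s' ≫ ε = 𝟙 _ := by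
      rw [Linear.smul_comp, hc, smul_smul, inv_mul_cancel₀ hc₀, one_smul]
    refine ⟨s', ?_, hs'⟩
    let p := 𝟙 L - ε ≫ s'
    have hp : p ≫ ε = 0 := by simp [p, hs']
    have hp' : L ◁ p = 0 := by
      rw [← cancel_mono (L ◁ ε), zero_comp, ← MonoidalCategory.whiskerLeft_comp]
      exact whiskerLeft_eq_zero (fdim k) L _ hp
    have h₁ : s' ▷ L ≫ L ◁ p ≫ ε ▷ L = 𝟙_ _ ◁ p := by
      rw [whisker_exchange, ← comp_whiskerRight_assoc, hs', id_whiskerRight, Category.id_comp]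
    rw [hp', zero_comp, comp_zero] at h₁
    have h₂ : p = 0 := by
      rw [← cancel_epi (λ_ L).hom, ← leftUnitor_naturality, ← h₁, zero_comp, comp_zero]
    exact (sub_eq_zero.1 h₂).symm

end

/-! ### Evaluation of complexes concentrated in one degree -/

/-- Functors induced on derived categories preserve the objects concentrated in one degree. -/
def mapCbSingleIso {A B : Type*} [Category* A] [Abelian A] [Category* B] [Abelian B] (G : A ⥤ B)
    [G.Additive] (n : ℤ) : singleb A n ⋙ mapCb G ≅ G ⋙ singleb B n :=
  NatIso.ofComponents
    (fun M ↦ (bounded B).isoMk ((HomologicalComplex.singleMapHomologicalComplex G (.up ℤ) n).app M))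
    (fun f ↦ by
      ext1
      exact (HomologicalComplex.singleMapHomologicalComplex G (.up ℤ) n).hom.naturality f)

/-- Functors induced on derived categories preserve the objects concentrated in one degree. -/
def mapDbSingleIso {A B : Type*} [Category* A] [Abelian A] [Category* B] [Abelian B] (G : A ⥤ B)
    [G.Additive] [PreservesQis G] (n : ℤ) :
    (singleb A n ⋙ Q A) ⋙ mapDb G ≅ G ⋙ singleb B n ⋙ Q B :=
  Functor.isoWhiskerLeft (singleb A n) (mapDbFac G) ≪≫
    Functor.isoWhiskerRight (mapCbSingleIso G n) (Q B)

lemma isIso_map_of_natIso {C D : Type*} [Category* C] [Category* D] {F G : C ⥤ D} (e : F ≅ G)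
    {X Y : C} (f : X ⟶ Y) (h : IsIso (G.map f)) : IsIso (F.map f) := by
  rw [← NatIso.naturality_2 e f]
  infer_instance

namespace BoundQuiver

variable {k : Type u} [Field k] (X : BoundQuiver.{u, v, w} k)

/-! ### The representations supported on convex sets of vertices -/

/-- A set of vertices is convex if it contains all vertices on the paths between its elements. -/
def IsConvex (C : Set X.V) : Prop := ∀ {a b c : X.V}, a ∈ C → c ∈ C → Quiver.Path a b →
  Quiver.Path b c → b ∈ C

open Classical in
/-- The map between the spaces of functions on truth values which is the identity if both are
true. -/
def truthMap (k : Type u) [Field k] (p q : Prop) : (PLift p → k) →ₗ[k] (PLift q → k) where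
  toFun f _ := if h : p then f ⟨h⟩ else 0
  map_add' f g := by funext; split_ifs <;> simp
  map_smul' c f := by funext; split_ifs <;> simp

lemma truthMap_pos {p q : Prop} (h : p) (f : PLift p → k) (h' : PLift q) :
    truthMap k p q f h' = f ⟨h⟩ := dif_pos h

lemma truthMap_neg {p q : Prop} (h : ¬ p) : truthMap k p q = 0 :=
  LinearMap.ext (fun _ ↦ funext (fun _ ↦ dif_neg h))

lemma truthMap_self (p : Prop) : truthMap k p p = LinearMap.id :=
  LinearMap.ext (fun _ ↦ funext (fun h ↦ dif_pos h.down))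

lemma truthMap_comp {p q r : Prop} (h : p → r → q) :
    truthMap k q r ∘ₗ truthMap k p q = truthMap k p r := by
  by_cases hp : p
  · refine LinearMap.ext (fun f ↦ funext (fun hr ↦ ?_))
    rw [LinearMap.comp_apply, truthMap_pos hp, truthMap_pos (h hp hr.down), truthMap_pos hp]
  · rw [truthMap_neg hp, truthMap_neg hp, LinearMap.comp_zero]

/-- The representation which is the unit representation on a convex set of vertices, and zero
elsewhere. -/
def supportBigRep (C : Set X.V) (hC : X.IsConvex C) : BigRep k X.V where
  obj a := ModuleCat.of k (PLift (a ∈ C) → k)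
  map {a b} _ := ModuleCat.ofHom (truthMap k (a ∈ C) (b ∈ C))
  map_id a := by
    ext1
    exact truthMap_self _
  map_comp {a b c} p q := by
    ext1
    exact (truthMap_comp (fun h h' ↦ hC h h' p q)).symm

lemma supportBigRep_act (C : Set X.V) (hC : X.IsConvex C) {a b : X.V}
    (x : vertexObj k X.V a ⟶ vertexObj k X.V b) :
    ((X.supportBigRep C hC).act x).hom =
      (show k from (BigRep.act (𝟙_ (BigRep k X.V)) x).hom (1 : k)) •
        truthMap k (a ∈ C) (b ∈ C) := by
  induction x using hom_induction with
  | zero =>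
    rw [BigRep.act_zero, BigRep.act_zero]
    exact (zero_smul _ _).symm
  | add x y hx hy =>
    rw [BigRep.act_add, BigRep.act_add]
    exact (congr_arg₂ (· + ·) hx hy).trans (add_smul _ _ _).symm
  | path c p =>
    rw [BigRep.act_smul, BigRep.act_smul, BigRep.act_ofPath, BigRep.act_ofPath]
    exact congr_arg (· • truthMap k (a ∈ C) (b ∈ C)) (mul_one c).symm

/-- The representation which is the unit representation on a convex set of vertices, and zero
elsewhere. -/
def supportRep (C : Set X.V) (hC : X.IsConvex C) : X.Rep := ⟨X.supportBigRep C hC,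
  fun a ↦ inferInstanceAs (Module.Finite k (PLift (a ∈ C) → k)),
  fun r hr a b ↦ by
    ext1
    rw [supportBigRep_act, X.unit_mem.2 r hr]
    exact zero_smul k _⟩

lemma isZero_eval_supportRep (C : Set X.V) (hC : X.IsConvex C) {a : X.V} (ha : a ∉ C) :
    IsZero ((X.eval a).obj (X.supportRep C hC)) := by
  rw [IsZero.iff_id_eq_zero]
  ext1
  ext1
  exact LinearMap.ext (fun f ↦ funext (fun h ↦ (ha h.down).elim))

/-- A set of vertices that contains all targets of arrows with source in the set. -/
def IsUpset (C : Set X.V) : Prop := ∀ {a b : X.V}, a ∈ C → Quiver.Path a b → b ∈ C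

variable {X} in
lemma IsUpset.isConvex {C : Set X.V} (hC : X.IsUpset C) : X.IsConvex C := fun ha _ p _ ↦ hC ha p

/-- The inclusion in the unit representation. -/
def supportι (C : Set X.V) (hC : X.IsUpset C) : X.supportRep C hC.isConvex ⟶ 𝟙_ X.Rep :=
  ObjectProperty.homMk
    { app a := ModuleCat.ofHom (Y := k)
        (LinearMap.proj (⟨trivial⟩ : PLift True) ∘ₗ truthMap k (a ∈ C) True)
      naturality a b p := by
        ext1
        exact congr_arg (LinearMap.proj (⟨trivial⟩ : PLift True) ∘ₗ ·)
          (truthMap_comp (fun h _ ↦ hC h p)) }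

lemma isIso_eval_supportι (C : Set X.V) (hC : X.IsUpset C) {a : X.V} (h : a ∈ C) :
    IsIso ((X.eval a).map (X.supportι C hC)) := by
  let g₀ : k →ₗ[k] (PLift (a ∈ C) → k) := LinearMap.pi (fun _ ↦ LinearMap.id)
  let g : (X.eval a).obj (𝟙_ X.Rep) ⟶ (X.eval a).obj (X.supportRep C hC.isConvex) :=
    ObjectProperty.homMk (ModuleCat.ofHom g₀)
  refine ⟨g, ?_, ?_⟩
  · ext1
    ext1
    exact LinearMap.ext (fun f ↦ funext (fun _ ↦ truthMap_pos h f _))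
  · ext1
    ext1
    exact LinearMap.ext (fun f ↦ truthMap_pos h (g₀ f) (⟨trivial⟩ : PLift True))

end BoundQuiver

end QuiverPoints

namespace QuiverPoints

open MonoidalCategory

namespace TTFunctor

variable {k : Type*} [CommRing k]
  {T : Type*} [Category* T] [Preadditive T] [HasZeroObject T] [HasShift T ℤ]
  [∀ n : ℤ, (shiftFunctor T n).Additive] [Pretriangulated T] [Linear k T]
  [∀ n : ℤ, (shiftFunctor T n).Linear k] [MonoidalCategory T]
  {S : Type*} [Category* S] [Preadditive S] [HasZeroObject S] [HasShift S ℤ]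
  [∀ n : ℤ, (shiftFunctor S n).Additive] [Pretriangulated S] [Linear k S]
  [∀ n : ℤ, (shiftFunctor S n).Linear k] [MonoidalCategory S]

/-- An isomorphism of functors which is compatible with the shift. -/
def isoMk {F G : TTFunctor k T S} (e : F.functor ≅ G.functor) (h : NatTrans.CommShift e.hom ℤ) :
    F ≅ G where
  hom := ⟨e.hom, h⟩
  inv := ⟨e.inv, inferInstance⟩
  hom_inv_id := Hom.ext e.hom_inv_id
  inv_hom_id := Hom.ext e.inv_hom_id

/-- The isomorphism of functors underlying an isomorphism of exact functors. -/
def natIso {F G : TTFunctor k T S} (e : F ≅ G) : F.functor ≅ G.functor where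
  hom := e.hom.natTrans
  inv := e.inv.natTrans
  hom_inv_id := congr_arg Hom.natTrans e.hom_inv_id
  inv_hom_id := congr_arg Hom.natTrans e.inv_hom_id

lemma toPoint_eq_iff (F G : TTFunctor k T S) : F.toPoint = G.toPoint ↔ Nonempty (F ≅ G) := Quotient.eq

lemma toPoint_rep (p : Points k T S) : p.rep.toPoint = p := Quotient.out_eq p

end TTFunctor

namespace BoundQuiver

variable {k : Type u} [Field k] (X : BoundQuiver.{u, v, w} k)

/-! ### Subunits of the derived category of representations -/

/-- The representation supported on a convex set of vertices, as an object of the derived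
category. -/
def supportD (C : Set X.V) (hC : X.IsConvex C) : X.D :=
  (singleb X.Rep 0 ⋙ Q X.Rep).obj (X.supportRep C hC)

/-- The morphism from the representation supported on an upset to the unit object. -/
def supportDι (C : Set X.V) (hC : X.IsUpset C) : X.supportD C hC.isConvex ⟶ 𝟙_ X.D :=
  (singleb X.Rep 0 ⋙ Q X.Rep).map (X.supportι C hC) ≫ (QsingleUnitIso (repProp X.rel)).hom

lemma isZero_eval_supportD (C : Set X.V) (hC : X.IsConvex C) {a : X.V} (ha : a ∉ C) :
    IsZero ((mapDb (X.eval a)).obj (X.supportD C hC)) :=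
  ((singleb (Vect k) 0 ⋙ Q (Vect k)).map_isZero (X.isZero_eval_supportRep C hC ha)).of_iso
    ((mapDbSingleIso (X.eval a) 0).app (X.supportRep C hC))

lemma isIso_eval_supportDι (C : Set X.V) (hC : X.IsUpset C) {a : X.V} (ha : a ∈ C) :
    IsIso ((mapDb (X.eval a)).map (X.supportDι C hC)) := by
  have := X.isIso_eval_supportι C hC ha
  have : IsIso ((mapDb (X.eval a)).map ((singleb X.Rep 0 ⋙ Q X.Rep).map (X.supportι C hC))) :=
    isIso_map_of_natIso (mapDbSingleIso (X.eval a) 0) (X.supportι C hC)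
      (inferInstanceAs (IsIso ((singleb (Vect k) 0 ⋙ Q (Vect k)).map
        ((X.eval a).map (X.supportι C hC)))))
  have h : (mapDb (X.eval a)).map (X.supportDι C hC) = (mapDb (X.eval a)).map
      ((singleb X.Rep 0 ⋙ Q X.Rep).map (X.supportι C hC)) ≫
        (mapDb (X.eval a)).map (QsingleUnitIso (repProp X.rel)).hom := Functor.map_comp _ _ _
  have h' : IsIso ((mapDb (X.eval a)).map (QsingleUnitIso (repProp X.rel)).hom) := inferInstance
  rw [h]
  exact @IsIso.comp_isIso _ _ _ _ _ _ _ this h'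

lemma isZero_eval_tensor {a : X.V} (M N : X.D)
    (h : IsZero ((mapDb (X.eval a)).obj M) ∨ IsZero ((mapDb (X.eval a)).obj N)) :
    IsZero ((mapDb (X.eval a)).obj (M ⊗ N)) :=
  (isZero_tensor_Db (fdim k) _ _ h).of_iso (Functor.Monoidal.μIso (mapDb (X.eval a)) M N).symm

lemma isIso_whiskerLeft_supportDι (C : Set X.V) (hC : X.IsUpset C) (M : X.D)
    (h : ∀ a, a ∉ C → IsZero ((mapDb (X.eval a)).obj M)) : IsIso (M ◁ X.supportDι C hC) := by
  refine X.isIso_of_eval _ (fun a ↦ ?_)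
  by_cases ha : a ∈ C
  · have := X.isIso_eval_supportDι C hC ha
    rw [Functor.Monoidal.map_whiskerLeft]
    infer_instance
  · have h₁ := X.isZero_eval_tensor M (X.supportD C hC.isConvex) (Or.inl (h a ha))
    have h₂ := X.isZero_eval_tensor M (𝟙_ X.D) (Or.inl (h a ha))
    exact ⟨0, h₁.eq_of_src _ _, h₂.eq_of_src _ _⟩

section Classification

variable {X} (F : TTFunctor k X.D (DbVect k))

lemma isZero_obj_tensor (M N : X.D) (h : IsZero (F.functor.obj M) ∨ IsZero (F.functor.obj N)) :
    IsZero (F.functor.obj (M ⊗ N)) :=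
  (isZero_tensor_Db (fdim k) _ _ h).of_iso (Functor.Monoidal.μIso F.functor M N).symm

lemma not_isZero_obj_unit : ¬ IsZero (F.functor.obj (𝟙_ X.D)) := fun h ↦
  id_unit_DbVect_ne_zero ((h.of_iso (Functor.Monoidal.εIso F.functor)).eq_of_src _ _)

lemma isZero_or_isIso_map_supportDι (C : Set X.V) (hC : X.IsUpset C) :
    IsZero (F.functor.obj (X.supportD C hC.isConvex)) ∨
      IsIso (F.functor.map (X.supportDι C hC)) := by
  let ε : F.functor.obj (X.supportD C hC.isConvex) ⟶ 𝟙_ (DbVect k) :=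
    F.functor.map (X.supportDι C hC) ≫ (Functor.Monoidal.εIso F.functor).inv
  have h₁ := X.isIso_whiskerLeft_supportDι C hC (X.supportD C hC.isConvex)
    (fun a ha ↦ X.isZero_eval_supportD C hC.isConvex ha)
  have h₂ : IsIso (F.functor.obj (X.supportD C hC.isConvex) ◁ F.functor.map (X.supportDι C hC)) := by
    have := Functor.Monoidal.map_whiskerLeft F.functor (X.supportD C hC.isConvex) (X.supportDι C hC)
    have h₃ : IsIso (Functor.OplaxMonoidal.δ F.functor _ _ ≫
        F.functor.obj (X.supportD C hC.isConvex) ◁ F.functor.map (X.supportDι C hC) ≫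
          Functor.LaxMonoidal.μ F.functor _ _) := by
      rw [← this]
      infer_instance
    have h₄ := IsIso.of_isIso_comp_left (Functor.OplaxMonoidal.δ F.functor _ _)
      (F.functor.obj (X.supportD C hC.isConvex) ◁ F.functor.map (X.supportDι C hC) ≫
          Functor.LaxMonoidal.μ F.functor _ _)
    exact IsIso.of_isIso_comp_right _ (Functor.LaxMonoidal.μ F.functor _ _)
  have h₅ : IsIso (F.functor.obj (X.supportD C hC.isConvex) ◁ ε) := by
    simp only [ε, MonoidalCategory.whiskerLeft_comp]
    infer_instance
  refine (isZero_or_isIso_of_subunit ε h₅).imp id (fun h ↦ ?_)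
  have : IsIso (F.functor.map (X.supportDι C hC) ≫ (Functor.Monoidal.εIso F.functor).inv) := h
  exact IsIso.of_isIso_comp_right _ (Functor.Monoidal.εIso F.functor).inv

/-- An upset is called large if the functor does not annihilate the corresponding object. -/
def IsLarge (C : Set X.V) : Prop :=
  ∃ hC : X.IsUpset C, IsIso (F.functor.map (X.supportDι C hC))

lemma isLarge_univ : IsLarge F Set.univ := by
  refine ⟨fun _ _ ↦ trivial, ?_⟩
  have := X.isIso_of_eval (X.supportDι Set.univ (fun _ _ ↦ trivial))
    (fun a ↦ X.isIso_eval_supportDι Set.univ _ trivial)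
  infer_instance

lemma IsLarge.nonempty {C : Set X.V} (h : IsLarge F C) : C.Nonempty := by
  obtain ⟨hC, h⟩ := h
  rw [Set.nonempty_iff_ne_empty]
  rintro rfl
  have h₁ : IsZero (X.supportD ∅ hC.isConvex) :=
    X.isZero_of_eval (fun a ↦ X.isZero_eval_supportD ∅ hC.isConvex (Set.notMem_empty a))
  exact not_isZero_obj_unit F ((F.functor.map_isZero h₁).of_iso
    (asIso (F.functor.map (X.supportDι ∅ hC))).symm)

lemma exists_isLarge_diff : ∃ (C : Set X.V) (a : X.V) (_ : X.IsUpset (C \ {a})),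
    IsLarge F C ∧ ¬ IsLarge F (C \ {a}) := by
  obtain ⟨C, hC, hmin⟩ := WellFounded.has_min (r := (· < · : Set X.V → Set X.V → Prop))
    _root_.wellFounded_lt {C | IsLarge F C} ⟨_, isLarge_univ F⟩
  obtain ⟨a, ha, hmin'⟩ := X.wellFounded_lt.has_min C hC.nonempty
  refine ⟨C, a, ?_, hC, fun h ↦ hmin _ h ⟨Set.sdiff_subset, fun h' ↦ (h' ha).2 rfl⟩⟩
  rintro b c ⟨hb, hba⟩ p
  refine ⟨hC.1 hb p, ?_⟩
  rintro rfl
  exact hmin' b hb ⟨hba, ⟨p⟩⟩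

lemma exists_isIso_map_of_isIso_eval : ∃ a : X.V, ∀ {M N : X.D} (f : M ⟶ N),
    IsIso ((mapDb (X.eval a)).map f) → IsIso (F.functor.map f) := by
  obtain ⟨C, a, hC', ⟨hC, h⟩, h'⟩ := exists_isLarge_diff F
  have h₀ : IsZero (F.functor.obj (X.supportD (C \ {a}) hC'.isConvex)) :=
    (isZero_or_isIso_map_supportDι F (C \ {a}) hC').resolve_right (fun h ↦ h' ⟨hC', h⟩)
  refine ⟨a, fun {M N} f hf ↦ ?_⟩
  obtain ⟨Z, g, δ, mem⟩ := Pretriangulated.distinguished_cocone_triangle f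
  have hZ : IsZero ((mapDb (X.eval a)).obj Z) :=
    (Pretriangulated.Triangle.isZero₃_iff_isIso₁ _ ((mapDb (X.eval a)).map_distinguished _ mem)).2 hf
  suffices IsZero (F.functor.obj Z) from
    (Pretriangulated.Triangle.isZero₃_iff_isIso₁ _ (F.functor.map_distinguished _ mem)).1 this
  let Z' := Z ⊗ X.supportD C hC.isConvex
  have hZ' (j : X.V) (hj : j ∉ C \ {a}) : IsZero ((mapDb (X.eval j)).obj Z') := by
    by_cases hja : j = a
    · subst hja
      exact X.isZero_eval_tensor _ _ (Or.inl hZ)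
    · exact X.isZero_eval_tensor _ _ (Or.inr (X.isZero_eval_supportD C hC.isConvex
        (fun h ↦ hj ⟨h, hja⟩)))
  have h₁ := X.isIso_whiskerLeft_supportDι (C \ {a}) hC' Z' hZ'
  have h₂ : IsZero (F.functor.obj Z') :=
    (isZero_obj_tensor F Z' _ (Or.inr h₀)).of_iso
      (F.functor.mapIso (asIso (Z' ◁ X.supportDι (C \ {a}) hC') ≪≫ ρ_ Z')).symm
  have h₃ : IsIso (F.functor.map (Z ◁ X.supportDι C hC)) := by
    rw [Functor.Monoidal.map_whiskerLeft]
    infer_instance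
  exact h₂.of_iso (asIso (F.functor.map (Z ◁ X.supportDι C hC)) ≪≫ F.functor.mapIso (ρ_ Z)).symm

instance (a : X.V) (K : Cb X.Rep) :
    IsIso ((mapCb (X.eval a)).map ((mapCbCounit (X.copowerCounit a)).app K)) := by
  have : IsIso ((bounded (Vect k)).ι.map
      ((mapCb (X.eval a)).map ((mapCbCounit (X.copowerCounit a)).app K))) := by
    have (i : ℤ) : IsIso (((bounded (Vect k)).ι.map
        ((mapCb (X.eval a)).map ((mapCbCounit (X.copowerCounit a)).app K))).f i) :=
      inferInstanceAs (IsIso ((X.eval a).map ((X.copowerCounit a).app (K.obj.X i))))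
    exact HomologicalComplex.Hom.isIso_of_components _
  exact isIso_of_reflects_iso _ (bounded (Vect k)).ι

instance (a : X.V) (M : X.D) :
    IsIso ((mapDb (X.eval a)).map ((mapDbCounit (X.copowerCounit a)).app M)) := by
  have := Localization.essSurj (Q X.Rep) (quasiIsoCb X.Rep)
  have h (K : Cb X.Rep) :
      IsIso ((mapDb (X.eval a)).map ((mapDbCounit (X.copowerCounit a)).app ((Q X.Rep).obj K))) := by
    have : IsIso ((mapDb (X.eval a)).map ((Q X.Rep).map
        ((mapCbCounit (X.copowerCounit a)).app K))) :=
      isIso_map_of_natIso (mapDbFac (X.eval a)) _ (inferInstanceAs (IsIso ((Q (Vect k)).map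
        ((mapCb (X.eval a)).map ((mapCbCounit (X.copowerCounit a)).app K)))))
    rw [mapDbCounit_app_Q]
    simp only [Functor.map_comp]
    infer_instance
  have e := (mapDbCounit (X.copowerCounit a)).naturality ((Q X.Rep).objObjPreimageIso M).hom
  have := h ((Q X.Rep).objPreimage M)
  have h₁ : IsIso ((mapDb (X.eval a)).map
      ((mapDb (X.eval a) ⋙ mapDb (X.copower a)).map ((Q X.Rep).objObjPreimageIso M).hom ≫
        (mapDbCounit (X.copowerCounit a)).app M)) := by
    rw [e, Functor.map_comp]
    infer_instance
  rw [Functor.map_comp] at h₁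
  exact IsIso.of_isIso_comp_left ((mapDb (X.eval a)).map ((mapDb (X.eval a) ⋙
    mapDb (X.copower a)).map ((Q X.Rep).objObjPreimageIso M).hom)) ((mapDb (X.eval a)).map ((mapDbCounit (X.copowerCounit a)).app M))

/-- Every point of the derived category is isomorphic to the evaluation at a vertex. -/
lemma exists_iso_evalTT : ∃ a : X.V, Nonempty (X.evalTT a ≅ F) := by
  obtain ⟨a, h⟩ := exists_isIso_map_of_isIso_eval F
  refine ⟨a, ⟨?_⟩⟩
  let ξ := mapDbCounit (X.copowerCounit a)
  have h₁ (M : X.D) : IsIso (F.functor.map (ξ.app M)) := h _ inferInstance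
  have (M : X.D) : IsIso ((Functor.whiskerRight ξ F.functor).app M) := h₁ M
  have : IsIso (Functor.whiskerRight ξ F.functor) := NatIso.isIso_of_isIso_app _
  let H : DbVect k ⥤ DbVect k := mapDb (X.copower a) ⋙ F.functor
  let i : 𝟙_ (DbVect k) ≅ H.obj (𝟙_ (DbVect k)) :=
    Functor.Monoidal.εIso F.functor ≪≫ (asIso (F.functor.map (ξ.app (𝟙_ X.D)))).symm ≪≫
      H.mapIso (Functor.Monoidal.εIso (mapDb (X.eval a))).symm
  let η := isGradedLine_unit.unit H i
  let τ : mapDb (X.eval a) ⟶ F.functor :=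
    (Functor.rightUnitor _).inv ≫ Functor.whiskerLeft (mapDb (X.eval a)) η ≫
      (Functor.associator _ _ _).inv ≫ Functor.whiskerRight ξ F.functor ≫
        (Functor.leftUnitor _).hom
  have h₂ : IsIso η := isGradedLine_unit.isIso_unit H i
  have h₃ : IsIso ((Functor.associator (mapDb (X.eval a)) (mapDb (X.copower a)) F.functor).inv ≫
      Functor.whiskerRight ξ F.functor ≫ (Functor.leftUnitor F.functor).hom) := inferInstance
  have h₄ : IsIso ((Functor.rightUnitor (mapDb (X.eval a))).inv ≫
      Functor.whiskerLeft (mapDb (X.eval a)) η) := inferInstance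
  have : IsIso τ := by
    have := @IsIso.comp_isIso _ _ _ _ _ _ _ h₄ h₃
    rwa [Category.assoc] at this
  have : NatTrans.CommShift τ ℤ := by dsimp only [τ, η, ξ]; infer_instance
  let e : mapDb (X.eval a) ≅ F.functor := asIso τ
  exact TTFunctor.isoMk (F := X.evalTT a) (G := F) e this

end Classification

end BoundQuiver

end QuiverPoints

namespace QuiverPoints

open MonoidalCategory

section MapNat

variable {A : Type*} [Category* A] [Abelian A] {B : Type*} [Category* B] [Abelian B]

lemma mapDbFac_app_singleIso (G : A ⥤ B) [G.Additive] [PreservesQis G] (M : A) :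
    (mapDbSingleIso G 0).hom.app M = (mapDbFac G).hom.app ((singleb A 0).obj M) ≫
      (Q B).map ((mapCbSingleIso G 0).hom.app M) := rfl

lemma mapCbSingleIso_naturality {G G' : A ⥤ B} [G.Additive] [G'.Additive] (α : G ⟶ G') (M : A) :
    (mapCbNat α).app ((singleb A 0).obj M) ≫ (mapCbSingleIso G' 0).hom.app M =
      (mapCbSingleIso G 0).hom.app M ≫ (singleb B 0).map (α.app M) := by
  ext1
  apply HomologicalComplex.to_single_hom_ext
  change α.app _ ≫ ((HomologicalComplex.singleMapHomologicalComplex G' (.up ℤ) 0).hom.app M).f 0 =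
    ((HomologicalComplex.singleMapHomologicalComplex G (.up ℤ) 0).hom.app M).f 0 ≫
      ((HomologicalComplex.single B (.up ℤ) 0).map (α.app M)).f 0
  rw [HomologicalComplex.singleMapHomologicalComplex_hom_app_self,
    HomologicalComplex.singleMapHomologicalComplex_hom_app_self,
    HomologicalComplex.single_map_f_self]
  have aux {P : A} {N N' : B} (x : P ⟶ M) (j : N ≅ G.obj M) (j' : N' ≅ G'.obj M) :
      α.app P ≫ G'.map x ≫ j'.inv = (G.map x ≫ j.inv) ≫ j.hom ≫ α.app M ≫ j'.inv := by simp
  exact aux _ _ _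

lemma mapDbSingleIso_naturality {G G' : A ⥤ B} [G.Additive] [G'.Additive] [PreservesQis G]
    [PreservesQis G'] (α : G ⟶ G') :
    Functor.whiskerLeft (singleb A 0 ⋙ Q A) (mapDbNat α) ≫ (mapDbSingleIso G' 0).hom =
      (mapDbSingleIso G 0).hom ≫ Functor.whiskerRight α (singleb B 0 ⋙ Q B) := by
  ext M
  have h₁ := congr_app (whiskerLeft_Q_mapDbNat α) ((singleb A 0).obj M)
  have h₂ := (Q B).congr_map (mapCbSingleIso_naturality α M)
  simp only [Functor.map_comp] at h₂
  simp only [NatTrans.comp_app, Functor.whiskerLeft_app, Functor.whiskerRight_app] at h₁ ⊢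
  refine (congr_arg (· ≫ (mapDbSingleIso G' 0).hom.app M) h₁).trans ?_
  rw [mapDbFac_app_singleIso, mapDbFac_app_singleIso, Category.assoc, Category.assoc, Category.assoc,
    Iso.inv_hom_id_app_assoc]
  exact congr_arg ((mapDbFac G).hom.app ((singleb A 0).obj M) ≫ ·) h₂

end MapNat

namespace BoundQuiver

variable {k : Type u} [Field k] (X : BoundQuiver.{u, v, w} k)

/-- The functor from finite dimensional vector spaces to the derived category. -/
abbrev singleVect (k : Type u) [Field k] : Vect k ⥤ DbVect k := singleb (Vect k) 0 ⋙ Q (Vect k)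

instance : (singleVect k).Faithful where
  map_injective {M N f g} h := by
    have h₁ : (Q (Vect k)).map ((singleb (Vect k) 0).map (f - g)) = 0 := by
      rw [Functor.map_sub, Functor.map_sub, sub_eq_zero]
      exact h
    have hd (M : Vect k) (i j : ℤ) : ((singleb (Vect k) 0).obj M).obj.d i j = 0 := rfl
    have h₂ := Q_map_eq_zero _ h₁ (hd _) (hd _)
    exact sub_eq_zero.1 ((singleb (Vect k) 0).map_injective (h₂.trans (Functor.map_zero _ _ _).symm))

variable {X} in
/-- A vector of a representation at a vertex, as a morphism from the unit object. -/
def elt {W : X.Rep} {a : X.V} (s : W.obj.space a) : 𝟙_ (Vect k) ⟶ (X.eval a).obj W :=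
  ObjectProperty.homMk (ModuleCat.ofHom (X := k) (LinearMap.toSpanSingleton k _ s))

section Elements

variable {X} {W : X.Rep} {a : X.V}

lemma elt_one (s : W.obj.space a) : (elt s).hom.hom (1 : k) = s := one_smul k s

lemma unit_hom_ext {M : Vect k} {f g : 𝟙_ (Vect k) ⟶ M} (h : f.hom.hom (1 : k) = g.hom.hom (1 : k)) :
    f = g := by
  ext1
  ext1
  exact LinearMap.ext_ring (R := k) h

lemma elt_injective : Function.Injective (elt (W := W) (a := a)) := by
  intro s t h
  rw [← elt_one s, h, elt_one]

lemma elt_surjective : Function.Surjective (elt (W := W) (a := a)) :=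
  fun f ↦ ⟨f.hom.hom (1 : k), unit_hom_ext (elt_one (X := X) _)⟩

lemma elt_comp {b : X.V} (s : W.obj.space a) (φ : (X.eval a).obj W ⟶ (X.eval b).obj W) :
    elt s ≫ φ = elt (W := W) (a := b) (φ.hom.hom s) :=
  unit_hom_ext ((congr_arg φ.hom.hom (elt_one s)).trans (elt_one (X := X) _).symm)

lemma elt_comp_map {W' : X.Rep} (s : W.obj.space a) (φ : W ⟶ W') :
    elt s ≫ (X.eval a).map φ = elt ((φ.hom.app ((Paths.of X.V).obj a)).hom s) :=
  unit_hom_ext ((congr_arg (φ.hom.app _).hom (elt_one s)).trans (elt_one _).symm)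

variable (W a) in
/-- The evaluation at a vertex of a representation, as an object of the derived category. -/
def evalSingleIso : (X.evalTT a).functor.obj ((singleb X.Rep 0 ⋙ Q X.Rep).obj W) ≅
    (singleVect k).obj ((X.eval a).obj W) :=
  (mapDbSingleIso (X.eval a) 0).app W

/-- A vector of a representation at a vertex, as a morphism in the derived category. -/
def eltD (s : W.obj.space a) : (singleVect k).obj (𝟙_ (Vect k)) ⟶
    (X.evalTT a).functor.obj ((singleb X.Rep 0 ⋙ Q X.Rep).obj W) :=
  (singleVect k).map (elt s) ≫ (evalSingleIso W a).inv

lemma eltD_add (s t : W.obj.space a) : eltD (s + t) = eltD s + eltD t := by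
  have : elt (s + t) = elt s + elt t :=
    unit_hom_ext ((elt_one _).trans (congr_arg₂ (· + ·) (elt_one s) (elt_one t)).symm)
  rw [eltD, this, Functor.map_add, Preadditive.add_comp]
  rfl

lemma eltD_smul (c : k) (s : W.obj.space a) : eltD (c • s) = c • eltD s := by
  have : elt (c • s) = c • elt s :=
    unit_hom_ext ((elt_one _).trans (congr_arg (c • ·) (elt_one s)).symm)
  rw [eltD, this, Functor.map_smul, Linear.smul_comp]
  rfl

lemma eltD_injective : Function.Injective (eltD (W := W) (a := a)) := by
  intro s t h
  exact elt_injective ((singleVect k).map_injective ((cancel_mono _).1 h))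

lemma eltD_surjective : Function.Surjective (eltD (W := W) (a := a)) := by
  intro f
  obtain ⟨g, hg⟩ := (singleVect k).map_surjective (f ≫ (evalSingleIso W a).hom)
  obtain ⟨s, rfl⟩ := elt_surjective g
  exact ⟨s, by rw [eltD, hg, Category.assoc, Iso.hom_inv_id, Category.comp_id]⟩

/-- The morphism of points given by a morphism of functors on representations. -/
def evalTTNat {b : X.V} (α : X.eval a ⟶ X.eval b) : X.evalTT a ⟶ X.evalTT b where
  natTrans := mapDbNat α
  commShift := inferInstanceAs (NatTrans.CommShift (mapDbNat α) ℤ)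

lemma evalTTNat_app_evalSingleIso {b : X.V} (α : X.eval a ⟶ X.eval b) :
    (evalTTNat α).natTrans.app ((singleb X.Rep 0 ⋙ Q X.Rep).obj W) ≫ (evalSingleIso W b).hom =
      (evalSingleIso W a).hom ≫ (singleVect k).map (α.app W) :=
  congr_app (mapDbSingleIso_naturality α) W

lemma eltD_comp_evalTTNat {b : X.V} (s : W.obj.space a) (α : X.eval a ⟶ X.eval b) :
    eltD s ≫ (evalTTNat α).natTrans.app ((singleb X.Rep 0 ⋙ Q X.Rep).obj W) =
      eltD (W := W) (a := b) ((α.app W).hom.hom s) := by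
  have h := evalTTNat_app_evalSingleIso (W := W) α
  refine (Category.assoc _ _ _).trans (Eq.trans ?_ (congr_arg (· ≫ (evalSingleIso W b).inv)
    (congr_arg (singleVect k).map (elt_comp s (α.app W)))))
  rw [Functor.map_comp, Category.assoc]
  refine congr_arg ((singleVect k).map (elt s) ≫ ·) ?_
  rw [Iso.inv_comp_eq, ← Category.assoc, Iso.eq_comp_inv]
  exact h

end Elements

/-- The generator of the projective representation at a vertex. -/
def gen (a : X.V) : (X.projRep a).obj.space a := X.pathClass a a (𝟙 _)

variable {X}

lemma exists_chain_map {a : X.V} {K : Cb X.Rep}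
    (g : (singleb (Vect k) 0).obj (𝟙_ (Vect k)) ⟶ (mapCb (X.eval a)).obj K) :
    ∃ h : (singleb X.Rep 0).obj (X.projRep a) ⟶ K,
      g = (singleb (Vect k) 0).map (elt (X.gen a)) ≫
        (mapCbSingleIso (X.eval a) 0).inv.app (X.projRep a) ≫ (mapCb (X.eval a)).map h := by
  let i : ((singleb (Vect k) 0).obj (𝟙_ (Vect k))).obj.X 0 ≅ 𝟙_ (Vect k) :=
    HomologicalComplex.singleObjXSelf (.up ℤ) (0 : ℤ) (𝟙_ (Vect k))
  let g₀ : ((singleb (Vect k) 0).obj (𝟙_ (Vect k))).obj.X 0 ⟶ (X.eval a).obj (K.obj.X 0) := g.hom.f 0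
  obtain ⟨s, hs⟩ := elt_surjective (W := K.obj.X 0) (a := a) (i.inv ≫ g₀)
  have hd : (X.projDesc (K.obj.X 0) s) ≫ K.obj.d 0 1 = 0 := by
    have hs' : ((K.obj.d 0 1).hom.app ((Paths.of X.V).obj a)).hom s = 0 := by
      apply elt_injective
      rw [← elt_comp_map, hs, Category.assoc]
      have : g₀ ≫ (X.eval a).map (K.obj.d 0 1) = _ := g.hom.comm 0 1
      refine (congr_arg (i.inv ≫ ·) this).trans ?_
      have h₀ : ((singleb (Vect k) 0).obj (𝟙_ (Vect k))).obj.d 0 1 = 0 := rfl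
      rw [h₀, zero_comp]
      refine (comp_zero (f := i.inv)).trans ?_
      exact (unit_hom_ext (elt_one (W := K.obj.X 1) (a := a) 0)).symm
    ext1
    ext1
    ext1 b
    ext1
    refine LinearMap.ext (fun y ↦ ?_)
    obtain ⟨y, rfl⟩ := X.pathClass_surjective _ _ y
    change ((K.obj.d 0 1).hom.app b).hom (((X.projDesc (K.obj.X 0) s).hom.app b).hom _) = 0
    refine (congr_arg _ (X.projDesc_pathClass (K.obj.X 0) s y)).trans ?_
    have := LinearMap.congr_fun (congr_arg ModuleCat.Hom.hom
      (BigRep.act_naturality (K.obj.d 0 1).hom y)) s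
    refine this.trans ?_
    change ((K.obj.X 1).obj.act y).hom (((K.obj.d 0 1).hom.app ((Paths.of X.V).obj a)).hom s) = 0
    rw [hs', map_zero]
  let h₀ : (HomologicalComplex.single X.Rep (.up ℤ) 0).obj (X.projRep a) ⟶ K.obj :=
    HomologicalComplex.mkHomFromSingle (X.projDesc (K.obj.X 0) s) (fun j hj ↦ by
      obtain rfl : (0 : ℤ) + 1 = j := hj
      exact hd)
  refine ⟨ObjectProperty.homMk h₀, ?_⟩
  ext1
  apply HomologicalComplex.from_single_hom_ext
  have h₁ : h₀.f 0 = (HomologicalComplex.singleObjXSelf (.up ℤ) (0 : ℤ) (X.projRep a)).hom ≫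
      X.projDesc (K.obj.X 0) s := HomologicalComplex.mkHomFromSingle_f _ _
  have h₂ : elt (X.gen a) ≫ (X.eval a).map (X.projDesc (K.obj.X 0) s) = i.inv ≫ g₀ := by
    rw [elt_comp_map, ← hs]
    congr 1
    refine (X.projDesc_pathClass (K.obj.X 0) s (𝟙 _)).trans ?_
    rw [BigRep.act_id]
    rfl
  refine (cancel_epi i.inv).1 (h₂.symm.trans ?_)
  change _ = i.inv ≫ ((HomologicalComplex.single (Vect k) (.up ℤ) 0).map (elt (X.gen a))).f 0 ≫
    ((HomologicalComplex.singleMapHomologicalComplex (X.eval a) (.up ℤ) 0).inv.app (X.projRep a)).f 0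
      ≫ (X.eval a).map (h₀.f 0)
  rw [h₁, HomologicalComplex.singleMapHomologicalComplex_inv_app_self,
    HomologicalComplex.single_map_f_self]
  have aux {E E' N : Vect k} {P P' M : X.Rep} (e : E' ≅ E) (x : E ⟶ (X.eval a).obj P)
      (j : N ≅ (X.eval a).obj P) (m : P' ≅ P) (y : P ⟶ M) :
      x ≫ (X.eval a).map y = e.inv ≫ (e.hom ≫ x ≫ j.inv) ≫ (j.hom ≫ (X.eval a).map m.inv) ≫
        (X.eval a).map (m.hom ≫ y) := by simp
  exact aux _ _ _ _ _

section HomExt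

variable {F : TTFunctor k X.D (DbVect k)} {a : X.V} (τ : X.evalTT a ⟶ F)
  (h : eltD (X.gen a) ≫ τ.natTrans.app ((singleb X.Rep 0 ⋙ Q X.Rep).obj (X.projRep a)) = 0)

include h in
lemma comp_app_eq_zero_of_gen (M : X.D)
    (y : (singleVect k).obj (𝟙_ (Vect k)) ⟶ (X.evalTT a).functor.obj M) :
    y ≫ τ.natTrans.app M = 0 := by
  have hess := Localization.essSurj (Q X.Rep) (quasiIsoCb X.Rep)
  let K := (Q X.Rep).objPreimage M
  let e : (Q X.Rep).obj K ≅ M := (Q X.Rep).objObjPreimageIso M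
  let j : (X.evalTT a).functor.obj ((Q X.Rep).obj K) ≅ (Q (Vect k)).obj ((mapCb (X.eval a)).obj K) :=
    (mapDbFac (X.eval a)).app K
  obtain ⟨g, hg⟩ := (Q (Vect k)).map_surjective (y ≫ (X.evalTT a).functor.map e.inv ≫ j.hom)
  obtain ⟨c, rfl⟩ := exists_chain_map g
  have h₁ : y = eltD (X.gen a) ≫ (X.evalTT a).functor.map ((Q X.Rep).map c ≫ e.hom) := by
    have h₂ : (evalSingleIso (X.projRep a) a).inv ≫ (X.evalTT a).functor.map ((Q X.Rep).map c) ≫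
        j.hom = (Q (Vect k)).map ((mapCbSingleIso (X.eval a) 0).inv.app (X.projRep a) ≫
          (mapCb (X.eval a)).map c) := by
      rw [Functor.map_comp]
      exact (Category.assoc _ _ _).trans (congr_arg (_ ≫ ·) (NatIso.naturality_1 (mapDbFac _) c))
    rw [← cancel_mono ((X.evalTT a).functor.map e.inv), ← cancel_mono j.hom, Category.assoc, ← hg,
      Functor.map_comp, ← h₂, eltD]
    simp only [Functor.map_comp, Category.assoc]
    rw [← Functor.map_comp_assoc (X.evalTT a).functor e.hom, Iso.hom_inv_id,
      CategoryTheory.Functor.map_id, Category.id_comp]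
    rfl
  rw [h₁, Category.assoc, τ.natTrans.naturality, ← Category.assoc, h, zero_comp]

include h in
lemma eq_zero_of_gen : τ = 0 := by
  apply TTFunctor.Hom.ext
  ext M
  refine isGradedLine_single.hom_ext (k := k) (fun n x ↦ ?_)
  refine Eq.trans ?_ comp_zero.symm
  apply (shiftFunctor (DbVect k) (-n)).map_injective
  let z := (shiftFunctorCompIsoId (DbVect k) n (-n) (by simp)).app
    ((singleVect k).obj (𝟙_ (Vect k)))
  have h₁ := comp_app_eq_zero_of_gen τ h (M⟦-n⟧)
    (z.inv ≫ x⟦-n⟧' ≫ ((X.evalTT a).functor.commShiftIso (-n)).inv.app M)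
  rw [NatTrans.app_shift, Category.assoc, Category.assoc, Iso.inv_hom_id_app_assoc,
    ← Functor.map_comp_assoc, ← Category.assoc] at h₁
  rw [Functor.map_zero]
  refine (cancel_epi z.inv).1 (((cancel_mono ((F.functor.commShiftIso (-n)).inv.app M)).1 ?_).trans
    comp_zero.symm)
  exact h₁.trans zero_comp.symm

end HomExt

end BoundQuiver

end QuiverPoints

namespace QuiverPoints

open MonoidalCategory

namespace BoundQuiver

variable {k : Type u} [Field k] {X : BoundQuiver.{u, v, w} k}

lemma hom_ext_gen {F : TTFunctor k X.D (DbVect k)} {a : X.V} {τ τ' : X.evalTT a ⟶ F}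
    (h : eltD (X.gen a) ≫ τ.natTrans.app ((singleb X.Rep 0 ⋙ Q X.Rep).obj (X.projRep a)) =
      eltD (X.gen a) ≫ τ'.natTrans.app ((singleb X.Rep 0 ⋙ Q X.Rep).obj (X.projRep a))) : τ = τ' := by
  rw [← sub_eq_zero]
  apply eq_zero_of_gen
  have : (τ - τ').natTrans.app ((singleb X.Rep 0 ⋙ Q X.Rep).obj (X.projRep a)) =
      τ.natTrans.app _ - τ'.natTrans.app _ := rfl
  rw [this, Preadditive.comp_sub, h, sub_self]

lemma eltD_gen_comp_evalTTNat {a b : X.V} (x : vertexObj k X.V a ⟶ vertexObj k X.V b) :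
    eltD (X.gen a) ≫ (evalTTNat (evalMap x)).natTrans.app
      ((singleb X.Rep 0 ⋙ Q X.Rep).obj (X.projRep a)) =
    eltD (W := X.projRep a) (X.pathClass a b x) := by
  rw [eltD_comp_evalTTNat]
  congr 1
  refine (X.projBigRep_act a x (𝟙 _)).trans ?_
  rw [Category.id_comp]

/-- The morphism of points given by a linear combination of paths. -/
def evalTTMap (a b : X.V) : (vertexObj k X.V a ⟶ vertexObj k X.V b) →ₗ[k] (X.evalTT a ⟶ X.evalTT b) where
  toFun x := evalTTNat (evalMap x)
  map_add' x y := by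
    apply hom_ext_gen
    have : (evalTTNat (evalMap x) + evalTTNat (evalMap y)).natTrans.app
        ((singleb X.Rep 0 ⋙ Q X.Rep).obj (X.projRep a)) = (evalTTNat (evalMap x)).natTrans.app _ +
          (evalTTNat (evalMap y)).natTrans.app _ := rfl
    rw [this, Preadditive.comp_add, eltD_gen_comp_evalTTNat, eltD_gen_comp_evalTTNat,
      eltD_gen_comp_evalTTNat, map_add]
    exact eltD_add _ _
  map_smul' c x := by
    apply hom_ext_gen
    have : (c • evalTTNat (evalMap x)).natTrans.app
        ((singleb X.Rep 0 ⋙ Q X.Rep).obj (X.projRep a)) = c • (evalTTNat (evalMap x)).natTrans.app _ :=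
      rfl
    rw [RingHom.id_apply, this, Linear.comp_smul, eltD_gen_comp_evalTTNat, eltD_gen_comp_evalTTNat,
      map_smul]
    exact eltD_smul _ _

lemma evalTTMap_apply {a b : X.V} (x : vertexObj k X.V a ⟶ vertexObj k X.V b) :
    evalTTMap a b x = evalTTNat (evalMap x) := rfl

lemma evalTTMap_id (a : X.V) : evalTTMap a a (𝟙 _) = 𝟙 (X.evalTT a) := by
  apply hom_ext_gen
  rw [evalTTMap_apply, eltD_gen_comp_evalTTNat]
  exact (Category.comp_id _).symm

lemma evalTTMap_comp {a b c : X.V} (x : vertexObj k X.V a ⟶ vertexObj k X.V b)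
    (y : vertexObj k X.V b ⟶ vertexObj k X.V c) :
    evalTTMap a c (x ≫ y) = evalTTMap a b x ≫ evalTTMap b c y := by
  apply hom_ext_gen
  have : (evalTTMap a b x ≫ evalTTMap b c y).natTrans.app
      ((singleb X.Rep 0 ⋙ Q X.Rep).obj (X.projRep a)) =
        (evalTTMap a b x).natTrans.app _ ≫ (evalTTMap b c y).natTrans.app _ := rfl
  rw [this, ← Category.assoc, evalTTMap_apply, evalTTMap_apply, evalTTMap_apply,
    eltD_gen_comp_evalTTNat, eltD_gen_comp_evalTTNat]
  refine Eq.trans ?_ (eltD_comp_evalTTNat _ _).symm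
  exact congr_arg (eltD (W := X.projRep a)) (X.projBigRep_act a y x).symm

lemma evalTTMap_surjective (a b : X.V) : Function.Surjective (evalTTMap a b) := by
  intro τ
  obtain ⟨s, hs⟩ := eltD_surjective (W := X.projRep a) (a := b)
    (eltD (X.gen a) ≫ τ.natTrans.app ((singleb X.Rep 0 ⋙ Q X.Rep).obj (X.projRep a)))
  obtain ⟨x, rfl⟩ := X.pathClass_surjective a b s
  refine ⟨x, ?_⟩
  apply hom_ext_gen
  rw [← hs, evalTTMap_apply, eltD_gen_comp_evalTTNat]

lemma evalTTMap_eq_zero_iff {a b : X.V} (x : vertexObj k X.V a ⟶ vertexObj k X.V b) :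
    evalTTMap a b x = 0 ↔ X.projOf a b x = 0 := by
  rw [← pathClass_eq_zero_iff]
  have h₀ : eltD (W := X.projRep a) (a := b) 0 = 0 := by
    have := eltD_smul (W := X.projRep a) (a := b) 0 0
    rwa [zero_smul, zero_smul] at this
  refine ⟨fun h ↦ ?_, fun h ↦ ?_⟩
  · have h₁ := eltD_gen_comp_evalTTNat x
    rw [← evalTTMap_apply, h] at h₁
    exact eltD_injective (W := X.projRep a) (a := b) (h₁.symm.trans (comp_zero.trans h₀.symm))
  · apply eq_zero_of_gen
    rw [evalTTMap_apply, eltD_gen_comp_evalTTNat, h]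
    exact h₀

lemma proj_eq_zero_iff_forall (x : PathAlg k X.V) :
    X.proj x = 0 ↔ ∀ a b, X.projOf a b (x a b) = 0 := by
  refine ⟨fun h a b ↦ ?_, fun h ↦ ?_⟩
  · rw [projOf_apply, ← HomAlg.of_id_mul_mul_of_id, map_mul, map_mul, h, mul_zero, zero_mul]
  · rw [proj_eq_sum]
    exact Finset.sum_eq_zero (fun a _ ↦ Finset.sum_eq_zero (fun b _ ↦ h a b))

section Family

variable (X) in
/-- The homomorphism from the path algebra to the algebra of the points given by evaluation. -/
def pathAlgToHomAlg : PathAlg k X.V →ₐ[k] HomAlg X.evalTT :=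
  HomAlg.map k (Equiv.refl _) evalTTMap evalTTMap_id evalTTMap_comp

lemma pathAlgToHomAlg_apply (x : PathAlg k X.V) (a b : X.V) :
    X.pathAlgToHomAlg x a b = evalTTMap a b (x a b) :=
  HomAlg.map_apply k (Equiv.refl _) evalTTMap evalTTMap_id evalTTMap_comp x a b

lemma pathAlgToHomAlg_surjective : Function.Surjective X.pathAlgToHomAlg := by
  intro y
  choose x hx using fun a b ↦ evalTTMap_surjective a b (y a b)
  exact ⟨x, HomAlg.ext (fun a b ↦ (pathAlgToHomAlg_apply _ a b).trans (hx a b))⟩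

lemma pathAlgToHomAlg_eq_zero_iff (x : PathAlg k X.V) :
    X.pathAlgToHomAlg x = 0 ↔ X.proj x = 0 := by
  simp only [proj_eq_zero_iff_forall, ← evalTTMap_eq_zero_iff, ← pathAlgToHomAlg_apply]
  exact ⟨fun h a b ↦ by rw [h]; rfl, fun h ↦ HomAlg.ext h⟩

lemma ringCon_le_ker : (TwoSidedIdeal.span X.rel).ringCon ≤ RingCon.ker X.pathAlgToHomAlg.toRingHom := by
  intro x y h
  have h₁ : X.proj (x - y) = 0 := by
    rw [map_sub, sub_eq_zero]
    exact (RingCon.eq _).2 h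
  rw [← pathAlgToHomAlg_eq_zero_iff, map_sub, sub_eq_zero] at h₁
  exact h₁

variable (X) in
/-- The algebra of a quiver with relations is the algebra of the points given by evaluation. -/
def boundPathAlgEquiv : X.BoundPathAlg ≃ₐ[k] HomAlg X.evalTT :=
  AlgEquiv.ofBijective (RingCon.liftₐ _ X.pathAlgToHomAlg ringCon_le_ker) (by
    refine ⟨?_, fun y ↦ ?_⟩
    · rw [injective_iff_map_eq_zero]
      intro x hx
      obtain ⟨x, rfl⟩ := X.proj_surjective x
      exact (pathAlgToHomAlg_eq_zero_iff x).1 hx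
    · obtain ⟨x, rfl⟩ := pathAlgToHomAlg_surjective y
      exact ⟨X.proj x, rfl⟩)

lemma boundPathAlgEquiv_proj (x : PathAlg k X.V) (a b : X.V) :
    X.boundPathAlgEquiv (X.proj x) a b = evalTTMap a b (x a b) :=
  pathAlgToHomAlg_apply x a b

variable {ι : Type*} [Fintype ι] (E : ι → TTFunctor k X.D (DbVect k)) (e : ι ≃ X.V)
  (θ : ∀ i a, e i = a → (E i ≅ X.evalTT a))

/-- The identification of the morphisms in a family of points with those between evaluations. -/
def familyHom (i j : ι) : (E i ⟶ E j) →ₗ[k] (X.evalTT (e i) ⟶ X.evalTT (e j)) :=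
  (Linear.homCongr k (θ i _ rfl) (θ j _ rfl)).toLinearMap

lemma familyHom_apply {i j : ι} (α : E i ⟶ E j) :
    familyHom E e θ i j α = (θ i _ rfl).inv ≫ α ≫ (θ j _ rfl).hom := by
  simp [familyHom, Linear.homCongr]

lemma familyHom_id (i : ι) : familyHom E e θ i i (𝟙 _) = 𝟙 _ := by
  simp [familyHom_apply]

lemma familyHom_comp {i j l : ι} (α : E i ⟶ E j) (β : E j ⟶ E l) :
    familyHom E e θ i l (α ≫ β) = familyHom E e θ i j α ≫ familyHom E e θ j l β := by
  simp [familyHom_apply]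

/-- The algebra of a family of points which is isomorphic to the family given by evaluation. -/
def homAlgEquiv : HomAlg E ≃ₐ[k] HomAlg X.evalTT :=
  AlgEquiv.ofBijective
    (HomAlg.map k e (familyHom E e θ) (familyHom_id E e θ) (familyHom_comp E e θ))
    (HomAlg.map_bijective k e (familyHom E e θ) (familyHom_id E e θ) (familyHom_comp E e θ)
      (fun i j ↦ (Linear.homCongr k (θ i _ rfl) (θ j _ rfl)).bijective))

lemma homAlgEquiv_apply (α : HomAlg E) (i j : ι) (a b : X.V) (hi : e i = a) (hj : e j = b) :
    homAlgEquiv E e θ α a b = (θ i a hi).inv ≫ α i j ≫ (θ j b hj).hom := by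
  subst hi hj
  rw [← familyHom_apply]
  exact HomAlg.map_apply k e (familyHom E e θ) (familyHom_id E e θ) (familyHom_comp E e θ) α i j

/-- The algebra of a quiver with relations is the algebra of a family of points which is isomorphic
to the family given by evaluation. -/
def familyEquiv : X.BoundPathAlg ≃ₐ[k] HomAlg E :=
  X.boundPathAlgEquiv.trans (homAlgEquiv E e θ).symm

lemma familyEquiv_proj (x : PathAlg k X.V) (i j : ι) (a b : X.V) (hi : e i = a) (hj : e j = b) :
    familyEquiv E e θ (X.proj x) i j = (θ i a hi).hom ≫ evalTTMap a b (x a b) ≫ (θ j b hj).inv := by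
  have h := homAlgEquiv_apply E e θ (familyEquiv E e θ (X.proj x)) i j a b hi hj
  rw [familyEquiv, AlgEquiv.trans_apply, AlgEquiv.apply_symm_apply, boundPathAlgEquiv_proj] at h
  rw [h]
  simp [familyEquiv]

end Family

section Points

lemma hom_eq_zero_of_isEmpty {a b : X.V} (h : IsEmpty (Quiver.Path a b))
    (x : vertexObj k X.V a ⟶ vertexObj k X.V b) : x = 0 :=
  Finsupp.ext (fun p ↦ h.elim p)

lemma hom_eq_zero_or {a b : X.V} (h : a ≠ b) (x : vertexObj k X.V a ⟶ vertexObj k X.V b)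
    (y : vertexObj k X.V b ⟶ vertexObj k X.V a) : x = 0 ∨ y = 0 := by
  by_contra! h'
  have h₁ : Nonempty (Quiver.Path a b) :=
    not_isEmpty_iff.1 (fun h ↦ h'.1 (hom_eq_zero_of_isEmpty h x))
  have h₂ : Nonempty (Quiver.Path b a) :=
    not_isEmpty_iff.1 (fun h ↦ h'.2 (hom_eq_zero_of_isEmpty h y))
  exact h (X.eq_of_path h₁.some h₂.some)

variable (X) in
lemma projOf_id_ne_zero (a : X.V) : X.projOf a a (𝟙 _) ≠ 0 := by
  intro h
  have h₁ := X.act_eq_zero_of_proj_eq_zero (𝟙_ X.Rep) h a a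
  replace h₁ : (𝟙_ X.Rep).obj.act (HomAlg.of (𝟙 (vertexObj k X.V a)) a a) = 0 := h₁
  rw [HomAlg.of_apply_self, BigRep.act_id] at h₁
  exact one_ne_zero (α := k) (LinearMap.congr_fun (congr_arg ModuleCat.Hom.hom h₁) (1 : k))

lemma eq_of_evalTT_iso {a b : X.V} (e : X.evalTT a ≅ X.evalTT b) : a = b := by
  by_contra h
  obtain ⟨x, hx⟩ := evalTTMap_surjective a b e.hom
  obtain ⟨y, hy⟩ := evalTTMap_surjective b a e.inv
  refine X.projOf_id_ne_zero a ((evalTTMap_eq_zero_iff _).1 ?_)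
  rw [evalTTMap_id, ← e.hom_inv_id, ← hx, ← hy]
  rcases hom_eq_zero_or h x y with rfl | rfl
  · rw [map_zero, zero_comp]
  · rw [map_zero, comp_zero]

variable (X) in
lemma toPoint_evalTT_bijective : Function.Bijective (fun a : X.V ↦ (X.evalTT a).toPoint) := by
  refine ⟨fun a b h ↦ ?_, fun p ↦ ?_⟩
  · obtain ⟨e⟩ := (TTFunctor.toPoint_eq_iff _ _).1 h
    exact eq_of_evalTT_iso e
  · obtain ⟨a, ⟨e⟩⟩ := exists_iso_evalTT p.rep
    refine ⟨a, ?_⟩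
    rw [← TTFunctor.toPoint_rep p]
    exact (TTFunctor.toPoint_eq_iff _ _).2 ⟨e⟩

variable (X) in
/-- The vertex which corresponds to a point. -/
def pointEquiv : X.DPoints ≃ X.V := (Equiv.ofBijective _ X.toPoint_evalTT_bijective).symm

variable (X) in
instance : Finite X.DPoints := Finite.of_equiv _ X.pointEquiv.symm

variable (X) in
instance : Fintype X.DPoints := Fintype.ofFinite _

/-- The isomorphism between a representative of a point and the evaluation at the vertex. -/
def pointIso (F : X.DPoints) (a : X.V) (h : X.pointEquiv F = a) : F.rep ≅ X.evalTT a := by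
  have : F.rep.toPoint = (X.evalTT a).toPoint := by
    rw [TTFunctor.toPoint_rep, ← h]
    exact (X.pointEquiv.symm_apply_apply F).symm
  exact ((TTFunctor.toPoint_eq_iff _ _).1 this).some

variable (X) in
/-- The isomorphism between the algebra of a quiver with relations and the algebra of the derived
category of representations. -/
def mainEquiv : X.BoundPathAlg ≃ₐ[k] TTAlg k X.D := familyEquiv _ X.pointEquiv pointIso

lemma mainEquiv_proj (x : PathAlg k X.V) (F G : X.DPoints) (a b : X.V) (hF : X.pointEquiv F = a)
    (hG : X.pointEquiv G = b) : X.mainEquiv (X.proj x) F G =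
      (pointIso F a hF).hom ≫ evalTTMap a b (x a b) ≫ (pointIso G b hG).inv :=
  familyEquiv_proj _ _ _ _ _ _ _ _ _ _

end Points

end BoundQuiver

end QuiverPoints

namespace QuiverPoints

open MonoidalCategory

lemma comp_comp_comp_assoc {C : Type*} [Category* C] {A₀ A₁ A₂ A₃ A₄ A₅ : C} (p : A₀ ⟶ A₁)
    (q : A₁ ⟶ A₂) (r : A₂ ⟶ A₃) (s : A₃ ⟶ A₄) (t : A₄ ⟶ A₅) :
    p ≫ (q ≫ r ≫ s) ≫ t = (p ≫ q) ≫ r ≫ s ≫ t := by simp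

namespace BoundQuiver

variable {k : Type u} [Field k] {X : BoundQuiver.{u, v, w} k}

/-! ### Description of the isomorphism -/

/-- The composition of a point with the localization functor. -/
def pointEvalIso (F : X.DPoints) (a : X.V) (h : X.pointEquiv F = a) :
    Q X.Rep ⋙ F.rep.functor ≅ X.evalD a :=
  Functor.isoWhiskerLeft (Q X.Rep) (TTFunctor.natIso (pointIso F a h)) ≪≫ mapDbFac (X.eval a)

lemma whiskerLeft_mainEquiv (x : PathAlg k X.V) (F G : X.DPoints) (a b : X.V)
    (hF : X.pointEquiv F = a) (hG : X.pointEquiv G = b) :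
    Functor.whiskerLeft (Q X.Rep) (X.mainEquiv (X.proj x) F G).natTrans =
      (pointEvalIso F a hF).hom ≫ evalDMap (x a b) ≫ (pointEvalIso G b hG).inv := by
  have h : (X.mainEquiv (X.proj x) F G).natTrans = (pointIso F a hF).hom.natTrans ≫
      mapDbNat (evalMap (x a b)) ≫ (pointIso G b hG).inv.natTrans :=
    congr_arg TTFunctor.Hom.natTrans (mainEquiv_proj x F G a b hF hG)
  have h' := whiskerLeft_Q_mapDbNat (evalMap (x a b))
  rw [h]
  change Functor.whiskerLeft (Q X.Rep) (pointIso F a hF).hom.natTrans ≫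
    Functor.whiskerLeft (Q X.Rep) (mapDbNat (evalMap (x a b))) ≫
      Functor.whiskerLeft (Q X.Rep) (pointIso G b hG).inv.natTrans = _
  refine (congr_arg (fun τ ↦ Functor.whiskerLeft (Q X.Rep) (pointIso F a hF).hom.natTrans ≫ τ ≫
    Functor.whiskerLeft (Q X.Rep) (pointIso G b hG).inv.natTrans) h').trans ?_
  exact comp_comp_comp_assoc _ _ _ _ _

/-! ### Natural endomorphisms of the total space -/

lemma rightAct_apply (W : X.Rep) (t : Tot W) (x : PathAlg k X.V) (b : X.V) :
    rightAct W t x b = ∑ a, (W.obj.act (x a b)).hom (t a) := rfl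

lemma rightAct_one (W : X.Rep) (t : Tot W) : rightAct W t 1 = t := by
  funext b
  rw [rightAct_apply, Finset.sum_eq_single b]
  · rw [HomAlg.one_apply_self, BigRep.act_id]
    rfl
  · intro a _ h
    rw [HomAlg.one_apply_of_ne h, BigRep.act_zero]
    rfl
  · simp

lemma rightAct_mul (W : X.Rep) (t : Tot W) (x y : PathAlg k X.V) :
    rightAct W t (x * y) = rightAct W (rightAct W t x) y := by
  funext c
  simp only [rightAct_apply, HomAlg.mul_apply, map_sum]
  rw [Finset.sum_comm]
  refine Finset.sum_congr rfl (fun a _ ↦ ?_)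
  have : W.obj.act (∑ l, x a l ≫ y l c) = ∑ l, W.obj.act (x a l) ≫ W.obj.act (y l c) := by
    simp only [← BigRep.act_comp]
    exact map_sum (W.obj.actₗ a c) _ _
  rw [this]
  simp

open Classical in
lemma rightAct_single (W : X.Rep) {a : X.V} (s : W.obj.space a) (x : PathAlg k X.V) (b : X.V) :
    rightAct W (Pi.single a s : Tot W) x b = (W.obj.act (x a b)).hom s := by
  rw [rightAct_apply, Finset.sum_eq_single a]
  · rw [Pi.single_eq_same]
  · intro c _ hc
    rw [Pi.single_eq_of_ne hc, map_zero]
  · simp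

open Classical in
lemma proj_eq_of_rightAct {x y : PathAlg k X.V}
    (h : ∀ (W : X.Rep) (t : Tot W), rightAct W t x = rightAct W t y) : X.proj x = X.proj y := by
  rw [← sub_eq_zero, ← map_sub, proj_eq_zero_iff_forall]
  intro a b
  have hsub : (x - y) a b = x a b - y a b := rfl
  rw [hsub, map_sub, sub_eq_zero]
  have h₁ := congr_fun (h (X.projRep a) (Pi.single a (X.gen a))) b
  rw [rightAct_single, rightAct_single] at h₁
  have h₂ : X.pathClass a b (𝟙 _ ≫ x a b) = X.pathClass a b (𝟙 _ ≫ y a b) :=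
    (X.projBigRep_act a (x a b) (𝟙 _)).symm.trans (h₁.trans (X.projBigRep_act a (y a b) (𝟙 _)))
  rw [Category.id_comp, Category.id_comp, ← sub_eq_zero, ← map_sub, pathClass_eq_zero_iff, map_sub,
    sub_eq_zero] at h₂
  exact h₂

open Classical in
/-- A natural endomorphism of the total space is the multiplication by an element of the path
algebra. -/
lemma exists_eq_rightAct (T : ∀ W : X.Rep, Tot W →ₗ[k] Tot W)
    (hT : ∀ {W W' : X.Rep} (φ : W ⟶ W') (t : Tot W), T W' (totMap φ t) = totMap φ (T W t)) :
    ∃ x : PathAlg k X.V, ∀ (W : X.Rep) (t : Tot W), T W t = rightAct W t x := by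
  let τ (a b : X.V) : X.eval a ⟶ X.eval b :=
    { app W := ObjectProperty.homMk (ModuleCat.ofHom
        (LinearMap.proj b ∘ₗ T W ∘ₗ LinearMap.single k (fun a ↦ W.obj.space a) a))
      naturality W W' φ := by
        ext1
        ext1
        refine LinearMap.ext (fun s ↦ ?_)
        have h₁ : (Pi.single a ((φ.hom.app ((Paths.of X.V).obj a)).hom s) : Tot W') =
            totMap φ (Pi.single a s) := by
          funext c
          by_cases h : c = a
          · subst h
            rw [Pi.single_eq_same]
            exact congr_arg _ (Pi.single_eq_same (M := fun a ↦ W.obj.space a) c s).symm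
          · rw [Pi.single_eq_of_ne h]
            exact ((congr_arg _ (Pi.single_eq_of_ne (M := fun a ↦ W.obj.space a) h s)).trans
              (map_zero _)).symm
        refine (congr_fun (congr_arg (T W') h₁) b).trans ?_
        rw [hT]
        rfl }
  choose x hx using fun a b ↦ X.exists_eq_evalMap (τ a b)
  refine ⟨x, fun W t ↦ ?_⟩
  have h₁ : t = ∑ a, Pi.single a (t a) := (Finset.univ_sum_single t).symm
  funext b
  conv_lhs => rw [h₁, map_sum, Finset.sum_apply]
  refine Finset.sum_congr rfl (fun a _ ↦ ?_)
  have h₂ : (τ a b).app W = (evalMap (x a b)).app W := by rw [hx a b]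
  exact LinearMap.congr_fun (congr_arg ModuleCat.Hom.hom ((fdim k).ι.congr_map h₂)) (t a)

lemma isConvex_singleton (a : X.V) : X.IsConvex {a} := by
  rintro _ b _ rfl rfl p q
  exact (X.eq_of_path p q).symm

/-! ### Restriction of scalars on total spaces -/

section Restriction

variable {Y : BoundQuiver.{u, v, w} k} {f : X.BoundPathAlg →ₐ[k] Y.BoundPathAlg}
  {G : Y.Rep ⥤ X.Rep} (r : RestrictionIso f G) (σ : X.V → Y.V)
  (κ : ∀ a, G ⋙ X.eval a ≅ Y.eval (σ a))

variable {σ}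

/-- The components of an identification of functors. -/
def componentEquiv (a : X.V) (W : Y.Rep) : (G.obj W).obj.space a ≃ₗ[k] W.obj.space (σ a) :=
  ((fdim k).ι.mapIso ((κ a).app W)).toLinearEquiv

include r κ in
open Classical in
lemma vertexMap_bijective : Function.Bijective σ := by
  have hcard : Nat.card X.V = Nat.card Y.V := by
    have h₁ : Module.finrank k (Tot (G.obj (𝟙_ Y.Rep))) = Nat.card X.V := by
      have (a : X.V) : Module.Finite k ((G.obj (𝟙_ Y.Rep)).obj.space a) := (G.obj _).property.1 a
      rw [Module.finrank_pi_fintype]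
      have (a : X.V) : Module.finrank k ((G.obj (𝟙_ Y.Rep)).obj.space a) = 1 :=
        (componentEquiv κ a (𝟙_ Y.Rep)).finrank_eq.trans (Module.finrank_self k)
      simp [this]
    have h₂ : Module.finrank k (Tot (𝟙_ Y.Rep)) = Nat.card Y.V := by
      have (a : Y.V) : Module.Finite k ((𝟙_ Y.Rep).obj.space a) := (𝟙_ Y.Rep).property.1 a
      rw [Module.finrank_pi_fintype]
      have (a : Y.V) : Module.finrank k ((𝟙_ Y.Rep).obj.space a) = 1 := Module.finrank_self k
      rw [Finset.sum_congr rfl (fun a _ ↦ this a)]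
      simp
    rw [← h₁, ← h₂]
    exact (r.equiv (𝟙_ Y.Rep)).finrank_eq
  refine (Nat.bijective_iff_surjective_and_card σ).2 ⟨fun b ↦ ?_, hcard⟩
  by_contra! hb
  let W := Y.supportRep {b} (isConvex_singleton b)
  have h₁ (t : Tot (G.obj W)) : t = 0 := by
    funext a
    have h₂ := (IsZero.iff_id_eq_zero _).1 ((Y.isZero_eval_supportRep {b} (isConvex_singleton b)
      (hb a)).of_iso ((κ a).app W))
    exact LinearMap.congr_fun (congr_arg ModuleCat.Hom.hom ((fdim k).ι.congr_map h₂)) (t a)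
  let s : W.obj.space b := fun _ : PLift (b ∈ ({b} : Set Y.V)) ↦ (1 : k)
  have h₃ : (Pi.single b s : Tot W) = 0 := by
    obtain ⟨t, ht⟩ := (r.equiv W).surjective (Pi.single b s)
    rw [← ht, h₁ t, map_zero]
  have h₄ : s = 0 := by
    have := congr_fun h₃ b
    rwa [Pi.single_eq_same] at this
  exact one_ne_zero (α := k) (congr_fun h₄ ⟨rfl⟩)

variable (hσ : Function.Bijective σ)

/-- The identification of total spaces given by an identification of their components. -/
def totEquiv (W : Y.Rep) : Tot (G.obj W) ≃ₗ[k] Tot W :=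
  (LinearEquiv.piCongrRight (fun a ↦ componentEquiv κ a W)).trans
    (LinearEquiv.piCongrLeft k (fun b ↦ W.obj.space b) (Equiv.ofBijective σ hσ))

lemma totEquiv_apply (W : Y.Rep) (t : Tot (G.obj W)) (a : X.V) :
    totEquiv κ hσ W t (σ a) = componentEquiv κ a W (t a) :=
  Equiv.piCongrLeft_apply_apply (fun b ↦ W.obj.space b) (Equiv.ofBijective σ hσ) _ a

lemma totEquiv_naturality {W W' : Y.Rep} (φ : W ⟶ W') (t : Tot (G.obj W)) :
    totEquiv κ hσ W' (totMap (G.map φ) t) = totMap φ (totEquiv κ hσ W t) := by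
  funext b
  obtain ⟨a, rfl⟩ := hσ.2 b
  rw [totEquiv_apply, totMap, totMap, totEquiv_apply]
  exact LinearMap.congr_fun (congr_arg ModuleCat.Hom.hom
    ((fdim k).ι.congr_map ((κ a).hom.naturality φ))) (t a)

lemma totEquiv_rightAct (W : Y.Rep) (t : Tot (G.obj W)) (x : PathAlg k X.V) (y : PathAlg k Y.V)
    (h : ∀ a b, (κ a).inv ≫ Functor.whiskerLeft G (evalMap (x a b)) ≫ (κ b).hom =
      evalMap (y (σ a) (σ b))) :
    totEquiv κ hσ W (rightAct (G.obj W) t x) = rightAct W (totEquiv κ hσ W t) y := by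
  funext b
  obtain ⟨b, rfl⟩ := hσ.2 b
  rw [totEquiv_apply, rightAct_apply, rightAct_apply]
  refine (map_sum (componentEquiv κ b W) _ _).trans ?_
  rw [← (Equiv.ofBijective σ hσ).sum_comp]
  refine Finset.sum_congr rfl (fun a _ ↦ ?_)
  have h₁ : Functor.whiskerLeft G (evalMap (x a b)) ≫ (κ b).hom =
      (κ a).hom ≫ evalMap (y (σ a) (σ b)) := by rw [← h, Iso.hom_inv_id_assoc]
  have h₂ := LinearMap.congr_fun (congr_arg ModuleCat.Hom.hom
    ((fdim k).ι.congr_map (congr_app h₁ W))) (t a)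
  refine h₂.trans ?_
  rw [Equiv.ofBijective_apply, totEquiv_apply]
  rfl

include r hσ in
/-- Up to an inner automorphism, a homomorphism of algebras is determined by the restriction of
scalars. -/
lemma exists_unit_conj : ∃ c : Y.BoundPathAlgˣ, ∀ (x : PathAlg k X.V) (y : PathAlg k Y.V),
    (∀ a b, (κ a).inv ≫ Functor.whiskerLeft G (evalMap (x a b)) ≫ (κ b).hom =
      evalMap (y (σ a) (σ b))) → (c⁻¹ : Y.BoundPathAlgˣ) * f (X.proj x) * c = Y.proj y := by
  let K := totEquiv κ hσ
  obtain ⟨z, hz⟩ := exists_eq_rightAct (fun W ↦ ((r.equiv W).symm.trans (K W)).toLinearMap) (by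
    intro W W' φ t
    obtain ⟨t, rfl⟩ := (r.equiv W).surjective t
    change K W' ((r.equiv W').symm _) = totMap φ (K W ((r.equiv W).symm _))
    rw [← r.natural, LinearEquiv.symm_apply_apply, LinearEquiv.symm_apply_apply]
    exact totEquiv_naturality κ hσ φ t)
  obtain ⟨z', hz'⟩ := exists_eq_rightAct (fun W ↦ ((K W).symm.trans (r.equiv W)).toLinearMap) (by
    intro W W' φ t
    obtain ⟨t, rfl⟩ := (K W).surjective t
    change r.equiv W' ((K W').symm _) = totMap φ (r.equiv W ((K W).symm _))
    rw [← totEquiv_naturality κ hσ, LinearEquiv.symm_apply_apply, LinearEquiv.symm_apply_apply]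
    exact r.natural φ t)
  replace hz (W : Y.Rep) (t : Tot W) : K W ((r.equiv W).symm t) = rightAct W t z := hz W t
  replace hz' (W : Y.Rep) (t : Tot W) : r.equiv W ((K W).symm t) = rightAct W t z' := hz' W t
  refine ⟨⟨Y.proj z, Y.proj z', ?_, ?_⟩, fun x y h ↦ ?_⟩
  · rw [← map_mul, ← map_one Y.proj]
    refine proj_eq_of_rightAct (fun W t ↦ ?_)
    rw [rightAct_mul, ← hz, ← hz', rightAct_one]
    simp
  · rw [← map_mul, ← map_one Y.proj]
    refine proj_eq_of_rightAct (fun W t ↦ ?_)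
    rw [rightAct_mul, ← hz, ← hz', rightAct_one]
    simp
  · obtain ⟨y', hy'⟩ := Y.proj_surjective (f (X.proj x))
    change Y.proj z' * f (X.proj x) * Y.proj z = Y.proj y
    rw [← hy', ← map_mul, ← map_mul]
    refine proj_eq_of_rightAct (fun W t ↦ ?_)
    obtain ⟨t, rfl⟩ := (K W).surjective t
    rw [rightAct_mul, rightAct_mul, ← hz, ← hz', LinearEquiv.symm_apply_apply,
      ← r.act W x y' hy'.symm, LinearEquiv.symm_apply_apply]
    exact totEquiv_rightAct κ hσ W t x y h

end Restriction

end BoundQuiver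

end QuiverPoints

namespace QuiverPoints

open MonoidalCategory

namespace TTFunctor

variable {k : Type*} [CommRing k]
  {R : Type*} [Category* R] [Preadditive R] [HasZeroObject R] [HasShift R ℤ]
  [∀ n : ℤ, (shiftFunctor R n).Additive] [Pretriangulated R] [Linear k R]
  [∀ n : ℤ, (shiftFunctor R n).Linear k] [MonoidalCategory R]
  {T : Type*} [Category* T] [Preadditive T] [HasZeroObject T] [HasShift T ℤ]
  [∀ n : ℤ, (shiftFunctor T n).Additive] [Pretriangulated T] [Linear k T]
  [∀ n : ℤ, (shiftFunctor T n).Linear k] [MonoidalCategory T]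
  {S : Type*} [Category* S] [Preadditive S] [HasZeroObject S] [HasShift S ℤ]
  [∀ n : ℤ, (shiftFunctor S n).Additive] [Pretriangulated S] [Linear k S]
  [∀ n : ℤ, (shiftFunctor S n).Linear k] [MonoidalCategory S]
  (u : TTFunctor k R T)

lemma whisker_id (F : TTFunctor k T S) : u.whisker (𝟙 F) = 𝟙 (u.comp F) := rfl

lemma whisker_comp {F G H : TTFunctor k T S} (α : F ⟶ G) (β : G ⟶ H) :
    u.whisker (α ≫ β) = u.whisker α ≫ u.whisker β := rfl

/-- Precomposition with a tensor triangulated functor, as a functor. -/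
def whiskerFunctor : TTFunctor k T S ⥤ TTFunctor k R S where
  obj F := u.comp F
  map α := u.whisker α

/-- Precomposition with a tensor triangulated functor, as a linear map. -/
def whiskerₗ (F G : TTFunctor k T S) : (F ⟶ G) →ₗ[k] (u.comp F ⟶ u.comp G) where
  toFun α := u.whisker α
  map_add' _ _ := rfl
  map_smul' _ _ := rfl

section Points

variable (κ : ∀ F : Points k T S, u.comp F.rep ≅ (u.onPoints F).rep)

lemma nonempty_onPointsIso (F : Points k T S) : Nonempty (u.comp F.rep ≅ (u.onPoints F).rep) :=
  (toPoint_eq_iff _ _).1 (toPoint_rep (u.onPoints F)).symm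

/-- The map on morphisms between points induced by precomposition. -/
def pullbackHom (F G : Points k T S) :
    (F.rep ⟶ G.rep) →ₗ[k] ((u.onPoints F).rep ⟶ (u.onPoints G).rep) :=
  (Linear.homCongr k (κ F) (κ G)).toLinearMap ∘ₗ u.whiskerₗ F.rep G.rep

lemma pullbackHom_apply {F G : Points k T S} (α : F.rep ⟶ G.rep) :
    u.pullbackHom κ F G α = (κ F).inv ≫ u.whisker α ≫ (κ G).hom := by
  simp [pullbackHom, Linear.homCongr]
  rfl

lemma pullbackHom_id (F : Points k T S) : u.pullbackHom κ F F (𝟙 _) = 𝟙 _ := by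
  rw [pullbackHom_apply, whisker_id, Category.id_comp, Iso.inv_hom_id]

lemma pullbackHom_comp {F G H : Points k T S} (α : F.rep ⟶ G.rep) (β : G.rep ⟶ H.rep) :
    u.pullbackHom κ F H (α ≫ β) = u.pullbackHom κ F G α ≫ u.pullbackHom κ G H β := by
  simp [pullbackHom_apply, whisker_comp]

variable [Fintype (Points k T S)] [Fintype (Points k R S)]
  (hu : Function.Bijective (u.onPoints : Points k T S → Points k R S))

/-- The homomorphism of algebras induced by precomposition. -/
def pullback : HomAlg (Points.rep : Points k T S → TTFunctor k T S) →ₐ[k]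
    HomAlg (Points.rep : Points k R S → TTFunctor k R S) :=
  HomAlg.map k (Equiv.ofBijective _ hu) (u.pullbackHom κ) (u.pullbackHom_id κ) (u.pullbackHom_comp κ)

lemma pullback_apply (α : HomAlg (Points.rep : Points k T S → TTFunctor k T S))
    (F G : Points k T S) : u.pullback κ hu α (u.onPoints F) (u.onPoints G) =
      (κ F).inv ≫ u.whisker (α F G) ≫ (κ G).hom := by
  rw [← pullbackHom_apply]
  exact HomAlg.map_apply k (Equiv.ofBijective _ hu) (u.pullbackHom κ) (u.pullbackHom_id κ)
    (u.pullbackHom_comp κ) α F G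

end Points

end TTFunctor

namespace BoundQuiver

variable {k : Type u} [Field k] {X Y : BoundQuiver.{u, v, w} k}

section Restrict

lemma comp_eq_of_squares {C : Type*} [Category* C] {P P' R R' S S' T T' : C} (i : P ≅ P')
    (i' : R ≅ R') {n : P ⟶ R} {m : P' ⟶ R'} {e : P ⟶ S} {e' : R ⟶ T} {b : S ⟶ T} {b' : S' ⟶ T'}
    {δ : S ⟶ S'} {δ' : T ⟶ T'} (h₁ : n ≫ i'.hom = i.hom ≫ m) (h₂ : n ≫ e' = e ≫ b)
    (h₃ : b ≫ δ' = δ ≫ b') : m ≫ i'.inv ≫ e' ≫ δ' = (i.inv ≫ e ≫ δ) ≫ b' := by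
  have : m ≫ i'.inv = i.inv ≫ n := by rw [Iso.eq_inv_comp, ← Category.assoc, ← h₁]; simp
  rw [reassoc_of% this, reassoc_of% h₂, h₃]
  simp

variable {G : Y.Rep ⥤ X.Rep} [G.Additive] (u : TTFunctor k Y.D X.D)
  (h : Q Y.Rep ⋙ u.functor ≅ mapCb G ⋙ Q X.Rep)

/-- The functor on objects concentrated in degree zero. -/
def singleCompIso : (singleb Y.Rep 0 ⋙ Q Y.Rep) ⋙ u.functor ≅ G ⋙ singleb X.Rep 0 ⋙ Q X.Rep :=
  Functor.isoWhiskerLeft (singleb Y.Rep 0) h ≪≫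
    Functor.isoWhiskerRight (mapCbSingleIso G 0) (Q X.Rep)

/-- The evaluation at a vertex after the functor, on objects concentrated in degree zero. -/
def singleCompEvalIso (a : X.V) :
    (singleb Y.Rep 0 ⋙ Q Y.Rep) ⋙ (u.comp (X.evalTT a)).functor ≅
      (G ⋙ X.eval a) ⋙ singleVect k :=
  Functor.isoWhiskerRight (singleCompIso u h) (mapDb (X.eval a)) ≪≫
    Functor.isoWhiskerLeft G (mapDbSingleIso (X.eval a) 0)

lemma singleCompEvalIso_naturality {a b : X.V} (α : X.eval a ⟶ X.eval b) :
    Functor.whiskerLeft (singleb Y.Rep 0 ⋙ Q Y.Rep) (u.whisker (evalTTNat α)).natTrans ≫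
      (singleCompEvalIso u h b).hom = (singleCompEvalIso u h a).hom ≫
        Functor.whiskerRight (Functor.whiskerLeft G α) (singleVect k) := by
  ext W
  have h₁ := (mapDbNat α).naturality ((singleCompIso u h).hom.app W)
  have h₂ := congr_app (mapDbSingleIso_naturality α) (G.obj W)
  simp only [NatTrans.comp_app, Functor.whiskerLeft_app, Functor.whiskerRight_app] at h₂
  change (mapDbNat α).app _ ≫ (mapDb (X.eval b)).map ((singleCompIso u h).hom.app W) ≫
    (mapDbSingleIso (X.eval b) 0).hom.app (G.obj W) =
      ((mapDb (X.eval a)).map ((singleCompIso u h).hom.app W) ≫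
        (mapDbSingleIso (X.eval a) 0).hom.app (G.obj W)) ≫ (singleVect k).map (α.app (G.obj W))
  refine (Category.assoc _ _ _).symm.trans ((congr_arg (· ≫ _) h₁.symm).trans ?_)
  refine (Category.assoc _ _ _).trans ((congr_arg (_ ≫ ·) h₂).trans ?_)
  exact (Category.assoc _ _ _).symm

/-- The isomorphism of functors on representations underlying an isomorphism of points. -/
def restrictIso {a : X.V} {b : Y.V} (e : u.comp (X.evalTT a) ≅ Y.evalTT b) :
    G ⋙ X.eval a ≅ Y.eval b :=
  ((Functor.whiskeringRight _ _ _).obj (singleVect k)).preimageIso ((singleCompEvalIso u h a).symm ≪≫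
    Functor.isoWhiskerLeft (singleb Y.Rep 0 ⋙ Q Y.Rep) (TTFunctor.natIso e) ≪≫
      mapDbSingleIso (Y.eval b) 0)

lemma whiskerRight_restrictIso_hom {a : X.V} {b : Y.V} (e : u.comp (X.evalTT a) ≅ Y.evalTT b) :
    Functor.whiskerRight (restrictIso u h e).hom (singleVect k) =
      (singleCompEvalIso u h a).inv ≫
        Functor.whiskerLeft (singleb Y.Rep 0 ⋙ Q Y.Rep) e.hom.natTrans ≫
          (mapDbSingleIso (Y.eval b) 0).hom :=
  ((Functor.whiskeringRight _ _ _).obj (singleVect k)).map_preimage _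

lemma restrictIso_naturality {a a' : X.V} {b b' : Y.V} (e : u.comp (X.evalTT a) ≅ Y.evalTT b)
    (e' : u.comp (X.evalTT a') ≅ Y.evalTT b') (α : X.eval a ⟶ X.eval a') (β : Y.eval b ⟶ Y.eval b')
    (he : e.inv ≫ u.whisker (evalTTNat α) ≫ e'.hom = evalTTNat β) :
    (restrictIso u h e).inv ≫ Functor.whiskerLeft G α ≫ (restrictIso u h e').hom = β := by
  rw [Iso.inv_comp_eq] at he ⊢
  apply ((Functor.whiskeringRight _ _ _).obj (singleVect k)).map_injective
  rw [Functor.map_comp, Functor.map_comp]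
  have h₁ := singleCompEvalIso_naturality u h α
  have h₂ : Functor.whiskerLeft (singleb Y.Rep 0 ⋙ Q Y.Rep) (mapDbNat β) ≫
      (mapDbSingleIso (Y.eval b') 0).hom = (mapDbSingleIso (Y.eval b) 0).hom ≫
        Functor.whiskerRight β (singleVect k) := mapDbSingleIso_naturality β
  have h₃ : Functor.whiskerLeft (singleb Y.Rep 0 ⋙ Q Y.Rep) (u.whisker (evalTTNat α)).natTrans ≫
      Functor.whiskerLeft (singleb Y.Rep 0 ⋙ Q Y.Rep) e'.hom.natTrans =
        Functor.whiskerLeft (singleb Y.Rep 0 ⋙ Q Y.Rep) e.hom.natTrans ≫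
          Functor.whiskerLeft (singleb Y.Rep 0 ⋙ Q Y.Rep) (mapDbNat β) :=
    congr_arg (Functor.whiskerLeft (singleb Y.Rep 0 ⋙ Q Y.Rep))
    (congr_arg TTFunctor.Hom.natTrans he)
  change Functor.whiskerRight (Functor.whiskerLeft G α) (singleVect k) ≫
    Functor.whiskerRight (restrictIso u h e').hom (singleVect k) =
      Functor.whiskerRight (restrictIso u h e).hom (singleVect k) ≫
        Functor.whiskerRight β (singleVect k)
  rw [whiskerRight_restrictIso_hom, whiskerRight_restrictIso_hom]
  exact comp_eq_of_squares _ _ h₁ h₃ h₂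

end Restrict

/-! ### Idempotents and diagonal elements -/

section Diagonal

lemma hom_point_eq_zero_or {F F' : X.DPoints} (h : F ≠ F') (α : F.rep ⟶ F'.rep)
    (β : F'.rep ⟶ F.rep) : α = 0 ∨ β = 0 := by
  have h' : X.pointEquiv F ≠ X.pointEquiv F' := fun h' ↦ h (X.pointEquiv.injective h')
  obtain ⟨x, hx⟩ := evalTTMap_surjective _ _
    ((pointIso F _ rfl).inv ≫ α ≫ (pointIso F' _ rfl).hom)
  obtain ⟨y, hy⟩ := evalTTMap_surjective _ _
    ((pointIso F' _ rfl).inv ≫ β ≫ (pointIso F _ rfl).hom)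
  rcases hom_eq_zero_or h' x y with rfl | rfl
  · left
    rw [map_zero] at hx
    simpa using hx.symm
  · right
    rw [map_zero] at hy
    simpa using hy.symm

lemma id_point_ne_zero (F : X.DPoints) : 𝟙 F.rep ≠ 0 := by
  intro h
  refine X.projOf_id_ne_zero (X.pointEquiv F) ((evalTTMap_eq_zero_iff _).1 ?_)
  rw [evalTTMap_id, ← (pointIso F _ rfl).inv_hom_id, ← Category.id_comp (pointIso F _ rfl).hom, h]
  simp

lemma mainEquiv_trivialPath (a : X.V) (F : X.DPoints) (h : X.pointEquiv F = a) :
    X.mainEquiv (X.proj (X.trivialPath a)) = HomAlg.of (𝟙 F.rep) := by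
  subst h
  ext F₁ F₂
  rw [mainEquiv_proj _ _ _ _ _ rfl rfl]
  by_cases h : F = F₁
  · subst h
    by_cases h' : F₂ = F
    · subst h'
      have : X.trivialPath (X.pointEquiv F₂) (X.pointEquiv F₂) (X.pointEquiv F₂) = 𝟙 _ :=
        dif_pos ⟨rfl, rfl⟩
      rw [this, evalTTMap_id, HomAlg.of_apply_self]
      simp
    · have : X.trivialPath (X.pointEquiv F) (X.pointEquiv F) (X.pointEquiv F₂) = 0 :=
        dif_neg (fun h ↦ h' (X.pointEquiv.injective h.2))
      rw [this, map_zero, HomAlg.of_apply_of_ne_right _ h']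
      simp
  · have : X.trivialPath (X.pointEquiv F) (X.pointEquiv F₁) (X.pointEquiv F₂) = 0 :=
      dif_neg (fun h' ↦ h (X.pointEquiv.injective h'.1).symm)
    rw [this, map_zero, HomAlg.of_apply_of_ne_left _ h]
    simp

end Diagonal

end BoundQuiver

end QuiverPoints

namespace QuiverPoints

open MonoidalCategory

namespace BoundQuiver

variable {k : Type u} [Field k] {X Y : BoundQuiver.{u, v, w} k}

section Naturality

lemma conj_trans_eq {C : Type*} [Category* C] {A A' B B' P P' S S' : C} (i : A ≅ B) (i' : A' ≅ B')
    (j : B ≅ P) (j' : B' ≅ P') (q : P ≅ S) (q' : P' ≅ S') {n : A ⟶ A'} {m : S ⟶ S'}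
    (h : q.hom ≫ m ≫ q'.inv = j.inv ≫ (i.inv ≫ n ≫ i'.hom) ≫ j'.hom) :
    (i ≪≫ j ≪≫ q).inv ≫ n ≫ (i' ≪≫ j' ≪≫ q').hom = m := by
  have : m = q.inv ≫ (q.hom ≫ m ≫ q'.inv) ≫ q'.hom := by simp
  rw [this, h]
  simp

variable {f : X.BoundPathAlg →ₐ[k] Y.BoundPathAlg} {G : Y.Rep ⥤ X.Rep} [G.Additive]
  (r : RestrictionIso f G) (u : TTFunctor k Y.D X.D) (h : Q Y.Rep ⋙ u.functor ≅ mapCb G ⋙ Q X.Rep)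
  (κ : ∀ F : X.DPoints, u.comp F.rep ≅ (u.onPoints F).rep)

/-- The map on vertices which corresponds to the map on points. -/
def vertexMap (a : X.V) : Y.V := Y.pointEquiv (u.onPoints (X.pointEquiv.symm a))

/-- The pullback of the evaluation at a vertex. -/
def compEvalIso (a : X.V) : u.comp (X.evalTT a) ≅ Y.evalTT (vertexMap u a) :=
  u.whiskerFunctor.mapIso (pointIso (X.pointEquiv.symm a) a (X.pointEquiv.apply_symm_apply a)).symm ≪≫
    κ (X.pointEquiv.symm a) ≪≫ pointIso _ _ rfl

include r h in
lemma onPoints_bijective : Function.Bijective (u.onPoints : X.DPoints → Y.DPoints) := by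
  have h₁ : Function.Bijective (vertexMap u) := vertexMap_bijective r (fun a ↦
    restrictIso u h (compEvalIso u (fun F ↦ (u.nonempty_onPointsIso F).some) a))
  have h₂ : (u.onPoints : X.DPoints → Y.DPoints) =
      Y.pointEquiv.symm ∘ vertexMap u ∘ X.pointEquiv := by
    funext F
    simp [vertexMap]
  rw [h₂]
  exact Y.pointEquiv.symm.bijective.comp (h₁.comp X.pointEquiv.bijective)

variable (hu : Function.Bijective (u.onPoints : X.DPoints → Y.DPoints))

include r h in
lemma exists_conj_eq_pullback : ∃ c : Y.BoundPathAlgˣ, ∀ x : X.BoundPathAlg,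
    Y.mainEquiv ((c⁻¹ : Y.BoundPathAlgˣ) * f x * c) = u.pullback κ hu (X.mainEquiv x) := by
  have hσ : Function.Bijective (vertexMap u) :=
    Y.pointEquiv.bijective.comp (hu.comp X.pointEquiv.symm.bijective)
  obtain ⟨c, hc⟩ := exists_unit_conj r (fun a ↦ restrictIso u h (compEvalIso u κ a)) hσ
  refine ⟨c, fun x ↦ ?_⟩
  obtain ⟨x, rfl⟩ := X.proj_surjective x
  obtain ⟨y, hy⟩ := Y.mainEquiv.surjective (u.pullback κ hu (X.mainEquiv (X.proj x)))
  obtain ⟨y, rfl⟩ := Y.proj_surjective y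
  rw [← hy]
  refine congr_arg _ (hc x y (fun a b ↦ ?_))
  apply restrictIso_naturality
  have h₁ := congr_fun (congr_fun hy (u.onPoints (X.pointEquiv.symm a)))
    (u.onPoints (X.pointEquiv.symm b))
  rw [u.pullback_apply, mainEquiv_proj y _ _ _ _ rfl rfl,
    mainEquiv_proj x _ _ a b (X.pointEquiv.apply_symm_apply a) (X.pointEquiv.apply_symm_apply b),
    u.whisker_comp, u.whisker_comp] at h₁
  exact conj_trans_eq (u.whiskerFunctor.mapIso
    (pointIso (X.pointEquiv.symm a) a (X.pointEquiv.apply_symm_apply a)).symm)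
    (u.whiskerFunctor.mapIso
      (pointIso (X.pointEquiv.symm b) b (X.pointEquiv.apply_symm_apply b)).symm) _ _
    (pointIso (u.onPoints (X.pointEquiv.symm a)) (vertexMap u a) rfl)
    (pointIso (u.onPoints (X.pointEquiv.symm b)) (vertexMap u b) rfl) h₁

lemma pullback_of_id (F : X.DPoints) :
    u.pullback κ hu (HomAlg.of (𝟙 F.rep)) = HomAlg.of (𝟙 (u.onPoints F).rep) := by
  ext F₁ F₂
  obtain ⟨F₁, rfl⟩ := hu.2 F₁
  obtain ⟨F₂, rfl⟩ := hu.2 F₂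
  rw [u.pullback_apply]
  by_cases h₁ : F = F₁
  · subst h₁
    by_cases h₂ : F₂ = F
    · subst h₂
      rw [HomAlg.of_apply_self, HomAlg.of_apply_self, u.whisker_id, Category.id_comp, Iso.inv_hom_id]
    · rw [HomAlg.of_apply_of_ne_right _ h₂, HomAlg.of_apply_of_ne_right _ (fun h ↦ h₂ (hu.1 h))]
      exact (congr_arg (_ ≫ ·) zero_comp).trans comp_zero
  · rw [HomAlg.of_apply_of_ne_left _ h₁, HomAlg.of_apply_of_ne_left _ (fun h ↦ h₁ (hu.1 h))]
    exact (congr_arg (_ ≫ ·) zero_comp).trans comp_zero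

/-- Conjugate idempotents of points are equal. -/
lemma eq_of_conj {C C' : TTAlg k Y.D} (h₁ : C * C' = 1) {F F' : Y.DPoints}
    (h : HomAlg.of (𝟙 F.rep) * C = C * HomAlg.of (𝟙 F'.rep)) : F = F' := by
  by_contra hF
  have h₂ : C F' F' = 0 := by
    have := congr_fun (congr_fun h F') F'
    rw [HomAlg.of_mul_apply_of_ne _ _ _ hF, HomAlg.mul_of_apply, Category.comp_id] at this
    exact this.symm
  have h₃ := congr_fun (congr_fun h₁ F') F'
  rw [HomAlg.mul_apply, HomAlg.one_apply_self] at h₃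
  refine id_point_ne_zero F' (h₃.symm.trans (Finset.sum_eq_zero (fun l _ ↦ ?_)))
  by_cases hl : F' = l
  · subst hl
    rw [h₂, zero_comp]
  · rcases hom_point_eq_zero_or hl (C F' l) (C' l F') with h | h
    · rw [h, zero_comp]
    · rw [h, comp_zero]

lemma apply_eq_zero_of_comm {C : TTAlg k Y.D} {F F' : Y.DPoints} (hF : F ≠ F')
    (h : HomAlg.of (𝟙 F.rep) * C = C * HomAlg.of (𝟙 F.rep)) : C F F' = 0 := by
  have := congr_fun (congr_fun h F) F'
  rwa [HomAlg.of_mul_apply, HomAlg.mul_of_apply_of_ne _ _ _ hF.symm, Category.id_comp] at this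

lemma mul_apply_of_diag {C D : TTAlg k Y.D} (hC : ∀ F F', F ≠ F' → C F F' = 0) (F F' : Y.DPoints) :
    (C * D) F F' = C F F ≫ D F F' := by
  rw [HomAlg.mul_apply]
  refine Finset.sum_eq_single _ (fun l _ hl ↦ ?_) (by simp)
  rw [hC _ _ hl.symm, zero_comp]

lemma mul_apply_of_diag' {C D : TTAlg k Y.D} (hC : ∀ F F', F ≠ F' → C F F' = 0) (F F' : Y.DPoints) :
    (D * C) F F' = D F F' ≫ C F' F' := by
  rw [HomAlg.mul_apply]
  refine Finset.sum_eq_single _ (fun l _ hl ↦ ?_) (by simp)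
  rw [hC _ _ hl, comp_zero]

include r h in
/-- If the homomorphism of algebras preserves the trivial paths, then it is induced by the
pullback of points. -/
lemma exists_eq_pullback
    (hf : ∀ a : X.V, ∃ b : Y.V, f (X.proj (X.trivialPath a)) = Y.proj (Y.trivialPath b)) :
    ∃ κ : ∀ F : X.DPoints, u.comp F.rep ≅ (u.onPoints F).rep, ∀ x : X.BoundPathAlg,
      Y.mainEquiv (f x) = u.pullback κ hu (X.mainEquiv x) := by
  let κ (F : X.DPoints) := (u.nonempty_onPointsIso F).some
  obtain ⟨c, hc⟩ := exists_conj_eq_pullback r u h κ hu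
  let C : (TTAlg k Y.D)ˣ := Units.map (Y.mainEquiv : _ →* _) c
  have hC (x : X.BoundPathAlg) : ((C⁻¹ : (TTAlg k Y.D)ˣ) : TTAlg k Y.D) * Y.mainEquiv (f x) * C =
      u.pullback κ hu (X.mainEquiv x) := by
    rw [← hc, map_mul, map_mul]
    rfl
  have hcomm (F : Y.DPoints) : HomAlg.of (𝟙 F.rep) * (C : TTAlg k Y.D) = C * HomAlg.of (𝟙 F.rep) := by
    obtain ⟨F, rfl⟩ := hu.2 F
    obtain ⟨b, hb⟩ := hf (X.pointEquiv F)
    have h₁ := hC (X.proj (X.trivialPath (X.pointEquiv F)))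
    rw [hb, mainEquiv_trivialPath _ _ (Y.pointEquiv.apply_symm_apply b),
      mainEquiv_trivialPath _ F rfl, pullback_of_id, mul_assoc, Units.inv_mul_eq_iff_eq_mul] at h₁
    have h₂ := eq_of_conj C.mul_inv h₁
    rwa [h₂] at h₁
  have hcomm' (F : Y.DPoints) : HomAlg.of (𝟙 F.rep) * ((C⁻¹ : (TTAlg k Y.D)ˣ) : TTAlg k Y.D) =
      ((C⁻¹ : (TTAlg k Y.D)ˣ) : TTAlg k Y.D) * HomAlg.of (𝟙 F.rep) := by
    rw [Units.eq_inv_mul_iff_mul_eq, ← mul_assoc, ← hcomm, mul_assoc, Units.mul_inv, mul_one]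
  have hd (F F' : Y.DPoints) (hF : F ≠ F') : (C : TTAlg k Y.D) F F' = 0 :=
    apply_eq_zero_of_comm hF (hcomm F)
  have hd' (F F' : Y.DPoints) (hF : F ≠ F') :
      ((C⁻¹ : (TTAlg k Y.D)ˣ) : TTAlg k Y.D) F F' = 0 := apply_eq_zero_of_comm hF (hcomm' F)
  let δ (F : Y.DPoints) : F.rep ≅ F.rep :=
    { hom := ((C⁻¹ : (TTAlg k Y.D)ˣ) : TTAlg k Y.D) F F
      inv := (C : TTAlg k Y.D) F F
      hom_inv_id := by rw [← mul_apply_of_diag hd', Units.inv_mul, HomAlg.one_apply_self]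
      inv_hom_id := by rw [← mul_apply_of_diag hd, Units.mul_inv, HomAlg.one_apply_self] }
  refine ⟨fun F ↦ κ F ≪≫ δ _, fun x ↦ ?_⟩
  ext F F'
  obtain ⟨F, rfl⟩ := hu.2 F
  obtain ⟨F', rfl⟩ := hu.2 F'
  have h₁ : Y.mainEquiv (f x) = C * u.pullback κ hu (X.mainEquiv x) *
      ((C⁻¹ : (TTAlg k Y.D)ˣ) : TTAlg k Y.D) := by
    rw [← hC, mul_assoc, mul_assoc, Units.mul_inv, mul_one, Units.mul_inv_cancel_left]
  rw [h₁, mul_apply_of_diag' hd', mul_apply_of_diag hd, u.pullback_apply, u.pullback_apply]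
  simp [δ]

end Naturality

/-- The description of the isomorphism in terms of the evaluations at the vertices. -/
lemma exists_description (X : BoundQuiver.{u, v, w} k) : ∃ (e : X.V ≃ X.DPoints)
    (θ : ∀ a : X.V, Q X.Rep ⋙ (e a).rep.functor ≅ X.evalD a), ∀ (x : PathAlg k X.V) (a b : X.V),
      Functor.whiskerLeft (Q X.Rep) (X.mainEquiv (X.proj x) (e a) (e b)).natTrans =
        (θ a).hom ≫ BoundQuiver.evalDMap (x a b) ≫ (θ b).inv :=
  ⟨X.pointEquiv.symm, fun a ↦ pointEvalIso _ a (X.pointEquiv.apply_symm_apply a),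
    fun _ _ _ ↦ whiskerLeft_mainEquiv _ _ _ _ _ _ _⟩

end BoundQuiver

end QuiverPoints

end

theorem mainTheorem1 (k : Type u) [Field k] :
    ∃ (_ : ∀ X : BoundQuiver.{u, v, w} k, Finite X.DPoints)
      (Φ : ∀ X : BoundQuiver.{u, v, w} k, X.BoundPathAlg ≃ₐ[k] TTAlg k X.D),
      (∀ X : BoundQuiver.{u, v, w} k,
        ∃ (e : X.V ≃ X.DPoints) (θ : ∀ a : X.V, Q X.Rep ⋙ (e a).rep.functor ≅ X.evalD a),
          ∀ (x : PathAlg k X.V) (a b : X.V),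
            Functor.whiskerLeft (Q X.Rep) (Φ X (X.proj x) (e a) (e b)).natTrans =
              (θ a).hom ≫ BoundQuiver.evalDMap (x a b) ≫ (θ b).inv) ∧
      (∀ (X Y : BoundQuiver.{u, v, w} k) (f : X.BoundPathAlg →ₐ[k] Y.BoundPathAlg)
        (G : Y.Rep ⥤ X.Rep) [G.Additive] (_ : BoundQuiver.RestrictionIso f G)
        (u : TTFunctor k Y.D X.D) (_ : Q Y.Rep ⋙ u.functor ≅ mapCb G ⋙ Q X.Rep),
        Function.Bijective (u.onPoints : X.DPoints → Y.DPoints) ∧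
        ∃ (κ : ∀ F : X.DPoints, u.comp F.rep ≅ (u.onPoints F).rep)
          (uStar : TTAlg k X.D →ₐ[k] TTAlg k Y.D) (c : Y.BoundPathAlgˣ),
          (∀ (α : TTAlg k X.D) (F F' : X.DPoints),
            uStar α (u.onPoints F) (u.onPoints F') =
              (κ F).inv ≫ u.whisker (α F F') ≫ (κ F').hom) ∧
          ((∀ a : X.V, ∃ b : Y.V, f (X.proj (X.trivialPath a)) = Y.proj (Y.trivialPath b)) →
            c = 1) ∧
          ∀ x : X.BoundPathAlg, Φ Y (c⁻¹ * f x * c) = uStar (Φ X x)) := by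
  refine ⟨fun X ↦ inferInstance, fun X ↦ X.mainEquiv, fun X ↦ X.exists_description,
    fun X Y f G _ r u h ↦ ?_⟩
  have hu := BoundQuiver.onPoints_bijective r u h
  refine ⟨hu, ?_⟩
  by_cases hf : ∀ a : X.V, ∃ b : Y.V, f (X.proj (X.trivialPath a)) = Y.proj (Y.trivialPath b)
  · obtain ⟨κ, hκ⟩ := BoundQuiver.exists_eq_pullback r u h hu hf
    exact ⟨κ, u.pullback κ hu, 1, u.pullback_apply κ hu, fun _ ↦ rfl, fun x ↦ by simpa using hκ x⟩
  · let κ (F : X.DPoints) := (u.nonempty_onPointsIso F).some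
    obtain ⟨c, hc⟩ := BoundQuiver.exists_conj_eq_pullback r u h κ hu
    exact ⟨κ, u.pullback κ hu, c, u.pullback_apply κ hu, fun h ↦ (hf h).elim, hc⟩
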